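/- For every positive integer $p$ let $n=n(p)$ be a positive integer and $b=b(p)$ a positive real number with $b\le p$, and assume that $b\to\infty$, $n\to\infty$ and $b/n\to 0$ as $p\to\infty$. For real random variables $X_1,\dots,X_k$ with moments of all orders, let $$\mathbf C(X_1,\dots,X_k)=i^{-k}\,\frac{\partial^k}{\partial t_1\cdots\partial t_k}\log \mathbf E\exp\Big(\sum_{j=1}^k i t_jX_j\Big)\Big|_{t_1=\dots=t_k=0}$$ denote their joint cumulant. Let $\{Z_j\}_{j\in\mathbb Z}$ be a (strictly) stationary sequence of real random variables such that $\mathbf E|Z_0|^k<\infty$ for all $k\ge1$, $\mathbf EZ_0=0$, and $$\sum_{j_1\in\mathbb Z}\cdots\sum_{j_r\in\mathbb Z}|\mathbf C(Z_0,Z_{j_1},\dots,Z_{j_r})|<\infty\qquad\text{for all } r\ge 1 .$$ Let $\{Z^{(i)}_j\}_{j\in\mathbb Z}$, $i=1,2,\dots$, be an i.i.d. family of copies of the sequence $\{Z_j\}_{j\in\mathbb Z}$. Let $X=X^{(p)}$ be the $n\times p$ matrix with entries $X(i,j)=Z^{(i)}_j/\sqrt n$, let $B=B^{(p)}$ be the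 $p\times p$ matrix with $B(i,j)=1$ if $|i-j|\le b$ and $B(i,j)=0$ otherwise, and let $Y=Y^{(p)}$ be the random symmetric $p\times p$ matrix with entries $Y(i,j)=B(i,j)\,(X^TX)(i,j)$. For $i,j\in\mathbb Z$ put $R(j)=\operatorname{Cov}(Z_0,Z_j)$, $R^{(0)}_i=\delta_{i0}$, $R^{(m)}_i=(\underbrace{R\star\cdots\star R}_{m})(i)$ for $m\ge1$, where $(F\star G)(j)=\sum_{k\in\mathbb Z}F(j-k)G(k)$, and $$Q_{ij}=\sum_{\ell\in\mathbb Z}\mathbf C(Z_i,Z_0,Z_{j+\ell},Z_\ell).$$ Then the series defining $R^{(m)}_i$ and $Q_{ij}$, and the double series below, converge absolutely, and for every integer $r\ge2$ and all positive integers $k_1,\dots,k_r$, $$\lim_{p\to\infty}\Big(\frac np\Big)^{r/2}\mathbf C\big(\operatorname{trace}Y^{k_1},\dots,\operatorname{trace}Y^{k_r}\big)=\begin{cases}0,& r>2,\\[2pt] k_1k_2\Big(2R^{(k_1+k_2)}_0+\sum_{i,j\in\mathbb Z}R^{(k_1-1)}_i\,Q_{ij}\,R^{(k_2-1)}_j\Big),&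 r=2.\end{cases}$$ -/

import Mathlib

open MeasureTheory ProbabilityTheory Filter Topology

namespace BandedCovariance

noncomputable section

/-- The joint cumulant `C(X₁, …, X_k)` of real random variables under the probability measure `P`:
`i^{-k} ∂^k/∂t₁⋯∂t_k log E exp(∑ⱼ i tⱼ Xⱼ)` at `t₁ = ⋯ = t_k = 0`. The expectation is `1` at
`t = 0`, so that the principal branch of the logarithm is the relevant one near `0`; the mixed
partial derivative is the `k`-th derivative applied to the standard basis vectors. -/
def jointCumulant {Ω : Type*} [MeasurableSpace Ω] (P : Measure Ω) {k : ℕ}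
    (X : Fin k → Ω → ℝ) : ℝ :=
  ((Complex.I ^ k)⁻¹ *
    iteratedFDeriv ℝ k
      (fun t : Fin k → ℝ =>
        Complex.log (∫ ω, Complex.exp (∑ j, Complex.I * ((t j : ℝ) : ℂ) * ((X j ω : ℝ) : ℂ)) ∂P))
      0 (fun j => Pi.single j (1 : ℝ))).re

/-- The growth conditions on the number of samples `n = n(p)` and the band width `b = b(p)`:
for every positive integer `p`, `n(p)` is a positive integer and `b(p)` is a positive number with
`b(p) ≤ p`; as `p → ∞`, `b → ∞`, `n → ∞` and `b / n → 0`. -/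
structure GrowthConditions (n : ℕ → ℕ) (b : ℕ → ℝ) : Prop where
  n_pos : ∀ p, 0 < p → 0 < n p
  b_pos : ∀ p, 0 < p → 0 < b p
  b_le : ∀ p, 0 < p → b p ≤ p
  b_tendsto : Tendsto b atTop atTop
  n_tendsto : Tendsto n atTop atTop
  ratio_tendsto : Tendsto (fun p => b p / (n p : ℝ)) atTop (𝓝 0)

/-- `Z` is a (strictly) stationary sequence of real random variables: all its shifts have the same
law, as random elements of `ℤ → ℝ` with the product σ-algebra. -/
structure IsStationary {Ω : Type*} [MeasurableSpace Ω] (P : Measure Ω) (Z : ℤ → Ω → ℝ) :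
    Prop where
  measurable : ∀ j, Measurable (Z j)
  shift : ∀ m : ℤ, IdentDistrib (fun ω j => Z (j + m) ω) (fun ω j => Z j ω) P P

/-- Finite moments of all orders, mean zero, and joint cumulant summability. -/
structure MomentConditions {Ω : Type*} [MeasurableSpace Ω] (P : Measure Ω) (Z : ℤ → Ω → ℝ) :
    Prop where
  moments : ∀ k : ℕ, 1 ≤ k → Integrable (fun ω => |Z 0 ω| ^ k) P
  mean_zero : ∫ ω, Z 0 ω ∂P = 0
  cumulant_summable : ∀ r : ℕ, 1 ≤ r →
    Summable (fun j : Fin r → ℤ =>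
      |jointCumulant P (fun s : Fin (r + 1) => Z ((Fin.cons 0 j : Fin (r + 1) → ℤ) s))|)

/-- `W 0, W 1, W 2, …` is an i.i.d. family of copies of the whole sequence `Z` (which may live on
another probability space). -/
structure IsIIDCopies {Ω Ω₀ : Type*} [MeasurableSpace Ω] [MeasurableSpace Ω₀]
    (P : Measure Ω) (P₀ : Measure Ω₀) (W : ℕ → ℤ → Ω → ℝ) (Z : ℤ → Ω₀ → ℝ) : Prop where
  measurable : ∀ i j, Measurable (W i j)
  identDistrib : ∀ i, IdentDistrib (fun ω j => W i j ω) (fun ω j => Z j ω) P P₀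
  indep : iIndepFun (fun i ω j => W i j ω) P

/-- The `n`-by-`p` data matrix with entries `X(i, j) = Z_j^{(i)} / √n`. The columns are
`j = 1, …, p`, hence the shift by one in the `0`-based index `j : Fin p`; the i.i.d. copies are
numbered from `0`. -/
def dataMatrix {Ω : Type*} (W : ℕ → ℤ → Ω → ℝ) (n p : ℕ) (ω : Ω) : Matrix (Fin n) (Fin p) ℝ :=
  Matrix.of fun i j => W (i : ℕ) (((j : ℕ) : ℤ) + 1) ω / √(n : ℝ)

/-- The deterministic `p`-by-`p` matrix of zeros and ones with band width `b`. -/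
def bandMatrix (p : ℕ) (b : ℝ) : Matrix (Fin p) (Fin p) ℝ :=
  open Classical in
  Matrix.of fun i j => if |((i : ℕ) : ℝ) - ((j : ℕ) : ℝ)| ≤ b then 1 else 0

/-- The banded sample covariance matrix `Y`, with entries `Y(i, j) = B(i, j) (Xᵀ X)(i, j)`. -/
def bandedCov {Ω : Type*} (W : ℕ → ℤ → Ω → ℝ) (n p : ℕ) (b : ℝ) (ω : Ω) :
    Matrix (Fin p) (Fin p) ℝ :=
  Matrix.of fun i j =>
    bandMatrix p b i j * ((dataMatrix W n p ω).transpose * dataMatrix W n p ω) i j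

/-- `R(j) = Cov(Z₀, Z_j)`. -/
def autocov {Ω : Type*} [MeasurableSpace Ω] (P : Measure Ω) (Z : ℤ → Ω → ℝ) (j : ℤ) : ℝ :=
  covariance (Z 0) (Z j) P

/-- Convolution of functions on `ℤ`: `(F ⋆ G)(j) = ∑_{k ∈ ℤ} F(j - k) G(k)`. -/
def conv (F G : ℤ → ℝ) (j : ℤ) : ℝ := ∑' k : ℤ, F (j - k) * G k

/-- The convolution powers `R_i^{(m)} = (R ⋆ ⋯ ⋆ R)(i)` (`m` factors), `R_i^{(0)} = δ_{i0}`. -/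
def autocovPow {Ω : Type*} [MeasurableSpace Ω] (P : Measure Ω) (Z : ℤ → Ω → ℝ) : ℕ → ℤ → ℝ
  | 0 => fun i => if i = 0 then 1 else 0
  | m + 1 => conv (autocov P Z) (autocovPow P Z m)

/-- The summand `C(Z_i, Z_0, Z_{j+ℓ}, Z_ℓ)` of `Q_{ij}`. -/
def QTerm {Ω : Type*} [MeasurableSpace Ω] (P : Measure Ω) (Z : ℤ → Ω → ℝ) (i j l : ℤ) : ℝ :=
  jointCumulant P ![Z i, Z 0, Z (j + l), Z l]

/-- `Q_{ij} = ∑_{ℓ ∈ ℤ} C(Z_i, Z_0, Z_{j+ℓ}, Z_ℓ)`. -/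
def Q {Ω : Type*} [MeasurableSpace Ω] (P : Measure Ω) (Z : ℤ → Ω → ℝ) (i j : ℤ) : ℝ :=
  ∑' l : ℤ, QTerm P Z i j l

end

end BandedCovariance

/-!
The joint cumulant of the traces is expanded twice. Each trace is a sum over cyclic words in the
columns `1, …, p`, each entry of the data matrix product is a sum over the `n` samples, and joint
cumulants of products are sums over the partitions `σ` of the factors that connect the products
(`IsCumulant.products`, `cum_prod_fibres`). Independence of the samples forces one sample per
block, so that a partition of `K` letters carries the factor `n ^ (|σ| - K)`
(`jointCumulant_trace`, `jointCumulant_trace_eq_sum`).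

The key estimate is `partition_bound`: for a connecting `σ`, the sum over all the words is `O(p *
b ^ (K - |σ| - 1))`. To prove it, the cumulant of the pairs in a block of `σ` is expanded once
more into cumulants of the single variables `Z_j`, which gives partitions of the half-edges of the
graph of the words. By summability of the cumulants, every block of half-edges ties its positions
together at a bounded cost, and every remaining degree of freedom costs a factor `b` because of
the band, except for the global translation, which costs `p` (`exists_explored_univ`). The degrees
of freedom are counted by the dimension of a space of functions over the field with two elements:
functions that are constant on the blocks (`finrank_clusterSpace_add_card_le`). Centering of `Z`
excludes blocks with one half-edge. Since `K - |σ| ≥ r - 1` (`card_conn_add_le`), after the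
normalization every term is `O((b / n) ^ (K - |σ| - r / 2) * (b / p) ^ (r / 2 - 1))`, which tends
to zero unless `r = 2` and `|σ| = K - 1` (`tendsto_minor`).

For `r = 2` the surviving partitions have one block with one letter of each word, all the other
blocks being singletons (`leading_partitions`); there are `k₁ k₂` of them, and rotating the words
shows that they all contribute the same (`sum_leading_partition`). A singleton contributes a
factor `R`, the pair contributes the covariance of two products, that is a fourth cumulant plus
two products of covariances (`pairCum_pair`). By dominated convergence the average over the
translations removes the band and the boundary (`tendsto_average`), and the remaining sum over the
increments of the two words is a convolution (`tsum_two_paths`, `tsum_paths_pairKernel`).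
-/

namespace BandedCovariance

noncomputable section

set_option linter.unusedSectionVars false

/-! ### Set partitions and the moment-cumulant relation -/

section Partitions

variable {ι S : Type*} [DecidableEq ι] [DecidableEq S]

/-- The set partitions of the finite set `A`, each one given as the set of its blocks. -/
def parts (A : Finset ι) : Finset (Finset (Finset ι)) :=
  open Classical in
  A.powerset.powerset.filter fun π =>
    ∅ ∉ π ∧ (∀ B ∈ π, ∀ C ∈ π, ∀ x, x ∈ B → x ∈ C → B = C) ∧ ∀ x ∈ A, ∃ B ∈ π, x ∈ B

/-- The multiplicative weight of a partition: the product of the weights of its blocks. -/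
def wt {R : Type*} [CommRing R] (c : Finset ι → R) (π : Finset (Finset ι)) : R := ∏ B ∈ π, c B

theorem mem_parts {A : Finset ι} {π : Finset (Finset ι)} :
    π ∈ parts A ↔ (∀ B ∈ π, B ⊆ A) ∧ ∅ ∉ π ∧
      (∀ B ∈ π, ∀ C ∈ π, ∀ x, x ∈ B → x ∈ C → B = C) ∧ ∀ x ∈ A, ∃ B ∈ π, x ∈ B := by
  classical
  simp only [parts, Finset.mem_filter, Finset.mem_powerset, Finset.subset_iff (s₁ := π)]

theorem parts_empty : parts (∅ : Finset ι) = {∅} := by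
  ext π
  rw [mem_parts, Finset.mem_singleton]
  constructor
  · rintro ⟨h1, h2, -, -⟩
    rw [Finset.eq_empty_iff_forall_notMem]
    intro B hB
    have := Finset.subset_empty.1 (h1 B hB)
    exact h2 (this ▸ hB)
  · rintro rfl
    simp

/-- A set `U` of fibres of `g` is closed for `π` if no block of `π` meets both a fibre in `U`
and a fibre outside `U`. -/
def IsClosedUnder (g : ι → S) (π : Finset (Finset ι)) (U : Finset S) : Prop :=
  ∀ B ∈ π, ∀ x ∈ B, ∀ y ∈ B, g x ∈ U → g y ∈ U

variable [Fintype ι]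

/-- The union of the fibres of `g` over `T`. -/
def pre (g : ι → S) (T : Finset S) : Finset ι := Finset.univ.filter fun x => g x ∈ T

@[simp] theorem mem_pre {g : ι → S} {T : Finset S} {x : ι} : x ∈ pre g T ↔ g x ∈ T := by
  simp [pre]

theorem pre_id (A : Finset ι) : pre id A = A := by ext; simp

theorem pre_empty (g : ι → S) : pre g ∅ = ∅ := by ext; simp

/-- The partitions of the union of the fibres over `T` that connect these fibres: the join of the
partition with the partition into fibres is trivial. -/
def conn (g : ι → S) (T : Finset S) : Finset (Finset (Finset ι)) :=
  open Classical in
  (parts (pre g T)).filter fun π => ∀ U ⊆ T, U.Nonempty → IsClosedUnder g π U → U = T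

theorem mem_conn {g : ι → S} {T : Finset S} {π : Finset (Finset ι)} :
    π ∈ conn g T ↔ π ∈ parts (pre g T) ∧
      ∀ U ⊆ T, U.Nonempty → IsClosedUnder g π U → U = T := by
  classical
  simp [conn]

/-- The connected component of the fibre over `s`: the smallest closed subset containing `s`. -/
def comp (g : ι → S) (π : Finset (Finset ι)) (S' : Finset S) (s : S) : Finset S :=
  open Classical in
  S'.filter fun t => ∀ U ⊆ S', s ∈ U → IsClosedUnder g π U → t ∈ U

theorem comp_subset (g : ι → S) (π : Finset (Finset ι)) (S' : Finset S) (s : S) :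
    comp g π S' s ⊆ S' := by
  classical
  exact Finset.filter_subset _ _

theorem mem_comp_self {g : ι → S} {π : Finset (Finset ι)} {S' : Finset S} {s : S} (hs : s ∈ S') :
    s ∈ comp g π S' s := by
  classical
  simp only [comp, Finset.mem_filter]
  exact ⟨hs, fun U _ h _ => h⟩

theorem comp_subset_of_closed {g : ι → S} {π : Finset (Finset ι)} {S' U : Finset S} {s : S}
    (hU : U ⊆ S') (hs : s ∈ U) (hc : IsClosedUnder g π U) : comp g π S' s ⊆ U := by
  classical
  intro t ht
  simp only [comp, Finset.mem_filter] at ht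
  exact ht.2 U hU hs hc

theorem comp_closed {g : ι → S} {π : Finset (Finset ι)} {S' : Finset S} {s : S}
    (hπ : π ∈ parts (pre g S')) : IsClosedUnder g π (comp g π S' s) := by
  classical
  intro B hB x hx y hy h
  simp only [comp, Finset.mem_filter] at h ⊢
  refine ⟨?_, fun U hU hsU hc => hc B hB x hx y hy (h.2 U hU hsU hc)⟩
  have := (mem_parts.1 hπ).1 B hB hy
  simpa using this

theorem IsClosedUnder.sdiff {g : ι → S} {π : Finset (Finset ι)} {T U : Finset S}
    (hT : IsClosedUnder g π T) (hU : IsClosedUnder g π U) : IsClosedUnder g π (T \ U) := by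
  intro B hB x hx y hy h
  rw [Finset.mem_sdiff] at h ⊢
  exact ⟨hT B hB x hx y hy h.1, fun h' => h.2 (hU B hB y hy x hx h')⟩

/-- Restriction of a partition to a closed set of fibres. -/
theorem filter_mem_parts {g : ι → S} {π : Finset (Finset ι)} {S' U : Finset S}
    (hπ : π ∈ parts (pre g S')) (hU : U ⊆ S') (hc : IsClosedUnder g π U) :
    π.filter (fun B => B ⊆ pre g U) ∈ parts (pre g U) := by
  obtain ⟨h1, h2, h3, h4⟩ := mem_parts.1 hπ
  rw [mem_parts]
  refine ⟨fun B hB => (Finset.mem_filter.1 hB).2, fun h => h2 (Finset.mem_filter.1 h).1,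
    fun B hB C hC => h3 B (Finset.mem_filter.1 hB).1 C (Finset.mem_filter.1 hC).1, ?_⟩
  intro x hx
  rw [mem_pre] at hx
  obtain ⟨B, hB, hxB⟩ := h4 x (by simpa using hU hx)
  refine ⟨B, Finset.mem_filter.2 ⟨hB, fun y hy => ?_⟩, hxB⟩
  rw [mem_pre]
  exact hc B hB x hxB y hy hx

theorem comp_filter_mem_conn {g : ι → S} {π : Finset (Finset ι)} {S' : Finset S} {s : S}
    (hs : s ∈ S') (hπ : π ∈ parts (pre g S')) :
    π.filter (fun B => B ⊆ pre g (comp g π S' s)) ∈ conn g (comp g π S' s) := by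
  have hcl : IsClosedUnder g π (comp g π S' s) := comp_closed hπ
  rw [mem_conn]
  refine ⟨filter_mem_parts hπ (comp_subset _ _ _ _) hcl, fun U hU hne hc => ?_⟩
  have hUc : IsClosedUnder g π U := by
    intro B hB x hx y hy hxU
    refine hc B (Finset.mem_filter.2 ⟨hB, fun z hz => ?_⟩) x hx y hy hxU
    rw [mem_pre]
    exact hcl B hB x hx z hz (hU hxU)
  have hUS := hU.trans (comp_subset g π S' s)
  by_cases hsU : s ∈ U
  · exact hU.antisymm (comp_subset_of_closed hUS hsU hUc)
  · exfalso
    have := comp_subset_of_closed (s := s) (Finset.sdiff_subset.trans (comp_subset g π S' s))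
      (Finset.mem_sdiff.2 ⟨mem_comp_self hs, hsU⟩) (hcl.sdiff hUc)
    obtain ⟨t, ht⟩ := hne
    exact (Finset.mem_sdiff.1 (this (hU ht))).2 ht

theorem union_mem_parts {A B : Finset ι} (hAB : Disjoint A B) {π₁ π₂ : Finset (Finset ι)}
    (h₁ : π₁ ∈ parts A) (h₂ : π₂ ∈ parts B) : π₁ ∪ π₂ ∈ parts (A ∪ B) := by
  obtain ⟨a1, a2, a3, a4⟩ := mem_parts.1 h₁
  obtain ⟨b1, b2, b3, b4⟩ := mem_parts.1 h₂
  rw [mem_parts]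
  refine ⟨?_, ?_, ?_, ?_⟩
  · intro C hC
    rcases Finset.mem_union.1 hC with h | h
    · exact (a1 C h).trans Finset.subset_union_left
    · exact (b1 C h).trans Finset.subset_union_right
  · rw [Finset.mem_union]; tauto
  · intro C hC D hD x hxC hxD
    rcases Finset.mem_union.1 hC with h | h <;> rcases Finset.mem_union.1 hD with h' | h'
    · exact a3 C h D h' x hxC hxD
    · exact absurd (b1 D h' hxD) (Finset.disjoint_left.1 hAB (a1 C h hxC))
    · exact absurd (b1 C h hxC) (Finset.disjoint_left.1 hAB (a1 D h' hxD))
    · exact b3 C h D h' x hxC hxD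
  · intro x hx
    rcases Finset.mem_union.1 hx with h | h
    · obtain ⟨C, hC, hx⟩ := a4 x h
      exact ⟨C, Finset.mem_union_left _ hC, hx⟩
    · obtain ⟨C, hC, hx⟩ := b4 x h
      exact ⟨C, Finset.mem_union_right _ hC, hx⟩

theorem filter_union_left {A B : Finset ι} (hAB : Disjoint A B) {π₁ π₂ : Finset (Finset ι)}
    (h₁ : π₁ ∈ parts A) (h₂ : π₂ ∈ parts B) : (π₁ ∪ π₂).filter (fun C => C ⊆ A) = π₁ := by
  obtain ⟨a1, a2, a3, a4⟩ := mem_parts.1 h₁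
  obtain ⟨b1, b2, b3, b4⟩ := mem_parts.1 h₂
  ext C
  simp only [Finset.mem_filter, Finset.mem_union]
  constructor
  · rintro ⟨h | h, hC⟩
    · exact h
    · exfalso
      obtain ⟨x, hx⟩ := Finset.nonempty_iff_ne_empty.2 (fun h0 : C = ∅ => b2 (h0 ▸ h))
      exact Finset.disjoint_left.1 hAB (hC hx) (b1 C h hx)
  · exact fun h => ⟨Or.inl h, a1 C h⟩

theorem disjoint_parts {A B : Finset ι} (hAB : Disjoint A B) {π₁ π₂ : Finset (Finset ι)}
    (h₁ : π₁ ∈ parts A) (h₂ : π₂ ∈ parts B) : Disjoint π₁ π₂ := by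
  obtain ⟨a1, a2, a3, a4⟩ := mem_parts.1 h₁
  obtain ⟨b1, b2, b3, b4⟩ := mem_parts.1 h₂
  rw [Finset.disjoint_left]
  intro C hC hC'
  obtain ⟨x, hx⟩ := Finset.nonempty_iff_ne_empty.2 (fun h0 : C = ∅ => a2 (h0 ▸ hC))
  exact Finset.disjoint_left.1 hAB (a1 C hC hx) (b1 C hC' hx)

theorem disjoint_pre (g : ι → S) {T T' : Finset S} (h : Disjoint T T') :
    Disjoint (pre g T) (pre g T') := by
  rw [Finset.disjoint_left] at h ⊢
  intro x; simpa using @h (g x)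

theorem pre_union_sdiff (g : ι → S) {T S' : Finset S} (h : T ⊆ S') :
    pre g T ∪ pre g (S' \ T) = pre g S' := by
  ext x
  simp only [Finset.mem_union, mem_pre, Finset.mem_sdiff]
  have := @h (g x)
  tauto

theorem comp_union {g : ι → S} {T S' : Finset S} {s : S} (hT : T ⊆ S') (hs : s ∈ T)
    {π₁ π₂ : Finset (Finset ι)} (h₁ : π₁ ∈ conn g T) (h₂ : π₂ ∈ parts (pre g (S' \ T))) :
    comp g (π₁ ∪ π₂) S' s = T := by
  obtain ⟨hp, hconn⟩ := mem_conn.1 h₁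
  have hdis := disjoint_pre g (T := T) (T' := S' \ T) Finset.disjoint_sdiff
  have hpu : π₁ ∪ π₂ ∈ parts (pre g S') := by
    rw [← pre_union_sdiff g hT]
    exact union_mem_parts hdis hp h₂
  have hTc : IsClosedUnder g (π₁ ∪ π₂) T := by
    intro B hB x hx y hy h
    rcases Finset.mem_union.1 hB with h' | h'
    · simpa using (mem_parts.1 hp).1 B h' hy
    · have := (mem_parts.1 h₂).1 B h' hx
      simp only [mem_pre, Finset.mem_sdiff] at this
      exact absurd h this.2
  have hsub := comp_subset_of_closed (s := s) hT hs hTc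
  refine hconn _ hsub ⟨s, mem_comp_self (hT hs)⟩ ?_
  intro B hB
  exact comp_closed hpu B (Finset.mem_union_left _ hB)

/-- Sorting the partitions of the union of the fibres over `S'` by the component of the fibre over
a fixed point `s`. -/
theorem sum_parts_split {R : Type*} [CommRing R] (c : Finset ι → R) (g : ι → S) (S' : Finset S)
    {s : S} (hs : s ∈ S') :
    ∑ π ∈ parts (pre g S'), wt c π =
      ∑ T ∈ S'.powerset.filter (fun T => s ∈ T),
        (∑ π ∈ conn g T, wt c π) * ∑ π ∈ parts (pre g (S' \ T)), wt c π := by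
  classical
  rw [← Finset.sum_fiberwise_of_maps_to (s := parts (pre g S'))
    (t := S'.powerset.filter (fun T => s ∈ T)) (g := fun π => comp g π S' s)
    (fun π _ => Finset.mem_filter.2
      ⟨Finset.mem_powerset.2 (comp_subset _ _ _ _), mem_comp_self hs⟩)]
  refine Finset.sum_congr rfl fun T hT => ?_
  obtain ⟨hT, hsT⟩ := Finset.mem_filter.1 hT
  rw [Finset.mem_powerset] at hT
  have hdis := disjoint_pre g (T := T) (T' := S' \ T) Finset.disjoint_sdiff
  rw [Finset.sum_mul_sum, ← Finset.sum_product']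
  symm
  refine Finset.sum_bij (fun q _ => q.1 ∪ q.2) ?_ ?_ ?_ ?_
  · rintro ⟨π₁, π₂⟩ hq
    obtain ⟨h₁, h₂⟩ := Finset.mem_product.1 hq
    refine Finset.mem_filter.2 ⟨?_, comp_union hT hsT h₁ h₂⟩
    rw [← pre_union_sdiff g hT]
    exact union_mem_parts hdis (mem_conn.1 h₁).1 h₂
  · rintro ⟨π₁, π₂⟩ hq ⟨ρ₁, ρ₂⟩ hr h
    obtain ⟨h₁, h₂⟩ := Finset.mem_product.1 hq
    obtain ⟨k₁, k₂⟩ := Finset.mem_product.1 hr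
    dsimp only at h h₁ h₂ k₁ k₂
    have e1 : π₁ = ρ₁ := by
      rw [← filter_union_left hdis (mem_conn.1 h₁).1 h₂, h,
        filter_union_left hdis (mem_conn.1 k₁).1 k₂]
    have e2 : π₂ = ρ₂ := by
      rw [← filter_union_left hdis.symm h₂ (mem_conn.1 h₁).1, Finset.union_comm, h,
        Finset.union_comm, filter_union_left hdis.symm k₂ (mem_conn.1 k₁).1]
    rw [e1, e2]
  · intro π hπ
    obtain ⟨hπ, hc⟩ := Finset.mem_filter.1 hπ
    have hcl : IsClosedUnder g π T := hc ▸ comp_closed hπ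
    have hcl' : IsClosedUnder g π (S' \ T) := by
      refine IsClosedUnder.sdiff (fun B hB x _ y hy _ => ?_) hcl
      simpa using (mem_parts.1 hπ).1 B hB hy
    refine ⟨(π.filter (fun B => B ⊆ pre g T), π.filter (fun B => B ⊆ pre g (S' \ T))),
      Finset.mem_product.2 ⟨?_, filter_mem_parts hπ Finset.sdiff_subset hcl'⟩, ?_⟩
    · have := comp_filter_mem_conn hs hπ
      rwa [hc] at this
    · ext B
      simp only [Finset.mem_union, Finset.mem_filter, ← and_or_left, and_iff_left_iff_imp]
      intro hB
      obtain ⟨x, hx⟩ := Finset.nonempty_iff_ne_empty.2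
        (fun h0 : B = ∅ => (mem_parts.1 hπ).2.1 (h0 ▸ hB))
      by_cases hxT : g x ∈ T
      · left
        intro y hy
        rw [mem_pre]
        exact hcl B hB x hx y hy hxT
      · right
        intro y hy
        rw [mem_pre]
        refine hcl' B hB x hx y hy (Finset.mem_sdiff.2 ⟨?_, hxT⟩)
        simpa using (mem_parts.1 hπ).1 B hB hx
  · rintro ⟨π₁, π₂⟩ hq
    obtain ⟨h₁, h₂⟩ := Finset.mem_product.1 hq
    exact (Finset.prod_union (disjoint_parts hdis (mem_conn.1 h₁).1 h₂)).symm

theorem singleton_mem_parts {A : Finset ι} (hA : A.Nonempty) :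
    ({A} : Finset (Finset ι)) ∈ parts A := by
  rw [mem_parts]
  refine ⟨by simp, by simpa using hA.ne_empty.symm, ?_, by simp⟩
  intro B hB C hC _ _ _
  rw [Finset.mem_singleton.1 hB, Finset.mem_singleton.1 hC]

theorem conn_id {A : Finset ι} (hA : A.Nonempty) : conn id A = {{A}} := by
  ext π
  rw [mem_conn, pre_id, Finset.mem_singleton]
  constructor
  · rintro ⟨hπ, hc⟩
    obtain ⟨h1, h2, h3, h4⟩ := mem_parts.1 hπ
    have key : ∀ B ∈ π, B = A := by
      intro B hB
      refine hc B (h1 B hB) (Finset.nonempty_iff_ne_empty.2 (fun h0 : B = ∅ => h2 (h0 ▸ hB))) ?_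
      intro C hC x hx y hy hxB
      rw [h3 B hB C hC x hxB hx]
      exact hy
    obtain ⟨x, hx⟩ := hA
    obtain ⟨B, hB, -⟩ := h4 x hx
    ext C
    rw [Finset.mem_singleton]
    refine ⟨key C, ?_⟩
    rintro rfl
    rwa [key B hB] at hB
  · rintro rfl
    refine ⟨singleton_mem_parts hA, fun U hU hne hc => hU.antisymm fun y hy => ?_⟩
    obtain ⟨x, hx⟩ := hne
    exact hc A (by simp) x (hU hx) y hy hx

end Partitions

section IsCumulant

variable {ι : Type*} [DecidableEq ι] [Fintype ι] {R : Type*} [CommRing R]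

/-- `c` is the cumulant function of the moment function `m`: every moment is the sum over set
partitions of the products of the cumulants of the blocks. -/
def IsCumulant (m c : Finset ι → R) : Prop := ∀ A, m A = ∑ π ∈ parts A, wt c π

theorem IsCumulant.empty {m c : Finset ι → R} (h : IsCumulant m c) : m ∅ = 1 := by
  rw [h ∅, parts_empty]; simp [wt]

/-- The recursion of moments and cumulants, sorting by the block of a fixed element. -/
theorem IsCumulant.rec_eq {m c : Finset ι → R} (h : IsCumulant m c) {A : Finset ι} {a : ι}
    (ha : a ∈ A) : m A = ∑ B ∈ A.powerset.filter (fun B => a ∈ B), c B * m (A \ B) := by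
  have := sum_parts_split c id A ha
  rw [pre_id] at this
  rw [h A, this]
  refine Finset.sum_congr rfl fun B hB => ?_
  rw [conn_id ⟨a, (Finset.mem_filter.1 hB).2⟩, pre_id, h (A \ B)]
  simp [wt]

/-- The recursion at one element of each set characterizes the cumulants. -/
theorem isCumulant_of_rec {m c : Finset ι → R} (h0 : m ∅ = 1)
    (h : ∀ A : Finset ι, A.Nonempty → ∃ a ∈ A,
      m A = ∑ B ∈ A.powerset.filter (fun B => a ∈ B), c B * m (A \ B)) : IsCumulant m c := by
  intro A
  induction A using Finset.strongInduction with
  | H A ih =>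
    rcases A.eq_empty_or_nonempty with rfl | hA
    · rw [h0, parts_empty]; simp [wt]
    obtain ⟨a, ha, h⟩ := h A hA
    have := sum_parts_split c id A ha
    rw [pre_id] at this
    rw [h, this]
    refine Finset.sum_congr rfl fun B hB => ?_
    obtain ⟨hB, haB⟩ := Finset.mem_filter.1 hB
    rw [Finset.mem_powerset] at hB
    rw [conn_id ⟨a, haB⟩, pre_id, ih (A \ B) (Finset.sdiff_ssubset hB ⟨a, haB⟩)]
    simp [wt]

theorem IsCumulant.unique {m c c' : Finset ι → R} (h : IsCumulant m c) (h' : IsCumulant m c')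
    {A : Finset ι} (hA : A.Nonempty) : c A = c' A := by
  induction A using Finset.strongInduction with
  | H A ih =>
    obtain ⟨a, ha⟩ := hA
    have e := (h.rec_eq ha).symm.trans (h'.rec_eq ha)
    have hmem : A ∈ A.powerset.filter (fun B => a ∈ B) := by simp [ha]
    rw [← Finset.add_sum_erase _ _ hmem, ← Finset.add_sum_erase _ _ hmem] at e
    have e2 : ∀ B ∈ (A.powerset.filter (fun B => a ∈ B)).erase A,
        c B * m (A \ B) = c' B * m (A \ B) := by
      intro B hB
      obtain ⟨hne, hB⟩ := Finset.mem_erase.1 hB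
      obtain ⟨hB, haB⟩ := Finset.mem_filter.1 hB
      rw [ih B ((Finset.mem_powerset.1 hB).ssubset_of_ne hne) ⟨a, haB⟩]
    rw [Finset.sum_congr rfl e2] at e
    simpa [h.empty] using e

/-- **Leonov-Shiryaev formula**: the cumulants of the products over the fibres of `g` are sums over
the partitions that connect the fibres. -/
theorem IsCumulant.products {S : Type*} [DecidableEq S] [Fintype S] {m c : Finset ι → R}
    (h : IsCumulant m c) (g : ι → S) :
    IsCumulant (fun T => m (pre g T)) (fun T => ∑ π ∈ conn g T, wt c π) := by
  refine isCumulant_of_rec ?_ ?_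
  · show m (pre g ∅) = 1
    rw [pre_empty, h.empty]
  · rintro T ⟨s, hs⟩
    refine ⟨s, hs, ?_⟩
    rw [h, sum_parts_split c g T hs]
    exact Finset.sum_congr rfl fun U _ => by rw [h (pre g (T \ U))]

theorem IsCumulant.map {R' : Type*} [CommRing R'] (f : R →+* R') {m c : Finset ι → R}
    (h : IsCumulant m c) : IsCumulant (fun A => f (m A)) (fun A => f (c A)) := by
  intro A
  simp only [h A, wt, map_sum, map_prod]

theorem IsCumulant.comap {κ : Type*} [DecidableEq κ] [Fintype κ] {m c : Finset ι → R}
    (h : IsCumulant m c) (e : κ ↪ ι) :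
    IsCumulant (fun A => m (A.map e)) (fun A => c (A.map e)) := by
  refine isCumulant_of_rec (by simpa using h.empty) ?_
  rintro A ⟨a, ha⟩
  refine ⟨a, ha, ?_⟩
  rw [h.rec_eq (Finset.mem_map_of_mem e ha)]
  symm
  refine Finset.sum_bij (fun B _ => B.map e) ?_ ?_ ?_ ?_
  · intro B hB
    obtain ⟨hB, haB⟩ := Finset.mem_filter.1 hB
    exact Finset.mem_filter.2 ⟨Finset.mem_powerset.2 (Finset.map_subset_map.2
      (Finset.mem_powerset.1 hB)), Finset.mem_map_of_mem e haB⟩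
  · intro B _ C _ hBC
    exact Finset.map_injective e hBC
  · intro B hB
    obtain ⟨hB, haB⟩ := Finset.mem_filter.1 hB
    obtain ⟨C, hC, rfl⟩ := Finset.subset_map_iff.1 (Finset.mem_powerset.1 hB)
    refine ⟨C, Finset.mem_filter.2 ⟨Finset.mem_powerset.2 hC, ?_⟩, rfl⟩
    simpa using haB
  · intro B _
    have : (A \ B).map e = A.map e \ B.map e := by
      ext x; simp only [Finset.mem_map, Finset.mem_sdiff]
      constructor
      · rintro ⟨y, ⟨hy, hy'⟩, rfl⟩
        exact ⟨⟨y, hy, rfl⟩, fun ⟨z, hz, hzy⟩ => hy' (e.injective hzy ▸ hz)⟩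
      · rintro ⟨⟨y, hy, rfl⟩, h2⟩
        exact ⟨y, ⟨hy, fun hyB => h2 ⟨y, hyB, rfl⟩⟩, rfl⟩
    rw [this]

/-- The cumulant function of a moment function, by recursion on the size of the set. -/
def algCum (m : Finset ι → R) : Finset ι → R :=
  open Classical in
  Finset.strongInduction fun A ih =>
    m A - ∑ π ∈ (parts A).erase {A}, ∏ B ∈ π, if h : B ⊂ A then ih B h else 0

theorem ssubset_of_mem_parts {A B : Finset ι} {π : Finset (Finset ι)} (hπ : π ∈ parts A)
    (hne : π ≠ {A}) (hB : B ∈ π) : B ⊂ A := by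
  obtain ⟨h1, h2, h3, h4⟩ := mem_parts.1 hπ
  refine (h1 B hB).ssubset_of_ne ?_
  rintro rfl
  refine hne (Finset.eq_singleton_iff_unique_mem.2 ⟨hB, fun C hC => ?_⟩)
  obtain ⟨x, hx⟩ := Finset.nonempty_iff_ne_empty.2 (fun h0 : C = ∅ => h2 (h0 ▸ hC))
  exact h3 C hC B hB x hx (h1 C hC hx)

theorem isCumulant_algCum {m : Finset ι → R} (h0 : m ∅ = 1) : IsCumulant m (algCum m) := by
  intro A
  rcases A.eq_empty_or_nonempty with rfl | hA
  · rw [h0, parts_empty]; simp [wt]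
  rw [← Finset.add_sum_erase _ _ (singleton_mem_parts hA)]
  have : algCum m A = m A - ∑ π ∈ (parts A).erase {A}, wt (algCum m) π := by
    conv_lhs => rw [algCum, Finset.strongInduction_eq]
    congr 1
    refine Finset.sum_congr rfl fun π hπ => Finset.prod_congr rfl fun B hB => ?_
    obtain ⟨hne, hπ⟩ := Finset.mem_erase.1 hπ
    rw [dif_pos (ssubset_of_mem_parts hπ hne hB)]
    rfl
  simp only [wt, Finset.prod_singleton] at this ⊢
  rw [this]
  ring

end IsCumulant

/-! ### Random variables with moments of all orders -/

section Moments

variable {Ω : Type*} [MeasurableSpace Ω] {P : Measure Ω}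

/-- The random variable `X` has moments of all orders under `P`. -/
def HasMoments (P : Measure Ω) (X : Ω → ℝ) : Prop := ∀ q : ℕ, MemLp X q P

theorem HasMoments.integrable {X : Ω → ℝ} (h : HasMoments P X) : Integrable X P := by
  have := h 1
  rwa [Nat.cast_one, memLp_one_iff_integrable] at this

theorem HasMoments.mul {X Y : Ω → ℝ} (hX : HasMoments P X) (hY : HasMoments P Y) :
    HasMoments P (fun ω => X ω * Y ω) := by
  intro q
  have : ENNReal.HolderTriple ((2 * q : ℕ) : ENNReal) ((2 * q : ℕ) : ENNReal) (q : ENNReal) := by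
    constructor
    push_cast
    rw [ENNReal.mul_inv (Or.inl (by norm_num)) (Or.inl (by norm_num)), ← add_mul,
      ENNReal.inv_two_add_inv_two, one_mul]
  exact (hY (2 * q)).mul (hX (2 * q))

theorem HasMoments.add {X Y : Ω → ℝ} (hX : HasMoments P X) (hY : HasMoments P Y) :
    HasMoments P (X + Y) := fun q => (hX q).add (hY q)

theorem HasMoments.const_mul {X : Ω → ℝ} (hX : HasMoments P X) (a : ℝ) :
    HasMoments P (fun ω => a * X ω) := fun q => (hX q).const_mul a

theorem hasMoments_const [IsFiniteMeasure P] (a : ℝ) : HasMoments P (fun _ => a) :=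
  fun _ => memLp_const a

theorem hasMoments_prod [IsFiniteMeasure P] {ι : Type*} {X : ι → Ω → ℝ} (A : Finset ι)
    (h : ∀ i ∈ A, HasMoments P (X i)) : HasMoments P (fun ω => ∏ i ∈ A, X i ω) := by
  classical
  induction A using Finset.induction_on with
  | empty => simpa using hasMoments_const 1
  | insert a A ha ih =>
    simp only [Finset.prod_insert ha]
    exact (h a (by simp)).mul (ih fun i hi => h i (Finset.mem_insert_of_mem hi))

theorem hasMoments_sum [IsFiniteMeasure P] {ι : Type*} {X : ι → Ω → ℝ} (A : Finset ι)
    (h : ∀ i ∈ A, HasMoments P (X i)) : HasMoments P (fun ω => ∑ i ∈ A, X i ω) := by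
  classical
  induction A using Finset.induction_on with
  | empty => simpa using hasMoments_const 0
  | insert a A ha ih =>
    simp only [Finset.sum_insert ha]
    exact (h a (by simp)).add (ih fun i hi => h i (Finset.mem_insert_of_mem hi))

/-- The joint moments of a family of random variables. -/
def mom {ι : Type*} (P : Measure Ω) (X : ι → Ω → ℝ) (A : Finset ι) : ℝ := ∫ ω, ∏ x ∈ A, X x ω ∂P

end Moments

/-! ### The derivatives of the logarithm of the characteristic function -/

section Derivatives

variable {E : Type*} [NormedAddCommGroup E] [NormedSpace ℝ E]

/-- Iterated directional derivative along a list of vectors, the head of the list first. -/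
def dirDeriv : List E → (E → ℂ) → E → ℂ
  | [], f => f
  | v :: l, f => dirDeriv l (fun t => fderiv ℝ f t v)

theorem dirDeriv_congr {f g : E → ℂ} {x : E} (l : List E) (h : f =ᶠ[𝓝 x] g) :
    dirDeriv l f x = dirDeriv l g x := by
  induction l generalizing f g with
  | nil => exact h.eq_of_nhds
  | cons v l ih =>
    refine ih ?_
    filter_upwards [h.fderiv (𝕜 := ℝ)] with t ht
    rw [ht]

theorem eventually_differentiableAt {f : E → ℂ} {x : E} (hf : ContDiffAt ℝ (⊤ : ℕ∞) f x) :
    ∀ᶠ t in 𝓝 x, DifferentiableAt ℝ f t := by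
  filter_upwards [(hf.of_le (m := 1) (by simp)).eventually (by simp)] with t ht
  exact ht.differentiableAt (by simp)

theorem contDiffAt_fderiv_apply {f : E → ℂ} {x : E} (hf : ContDiffAt ℝ (⊤ : ℕ∞) f x) (v : E) :
    ContDiffAt ℝ (⊤ : ℕ∞) (fun t => fderiv ℝ f t v) x :=
  (hf.fderiv_right (m := (⊤ : ℕ∞)) (by simp)).clm_apply contDiffAt_const

theorem dirDeriv_add {f g : E → ℂ} {x : E} (l : List E) (hf : ContDiffAt ℝ (⊤ : ℕ∞) f x)
    (hg : ContDiffAt ℝ (⊤ : ℕ∞) g x) :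
    dirDeriv l (fun t => f t + g t) x = dirDeriv l f x + dirDeriv l g x := by
  induction l generalizing f g with
  | nil => rfl
  | cons v l ih =>
    simp only [dirDeriv]
    rw [← ih (contDiffAt_fderiv_apply hf v) (contDiffAt_fderiv_apply hg v)]
    refine dirDeriv_congr l ?_
    filter_upwards [eventually_differentiableAt hf, eventually_differentiableAt hg] with t h1 h2
    rw [fderiv_fun_add (h1) (h2)]
    rfl

theorem iteratedFDeriv_eq_dirDeriv {f : E → ℂ} {x : E} (hf : ContDiffAt ℝ (⊤ : ℕ∞) f x) {n : ℕ}
    (m : Fin n → E) : iteratedFDeriv ℝ n f x m = dirDeriv (List.ofFn m).reverse f x := by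
  induction n generalizing f with
  | zero => simp [dirDeriv]
  | succ n ih =>
    have hr : (List.ofFn m).reverse = m (Fin.last n) :: (List.ofFn (Fin.init m)).reverse := by
      rw [List.ofFn_succ', List.concat_eq_append, List.reverse_append]
      rfl
    rw [iteratedFDeriv_succ_apply_right, hr, dirDeriv, ← ih (contDiffAt_fderiv_apply hf _)]
    have := ((ContinuousLinearMap.apply ℝ ℂ (m (Fin.last n))).iteratedFDeriv_comp_left
      (hf.fderiv_right (m := (⊤ : ℕ∞)) (by simp)) (i := n) (mod_cast le_top))
    have h2 := congrArg (fun T => T (Fin.init m)) this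
    simpa [Function.comp_def] using h2.symm

variable {k : ℕ}

/-- The derivative of `f` along the vectors `e i`, `i ∈ A`, the largest index first. -/
def setDeriv (e : Fin k → E) (A : Finset (Fin k)) (f : E → ℂ) : E → ℂ :=
  dirDeriv ((A.sort (fun a b => a ≥ b)).map e) f

theorem setDeriv_insert (e : Fin k → E) {a : Fin k} {s : Finset (Fin k)} (h : ∀ x ∈ s, x < a)
    (f : E → ℂ) : setDeriv e (insert a s) f = setDeriv e s (fun t => fderiv ℝ f t (e a)) := by
  rw [setDeriv, Finset.sort_insert _ (fun b hb => (h b hb).le)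
    (fun ha => lt_irrefl _ (h a ha))]
  rfl

/-- Leibniz rule for mixed derivatives. -/
theorem setDeriv_mul (e : Fin k → E) (A : Finset (Fin k)) {f g : E → ℂ} {x : E}
    (hf : ContDiffAt ℝ (⊤ : ℕ∞) f x) (hg : ContDiffAt ℝ (⊤ : ℕ∞) g x) :
    setDeriv e A (fun t => f t * g t) x =
      ∑ B ∈ A.powerset, setDeriv e B f x * setDeriv e (A \ B) g x := by
  induction A using Finset.induction_on_max generalizing f g with
  | empty => simp [setDeriv, dirDeriv]
  | insert a s hs ih =>
    have has : a ∉ s := fun ha => lt_irrefl _ (hs a ha)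
    have hf' := contDiffAt_fderiv_apply hf (e a)
    have hg' := contDiffAt_fderiv_apply hg (e a)
    have key : setDeriv e s (fun t => fderiv ℝ (fun t => f t * g t) t (e a)) x =
        setDeriv e s (fun t => f t * fderiv ℝ g t (e a)) x +
          setDeriv e s (fun t => fderiv ℝ f t (e a) * g t) x := by
      rw [setDeriv, setDeriv, setDeriv, ← dirDeriv_add _ (hf.mul hg') (hf'.mul hg)]
      refine dirDeriv_congr _ ?_
      filter_upwards [eventually_differentiableAt hf, eventually_differentiableAt hg] with t h1 h2
      rw [fderiv_fun_mul (h1) (h2)]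
      simp [mul_comm]
    rw [setDeriv_insert e hs, key, ih hf hg', ih hf' hg, Finset.sum_powerset_insert has]
    congr 1 <;> refine Finset.sum_congr rfl fun B hB => ?_
    · have hB := Finset.mem_powerset.1 hB
      rw [Finset.insert_sdiff_of_notMem _ (fun h => has (hB h)), setDeriv_insert e
        (fun x hx => hs x (Finset.sdiff_subset hx))]
    · have hB := Finset.mem_powerset.1 hB
      rw [setDeriv_insert e (fun x hx => hs x (hB hx))]
      congr 2
      ext y
      simp only [Finset.mem_sdiff, Finset.mem_insert]
      by_cases hya : y = a
      · subst hya; simp [has]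
      · simp [hya]

theorem contDiffAt_log_comp {φ : E → ℂ} (hφ : ContDiff ℝ (⊤ : ℕ∞) φ) {x : E} (h : φ x = 1) :
    ContDiffAt ℝ (⊤ : ℕ∞) (fun t => Complex.log (φ t)) x := by
  have h1 : ContDiffAt ℂ (⊤ : ℕ∞) Complex.log (φ x) := by
    rw [h]; exact Complex.contDiffAt_log (by simp)
  exact (h1.restrict_scalars ℝ).comp x hφ.contDiffAt

/-- The derivative of `φ = exp (log φ)` at a point where `φ = 1`, by the Leibniz rule. -/
theorem setDeriv_log_rec (e : Fin k → E) {φ : E → ℂ} (hφ : ContDiff ℝ (⊤ : ℕ∞) φ) {x : E}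
    (h : φ x = 1)
    {A : Finset (Fin k)} (hA : A.Nonempty) : ∃ a ∈ A, setDeriv e A φ x =
      ∑ B ∈ A.powerset.filter (fun B => a ∈ B),
        setDeriv e B (fun t => Complex.log (φ t)) x * setDeriv e (A \ B) φ x := by
  set a := A.max' hA with ha
  set s := A.erase a with hs
  have haA : a ∈ A := A.max'_mem hA
  have has : a ∉ s := Finset.notMem_erase a A
  have hlt : ∀ y ∈ s, y < a := by
    intro y hy
    exact lt_of_le_of_ne (A.le_max' y (Finset.mem_of_mem_erase hy)) (Finset.ne_of_mem_erase hy)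
  have hins : insert a s = A := Finset.insert_erase haA
  refine ⟨a, haA, ?_⟩
  have hL := contDiffAt_log_comp hφ h
  have hev : (fun t => fderiv ℝ φ t (e a)) =ᶠ[𝓝 x]
      fun t => fderiv ℝ (fun t => Complex.log (φ t)) t (e a) * φ t := by
    have hne : ∀ᶠ t in 𝓝 x, φ t ≠ 0 := hφ.continuous.continuousAt.eventually_ne (by simp [h])
    have hexp : (fun t => φ t) =ᶠ[𝓝 x] fun t => Complex.exp (Complex.log (φ t)) := by
      filter_upwards [hne] with t ht
      rw [Complex.exp_log ht]
    filter_upwards [hexp.fderiv (𝕜 := ℝ), hne, eventually_differentiableAt hL] with t h1 h2 h3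
    have h4 := (h3).hasFDerivAt.cexp.fderiv
    rw [h4] at h1
    have h5 : fderiv ℝ φ t = fderiv ℝ (fun t => φ t) t := rfl
    rw [h5, h1]
    simp only [_root_.smul_apply, smul_eq_mul]
    rw [Complex.exp_log h2, mul_comm]
  have e1 : setDeriv e A φ x = setDeriv e s
      (fun t => fderiv ℝ (fun t => Complex.log (φ t)) t (e a) * φ t) x := by
    conv_lhs => rw [← hins]
    rw [setDeriv_insert e hlt]
    exact dirDeriv_congr _ hev
  rw [e1, setDeriv_mul e s (contDiffAt_fderiv_apply hL (e a)) hφ.contDiffAt]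
  refine Finset.sum_bij (fun B _ => insert a B) ?_ ?_ ?_ ?_
  · intro B hB
    rw [Finset.mem_powerset] at hB
    rw [Finset.mem_filter, Finset.mem_powerset, ← hins]
    exact ⟨Finset.insert_subset_insert a hB, Finset.mem_insert_self _ _⟩
  · intro B hB C hC hBC
    rw [Finset.mem_powerset] at hB hC
    rw [← Finset.erase_insert (fun h => has (hB h)), hBC,
      Finset.erase_insert (fun h => has (hC h))]
  · intro B hB
    obtain ⟨hB, haB⟩ := Finset.mem_filter.1 hB
    refine ⟨B.erase a, Finset.mem_powerset.2 (Finset.erase_subset_erase a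
      (Finset.mem_powerset.1 hB)), Finset.insert_erase haB⟩
  · intro B hB
    rw [Finset.mem_powerset] at hB
    rw [setDeriv_insert e (fun y hy => hlt y (hB hy))]
    congr 2
    rw [← hins]
    ext y
    simp only [Finset.mem_sdiff, Finset.mem_insert]
    by_cases hya : y = a
    · subst hya; simp [has]
    · simp [hya]

end Derivatives

section CharFun

variable {Ω : Type*} [MeasurableSpace Ω] {P : Measure Ω} [IsProbabilityMeasure P] {k : ℕ}

/-- The joint characteristic function, written as in the definition of the joint cumulant. -/
def jointChar (P : Measure Ω) (X : Fin k → Ω → ℝ) (t : Fin k → ℝ) : ℂ :=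
  ∫ ω, Complex.exp (∑ j, Complex.I * ((t j : ℝ) : ℂ) * ((X j ω : ℝ) : ℂ)) ∂P

theorem jointChar_zero (X : Fin k → Ω → ℝ) : jointChar P X 0 = 1 := by
  simp [jointChar]

variable {X : Fin k → Ω → ℝ}

/-- The law of the random vector, on Euclidean space. -/
def vecLaw (P : Measure Ω) (X : Fin k → Ω → ℝ) : Measure (EuclideanSpace ℝ (Fin k)) :=
  P.map (fun ω => WithLp.toLp 2 (fun j => X j ω))

theorem aemeasurable_vec (hX : ∀ i, HasMoments P (X i)) :
    AEMeasurable (fun ω => (WithLp.toLp 2 (fun j => X j ω) : EuclideanSpace ℝ (Fin k))) P := by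
  have h : AEMeasurable (fun ω => (fun j => X j ω)) P :=
    aemeasurable_pi_lambda _ fun j => (hX j 1).1.aemeasurable
  exact (PiLp.continuous_toLp 2 (fun _ : Fin k => ℝ)).measurable.comp_aemeasurable h

theorem memLp_vecLaw (hX : ∀ i, HasMoments P (X i)) (q : ℕ) : MemLp id q (vecLaw P X) := by
  rw [vecLaw, memLp_map_measure_iff aestronglyMeasurable_id (aemeasurable_vec hX)]
  exact MemLp.of_eval_piLp fun i => hX i q

theorem jointChar_eq (hX : ∀ i, HasMoments P (X i)) :
    jointChar P X = charFun (vecLaw P X) ∘ (EuclideanSpace.equiv (Fin k) ℝ).symm := by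
  ext t
  simp only [Function.comp_apply, charFun, vecLaw]
  rw [integral_map (aemeasurable_vec hX) (by fun_prop)]
  simp only [jointChar]
  congr 1
  ext ω
  congr 1
  simp only [PiLp.inner_apply]
  push_cast
  rw [Finset.sum_mul]
  refine Finset.sum_congr rfl fun j _ => ?_
  simp
  ring

instance : IsFiniteMeasure (vecLaw P X) := by unfold vecLaw; infer_instance

theorem contDiff_jointChar (hX : ∀ i, HasMoments P (X i)) :
    ContDiff ℝ (⊤ : ℕ∞) (jointChar P X) := by
  rw [jointChar_eq hX]
  exact (contDiff_charFun' (n := ⊤) (memLp_vecLaw hX)).comp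
    (EuclideanSpace.equiv (Fin k) ℝ).symm.contDiff

theorem iteratedFDeriv_jointChar (hX : ∀ i, HasMoments P (X i)) {n : ℕ} (x : Fin n → Fin k) :
    iteratedFDeriv ℝ n (jointChar P X) 0 (fun i => Pi.single (x i) 1) =
      Complex.I ^ n * ((∫ ω, ∏ i, X (x i) ω ∂P : ℝ) : ℂ) := by
  have h1 : jointChar P X = charFun (vecLaw P X) ∘
      ((EuclideanSpace.equiv (Fin k) ℝ).symm : (Fin k → ℝ) →L[ℝ] EuclideanSpace ℝ (Fin k)) :=
    jointChar_eq hX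
  rw [h1, ContinuousLinearMap.iteratedFDeriv_comp_right _
    (contDiff_charFun (memLp_vecLaw hX n)) _ le_rfl]
  rw [ContinuousMultilinearMap.compContinuousLinearMap_apply,
    iteratedFDeriv_charFun (memLp_vecLaw hX n), vecLaw,
    integral_map (aemeasurable_vec hX) (by fun_prop)]
  rw [← integral_complex_ofReal]
  congr 2
  ext ω
  simp [PiLp.inner_apply]

theorem setDeriv_jointChar (hX : ∀ i, HasMoments P (X i)) (A : Finset (Fin k)) :
    setDeriv (fun j => Pi.single j (1 : ℝ)) A (jointChar P X) 0 =
      Complex.I ^ A.card * (mom P X A : ℂ) := by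
  set l := A.sort (fun a b => a ≥ b) with hl
  have hlen : l.reverse.length = A.card := by simp [hl]
  have h1 : setDeriv (fun j => Pi.single j (1 : ℝ)) A (jointChar P X) 0 =
      iteratedFDeriv ℝ l.reverse.length (jointChar P X) 0
        (fun i => Pi.single (l.reverse.get i) (1 : ℝ)) := by
    rw [iteratedFDeriv_eq_dirDeriv (contDiff_jointChar hX).contDiffAt]
    have : List.ofFn (fun i => (Pi.single (l.reverse.get i) (1 : ℝ) : Fin k → ℝ)) =
        l.reverse.map (fun j => Pi.single j (1 : ℝ)) := by
      rw [← congrArg (List.map _) (List.ofFn_get l.reverse), List.map_ofFn]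
      rfl
    rw [this, ← List.map_reverse, List.reverse_reverse]
    rfl
  rw [h1, iteratedFDeriv_jointChar hX, mom]
  congr 1
  · rw [hlen]
  congr 2
  ext ω
  have h2 : ∏ i, X (l.reverse.get i) ω = (l.reverse.map (fun j => X j ω)).prod := by
    rw [← List.prod_ofFn, ← congrArg (List.map _) (List.ofFn_get l.reverse), List.map_ofFn]
    rfl
  rw [h2, List.map_reverse, List.prod_reverse]
  have h3 : l.toFinset = A := by simp [hl]
  rw [← List.prod_toFinset _ (by rw [hl]; exact Finset.sort_nodup _ _), h3]

/-- The joint cumulant, defined by derivatives of the logarithm of the characteristic function, is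
the value at the full index set of any cumulant function of the joint moments. -/
theorem jointCumulant_eq (hX : ∀ i, HasMoments P (X i)) {c : Finset (Fin k) → ℝ}
    (hc : IsCumulant (mom P X) c) (hk : 0 < k) : jointCumulant P X = c Finset.univ := by
  set e : Fin k → (Fin k → ℝ) := fun j => Pi.single j (1 : ℝ) with he
  set L : (Fin k → ℝ) → ℂ := fun t => Complex.log (jointChar P X t) with hL
  set d : Finset (Fin k) → ℂ := fun A => (Complex.I ^ A.card)⁻¹ * setDeriv e A L 0 with hd
  have hI : ∀ n : ℕ, (Complex.I ^ n) ≠ 0 := fun n => pow_ne_zero _ Complex.I_ne_zero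
  have h1 : IsCumulant (fun A => (mom P X A : ℂ)) d := by
    refine isCumulant_of_rec (by simp [mom]) fun A hA => ?_
    obtain ⟨a, ha, h⟩ := setDeriv_log_rec e (contDiff_jointChar hX) (jointChar_zero X) hA
    refine ⟨a, ha, ?_⟩
    rw [setDeriv_jointChar hX] at h
    have h' := congrArg (fun z => (Complex.I ^ A.card)⁻¹ * z) h
    rw [inv_mul_cancel_left₀ (hI _), Finset.mul_sum] at h'
    rw [h']
    refine Finset.sum_congr rfl fun B hB => ?_
    rw [setDeriv_jointChar hX]
    have hB := Finset.mem_powerset.1 (Finset.mem_filter.1 hB).1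
    have hcard : A.card = B.card + (A \ B).card := by
      rw [Finset.card_sdiff_of_subset hB]
      have := Finset.card_le_card hB
      omega
    rw [hcard, pow_add, hd]
    have := hI B.card
    have := hI (A \ B).card
    field_simp
    exact mul_comm _ _
  have h2 := h1.unique (hc.map Complex.ofRealHom) (A := Finset.univ)
    ⟨⟨0, hk⟩, Finset.mem_univ _⟩
  have h3 : jointCumulant P X = (d Finset.univ).re := by
    simp only [jointCumulant, hd]
    have h4 : iteratedFDeriv ℝ k L 0 (fun j => Pi.single j (1 : ℝ)) =
        setDeriv e Finset.univ L 0 := by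
      rw [iteratedFDeriv_eq_dirDeriv (contDiffAt_log_comp (contDiff_jointChar hX)
        (jointChar_zero X)), setDeriv]
      congr 1
      have h5 : (Finset.univ : Finset (Fin k)).sort (fun a b => a ≥ b) =
          (List.finRange k).reverse := by
        refine (Finset.sortedGT_sort _).eq_of_mem_iff ?_ (by simp)
        exact (List.sortedLT_finRange k).reverse
      rw [h5, List.map_reverse]
      congr 1
      rw [List.ofFn_eq_map]
    rw [← h4, Finset.card_univ, Fintype.card_fin]
    rfl
  rw [h3, h2]
  simp

end CharFun

/-! ### Joint cumulants of families of random variables -/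

section Cum

variable {Ω : Type*} [MeasurableSpace Ω] {P : Measure Ω} [IsProbabilityMeasure P]
variable {ι : Type*} [DecidableEq ι] [Fintype ι]

/-- The joint cumulant of the variables `X x`, `x ∈ A`, defined from the joint moments. -/
def cum (P : Measure Ω) (X : ι → Ω → ℝ) : Finset ι → ℝ := algCum (mom P X)

theorem isCumulant_cum (X : ι → Ω → ℝ) : IsCumulant (mom P X) (cum P X) :=
  isCumulant_algCum (by simp [mom])

theorem jointCumulant_eq_cum {k : ℕ} {X : Fin k → Ω → ℝ} (hX : ∀ i, HasMoments P (X i))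
    (hk : 0 < k) : jointCumulant P X = cum P X Finset.univ :=
  jointCumulant_eq hX (isCumulant_cum X) hk

theorem cum_comap {κ : Type*} [DecidableEq κ] [Fintype κ] (X : ι → Ω → ℝ) (e : κ ↪ ι)
    {A : Finset κ} (hA : A.Nonempty) : cum P (fun x => X (e x)) A = cum P X (A.map e) := by
  have h := (isCumulant_cum (P := P) X).comap e
  have h2 : (fun A : Finset κ => mom P X (A.map e)) = mom P (fun x => X (e x)) := by
    ext A; simp [mom]
  rw [h2] at h
  exact (isCumulant_cum _).unique h hA

theorem cum_subtype (X : ι → Ω → ℝ) {A : Finset ι} (hA : A.Nonempty) :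
    cum P (fun x : A => X x) Finset.univ = cum P X A := by
  obtain ⟨a, ha⟩ := hA
  have := cum_comap (P := P) X (Function.Embedding.subtype (· ∈ A)) (A := Finset.univ)
    ⟨⟨a, ha⟩, Finset.mem_univ _⟩
  rw [Finset.univ_eq_attach, Finset.attach_map_val] at this
  exact this

/-- Factorization at an element of `U` of the moment recursion for families that split. -/
theorem mom_eq_sum_of_split {m c : Finset ι → ℝ} (hc : IsCumulant m c) {U : Finset ι}
    (h : ∀ A, m A = m (A ∩ U) * m (A \ U)) {A : Finset ι} {a : ι} (ha : a ∈ A) (haU : a ∈ U)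
    {c' : Finset ι → ℝ} (h1 : ∀ B, a ∈ B → B ⊆ U → c' B = c B)
    (h2 : ∀ B, a ∈ B → ¬ B ⊆ U → c' B = 0) :
    m A = ∑ B ∈ A.powerset.filter (fun B => a ∈ B), c' B * m (A \ B) := by
  rw [h A, hc.rec_eq (Finset.mem_inter.2 ⟨ha, haU⟩), Finset.sum_mul]
  refine Finset.sum_subset_zero_on_sdiff ?_ ?_ ?_
  · intro B hB
    rw [Finset.mem_filter, Finset.mem_powerset] at hB ⊢
    exact ⟨hB.1.trans Finset.inter_subset_left, hB.2⟩
  · intro B hB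
    rw [Finset.mem_sdiff, Finset.mem_filter, Finset.mem_filter, Finset.mem_powerset,
      Finset.mem_powerset] at hB
    rw [h2 B hB.1.2, zero_mul]
    exact fun hBU => hB.2 ⟨Finset.subset_inter hB.1.1 hBU, hB.1.2⟩
  · intro B hB
    rw [Finset.mem_filter, Finset.mem_powerset] at hB
    have hBU := hB.1.trans Finset.inter_subset_right
    rw [h1 B hB.2 hBU, h (A \ B), mul_assoc]
    congr 3
    · ext x; simp only [Finset.mem_sdiff, Finset.mem_inter]; tauto
    · ext x; simp only [Finset.mem_sdiff]; have := @hBU x; tauto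

/-- A joint cumulant vanishes if the family splits into two uncorrelated nonempty parts. -/
theorem cum_eq_zero_of_split {X : ι → Ω → ℝ} {U : Finset ι}
    (h : ∀ A, mom P X A = mom P X (A ∩ U) * mom P X (A \ U)) {A : Finset ι}
    (h1 : (A ∩ U).Nonempty) (h2 : (A \ U).Nonempty) : cum P X A = 0 := by
  classical
  set c := cum P X with hcdef
  have hc : IsCumulant (mom P X) c := isCumulant_cum X
  -- the cumulants of the two parts, without mixed cumulants, satisfy the moment recursion
  set c' : Finset ι → ℝ := fun A => if A ⊆ U ∨ A ⊆ Uᶜ then c A else 0 with hc'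
  have hsd : ∀ B : Finset ι, B ∩ Uᶜ = B \ U := fun B => by
    ext x; simp
  have hsd' : ∀ B : Finset ι, B \ Uᶜ = B ∩ U := fun B => by
    ext x; simp
  have h' : IsCumulant (mom P X) c' := by
    refine isCumulant_of_rec hc.empty ?_
    rintro A ⟨a, ha⟩
    refine ⟨a, ha, ?_⟩
    by_cases haU : a ∈ U
    · refine mom_eq_sum_of_split hc h ha haU (fun B _ hB => if_pos (Or.inl hB))
        (fun B haB hB => if_neg ?_)
      rintro (h | h)
      · exact hB h
      · exact (Finset.mem_compl.1 (h haB)) haU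
    · refine mom_eq_sum_of_split hc (U := Uᶜ) (fun A => ?_) ha (Finset.mem_compl.2 haU)
        (fun B _ hB => if_pos (Or.inr hB)) (fun B haB hB => if_neg ?_)
      · rw [hsd, hsd', mul_comm]; exact h A
      · rintro (h | h)
        · exact haU (h haB)
        · exact hB h
  obtain ⟨x, hx⟩ := h1
  obtain ⟨y, hy⟩ := h2
  rw [Finset.mem_inter] at hx
  rw [Finset.mem_sdiff] at hy
  rw [hc.unique h' ⟨x, hx.1⟩, hc']
  refine if_neg ?_
  rintro (h | h)
  · exact hy.2 (h hy.1)
  · exact (Finset.mem_compl.1 (h hx.1)) hx.2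

/-- **Leonov-Shiryaev formula** for products over the fibres of `g`. -/
theorem cum_prod_fibres {S : Type*} [DecidableEq S] [Fintype S] (X : ι → Ω → ℝ) (g : ι → S)
    {T : Finset S} (hT : T.Nonempty) :
    cum P (fun s ω => ∏ x ∈ Finset.univ.filter (fun x => g x = s), X x ω) T =
      ∑ π ∈ conn g T, wt (cum P X) π := by
  have h := (isCumulant_cum (P := P) X).products g
  have h2 : (fun T => mom P X (pre g T)) =
      mom P (fun s ω => ∏ x ∈ Finset.univ.filter (fun x => g x = s), X x ω) := by
    ext T
    simp only [mom]
    congr 1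
    ext ω
    rw [← Finset.prod_fiberwise_of_maps_to (s := pre g T) (t := T) (g := g)
      (fun x hx => mem_pre.1 hx)]
    refine Finset.prod_congr rfl fun s hs => ?_
    congr 1
    ext x
    simp only [Finset.mem_filter, mem_pre, Finset.mem_univ, true_and]
    exact ⟨fun h => h.2, fun h => ⟨h ▸ hs, h⟩⟩
  rw [h2] at h
  exact (isCumulant_cum _).unique h hT

theorem mom_update_of_notMem (X : ι → Ω → ℝ) (x : ι) (U V : Ω → ℝ) {A : Finset ι} (hx : x ∉ A) :
    mom P (Function.update X x U) A = mom P (Function.update X x V) A := by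
  simp only [mom]
  congr 1
  ext ω
  refine Finset.prod_congr rfl fun y hy => ?_
  have : y ≠ x := fun h => hx (h ▸ hy)
  simp [Function.update_of_ne this]

theorem mom_update_linear {X : ι → Ω → ℝ} (hX : ∀ i, HasMoments P (X i)) (x : ι)
    {U V : Ω → ℝ} (hU : HasMoments P U) (hV : HasMoments P V) (a b : ℝ) {A : Finset ι}
    (hx : x ∈ A) : mom P (Function.update X x (fun ω => a * U ω + b * V ω)) A =
      a * mom P (Function.update X x U) A + b * mom P (Function.update X x V) A := by
  have key : ∀ W : Ω → ℝ, ∀ ω, ∏ y ∈ A, Function.update X x W y ω =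
      W ω * ∏ y ∈ A.erase x, X y ω := by
    intro W ω
    rw [← Finset.mul_prod_erase A _ hx, Function.update_self]
    congr 1
    refine Finset.prod_congr rfl fun y hy => ?_
    rw [Function.update_of_ne (Finset.ne_of_mem_erase hy)]
  have hprod := hasMoments_prod (P := P) (A.erase x) (fun i _ => hX i)
  simp only [mom, key]
  rw [← integral_const_mul, ← integral_const_mul, ← integral_add]
  · congr 1; ext ω; ring
  · exact ((hU.mul hprod).integrable).const_mul a
  · exact ((hV.mul hprod).integrable).const_mul b

/-- Joint cumulants are linear in each variable. -/
theorem cum_update_linear {X : ι → Ω → ℝ} (hX : ∀ i, HasMoments P (X i)) (x : ι)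
    {U V : Ω → ℝ} (hU : HasMoments P U) (hV : HasMoments P V) (a b : ℝ) {A : Finset ι}
    (hx : x ∈ A) : cum P (Function.update X x (fun ω => a * U ω + b * V ω)) A =
      a * cum P (Function.update X x U) A + b * cum P (Function.update X x V) A := by
  classical
  set W := fun ω => a * U ω + b * V ω with hW
  set cU := cum P (Function.update X x U) with hcU
  set cV := cum P (Function.update X x V) with hcV
  have iU : IsCumulant (mom P (Function.update X x U)) cU := isCumulant_cum _
  have iV : IsCumulant (mom P (Function.update X x V)) cV := isCumulant_cum _
  set c' : Finset ι → ℝ := fun A => if x ∈ A then a * cU A + b * cV A else cU A with hc'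
  have h : IsCumulant (mom P (Function.update X x W)) c' := by
    refine isCumulant_of_rec (isCumulant_cum _).empty ?_
    rintro A ⟨y, hy⟩
    by_cases hxA : x ∈ A
    · refine ⟨x, hxA, ?_⟩
      rw [hW, mom_update_linear hX x hU hV a b hxA, iU.rec_eq hxA, iV.rec_eq hxA, Finset.mul_sum,
        Finset.mul_sum, ← Finset.sum_add_distrib]
      refine Finset.sum_congr rfl fun B hB => ?_
      have hxB := (Finset.mem_filter.1 hB).2
      have hn : x ∉ A \ B := fun h => (Finset.mem_sdiff.1 h).2 hxB
      rw [← hW, mom_update_of_notMem X x W U hn, mom_update_of_notMem X x V U hn, hc']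
      simp only [if_pos hxB]
      ring
    · refine ⟨y, hy, ?_⟩
      rw [mom_update_of_notMem X x W U hxA, iU.rec_eq hy]
      refine Finset.sum_congr rfl fun B hB => ?_
      have hB' := Finset.mem_powerset.1 (Finset.mem_filter.1 hB).1
      rw [mom_update_of_notMem X x W U (fun h => hxA (Finset.sdiff_subset h)), hc']
      simp only [if_neg (fun h => hxA (hB' h))]
  rw [(isCumulant_cum _).unique h ⟨x, hx⟩, hc']
  exact if_pos hx

/-- The space of random variables with moments of all orders. -/
def momSubmodule (P : Measure Ω) [IsProbabilityMeasure P] : Submodule ℝ (Ω → ℝ) where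
  carrier := {X | HasMoments P X}
  add_mem' := fun hX hY => hX.add hY
  zero_mem' := hasMoments_const 0
  smul_mem' := fun a _ hX => hX.const_mul a

/-- The joint cumulant as a multilinear map. -/
def cumMultilinear (P : Measure Ω) [IsProbabilityMeasure P] (ι : Type*)
    [hD : DecidableEq ι] [Fintype ι] : MultilinearMap ℝ (fun _ : ι => momSubmodule P) ℝ where
  toFun X := cum P (fun i => (X i : Ω → ℝ)) Finset.univ
  map_update_add' := by
    intro inst X x U V
    obtain rfl : inst = hD := Subsingleton.elim _ _
    have key : ∀ W : momSubmodule P, (fun i => ((Function.update X x W i : momSubmodule P) : Ω → ℝ))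
        = Function.update (fun i => (X i : Ω → ℝ)) x W := fun W => by
      ext i ω
      by_cases h : i = x
      · subst h; simp
      · simp [Function.update_of_ne h]
    rw [key, key, key]
    have := cum_update_linear (P := P) (X := fun i => (X i : Ω → ℝ)) (fun i => (X i).2) x U.2 V.2
      1 1 (Finset.mem_univ x)
    simp only [one_mul] at this
    exact this
  map_update_smul' := by
    intro inst X x a U
    obtain rfl : inst = hD := Subsingleton.elim _ _
    have key : ∀ W : momSubmodule P, (fun i => ((Function.update X x W i : momSubmodule P) : Ω → ℝ))
        = Function.update (fun i => (X i : Ω → ℝ)) x W := fun W => by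
      ext i ω
      by_cases h : i = x
      · subst h; simp
      · simp [Function.update_of_ne h]
    rw [key, key]
    have := cum_update_linear (P := P) (X := fun i => (X i : Ω → ℝ)) (fun i => (X i).2) x U.2 U.2
      a 0 (Finset.mem_univ x)
    simp only [zero_mul, add_zero] at this
    exact this

/-- Multilinear expansion of the joint cumulant of linear combinations. -/
theorem cum_sum {L : ι → Type*} [∀ i, Fintype (L i)] {Y : ∀ i, L i → Ω → ℝ}
    (hY : ∀ i l, HasMoments P (Y i l)) (a : ∀ i, L i → ℝ) :
    cum P (fun i ω => ∑ l, a i l * Y i l ω) Finset.univ =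
      ∑ l : (∀ i, L i), (∏ i, a i (l i)) * cum P (fun i => Y i (l i)) Finset.univ := by
  classical
  have h := (cumMultilinear P ι).map_sum
    (g := fun i l => a i l • (⟨Y i l, hY i l⟩ : momSubmodule P))
  have e1 : (cumMultilinear P ι) (fun i => ∑ l, a i l • (⟨Y i l, hY i l⟩ : momSubmodule P)) =
      cum P (fun i ω => ∑ l, a i l * Y i l ω) Finset.univ := by
    show cum P _ _ = _
    congr 1
    ext i ω
    simp [Finset.sum_apply]
  rw [← e1, h]
  refine Finset.sum_congr rfl fun l _ => ?_
  rw [MultilinearMap.map_smul_univ (cumMultilinear P ι)]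
  rfl

end Cum

/-! ### Independent copies -/

section Copies

variable {Ω Ω₀ : Type*} [MeasurableSpace Ω] [MeasurableSpace Ω₀]
  {P : Measure Ω} [IsProbabilityMeasure P] {P₀ : Measure Ω₀} [IsProbabilityMeasure P₀]
  {W : ℕ → ℤ → Ω → ℝ} {Z : ℤ → Ω₀ → ℝ}

theorem IsStationary.hasMoments (hs : IsStationary P₀ Z) (hm : MomentConditions P₀ Z) (j : ℤ) :
    HasMoments P₀ (Z j) := by
  have h0 : HasMoments P₀ (Z 0) := by
    intro q
    have hae : AEStronglyMeasurable (Z 0) P₀ := (hs.measurable 0).aestronglyMeasurable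
    rcases Nat.eq_zero_or_pos q with rfl | hq
    · simpa [memLp_zero_iff_aestronglyMeasurable] using hae
    · rw [← integrable_norm_rpow_iff hae (by simpa using hq.ne') (by simp)]
      simpa using hm.moments q hq
  intro q
  have h := (hs.shift j).comp (measurable_pi_apply (0 : ℤ))
  have h2 : IdentDistrib (Z j) (Z 0) P₀ P₀ := by
    simpa [Function.comp_def] using h
  exact h2.memLp_iff.2 (h0 q)

theorem IsIIDCopies.hasMoments (hW : IsIIDCopies P P₀ W Z) (hZ : ∀ j, HasMoments P₀ (Z j))
    (i : ℕ) (j : ℤ) : HasMoments P (W i j) := by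
  intro q
  have h : IdentDistrib (W i j) (Z j) P P₀ := (hW.identDistrib i).comp (measurable_pi_apply j)
  exact h.memLp_iff.2 (hZ j q)

variable {ι : Type*} [DecidableEq ι] [Fintype ι]

/-- Joint cumulants of functions of different independent copies vanish. -/
theorem cum_copies_eq_zero (hW : IsIIDCopies P P₀ W Z) {F : ι → (ℤ → ℝ) → ℝ}
    (hF : ∀ x, Measurable (F x)) (l : ι → ℕ) {A : Finset ι} {x y : ι} (hx : x ∈ A) (hy : y ∈ A)
    (hxy : l x ≠ l y) : cum P (fun x ω => F x (fun j => W (l x) j ω)) A = 0 := by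
  classical
  set U := Finset.univ.filter (fun z => l z = l x) with hU
  refine cum_eq_zero_of_split (U := U) (fun A => ?_) ⟨x, by simp [hU, hx]⟩
    ⟨y, by simp [hU, hy, Ne.symm hxy]⟩
  set S : Finset ℕ := {l x} with hS
  set T : Finset ℕ := (Finset.univ.image l).erase (l x) with hT
  have hmeas : ∀ i, Measurable (fun ω j => W i j ω) := fun i =>
    measurable_pi_lambda _ fun j => hW.measurable i j
  have hind := hW.indep.indepFun_finset S T
    (by rw [hS, Finset.disjoint_singleton_left]; exact Finset.notMem_erase _ _) hmeas
  -- the products over the letters with the copy of `x`, and over those with other copies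
  set φ : (S → ℤ → ℝ) → ℝ := fun z =>
    ∏ x' ∈ A ∩ U, F x' (z ⟨l x, Finset.mem_singleton_self _⟩) with hφ
  set ψ : (T → ℤ → ℝ) → ℝ := fun z =>
    ∏ x' ∈ A \ U, if h : l x' ∈ T then F x' (z ⟨l x', h⟩) else 0 with hψ
  have mφ : Measurable φ := Finset.measurable_prod _ fun x' _ =>
    (hF x').comp (measurable_pi_apply _)
  have mψ : Measurable ψ := by
    refine Finset.measurable_prod _ fun x' _ => ?_
    by_cases h : l x' ∈ T
    · simp only [dif_pos h]
      exact (hF x').comp (measurable_pi_apply _)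
    · simp only [dif_neg h]
      exact measurable_const
  have hc := hind.comp mφ mψ
  have e1 : (φ ∘ fun ω (i : S) => (fun j => W i j ω)) =
      fun ω => ∏ x' ∈ A ∩ U, F x' (fun j => W (l x') j ω) := by
    ext ω
    refine Finset.prod_congr rfl fun x' hx' => ?_
    have : l x' = l x := by
      have := (Finset.mem_inter.1 hx').2
      simpa [hU] using this
    simp only [this]
  have e2 : (ψ ∘ fun ω (i : T) => (fun j => W i j ω)) =
      fun ω => ∏ x' ∈ A \ U, F x' (fun j => W (l x') j ω) := by
    ext ω
    refine Finset.prod_congr rfl fun x' hx' => ?_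
    have h : l x' ∈ T := by
      have := (Finset.mem_sdiff.1 hx').2
      rw [hT, Finset.mem_erase]
      refine ⟨by simpa [hU] using this, Finset.mem_image_of_mem _ (Finset.mem_univ _)⟩
    rw [dif_pos h]
  have m1 : Measurable (φ ∘ fun ω (i : S) => (fun j => W i j ω)) :=
    mφ.comp (measurable_pi_lambda _ fun i => hmeas i)
  have m2 : Measurable (ψ ∘ fun ω (i : T) => (fun j => W i j ω)) :=
    mψ.comp (measurable_pi_lambda _ fun i => hmeas i)
  have := hc.integral_fun_mul_eq_mul_integral m1.aestronglyMeasurable m2.aestronglyMeasurable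
  rw [e1, e2] at this
  simp only [mom]
  rw [← this]
  congr 1
  ext ω
  exact (Finset.prod_inter_mul_prod_sdiff A U _).symm

/-- Each copy has the joint cumulants of the original sequence. -/
theorem cum_copy (hW : IsIIDCopies P P₀ W Z) {F : ι → (ℤ → ℝ) → ℝ}
    (hF : ∀ x, Measurable (F x)) (i : ℕ) :
    cum P (fun x ω => F x (fun j => W i j ω)) = cum P₀ (fun x ω => F x (fun j => Z j ω)) := by
  unfold cum
  congr 1
  ext A
  exact ((hW.identDistrib i).comp
    (Finset.measurable_prod A fun x _ => hF x : Measurable fun z => ∏ x ∈ A, F x z)).integral_eq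

/-- The joint cumulants of multiples of sums over `n` independent copies. -/
theorem cum_sum_copies (hW : IsIIDCopies P P₀ W Z) {F : ι → (ℤ → ℝ) → ℝ}
    (hF : ∀ x, Measurable (F x)) (hM : ∀ i x, HasMoments P (fun ω => F x (fun j => W i j ω)))
    (n : ℕ) (a : ℝ) {A : Finset ι} (hA : A.Nonempty) :
    cum P (fun x ω => ∑ i : Fin n, a * F x (fun j => W i j ω)) A =
      a ^ A.card * n * cum P₀ (fun x ω => F x (fun j => Z j ω)) A := by
  classical
  rw [← cum_subtype _ hA, cum_sum (Y := fun (x : A) (i : Fin n) ω => F x (fun j => W i j ω))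
    (fun x i => hM i x) (fun _ _ => a)]
  obtain ⟨x0, hx0⟩ := hA
  have hA : A.Nonempty := ⟨x0, hx0⟩
  rw [Finset.sum_congr rfl (g := fun l : A → Fin n => if l = (fun _ => l ⟨x0, hx0⟩) then
    a ^ A.card * cum P₀ (fun x ω => F x (fun j => Z j ω)) A else 0)]
  · rw [Finset.sum_ite, Finset.sum_const_zero, add_zero, Finset.sum_const]
    have : (Finset.univ.filter fun l : A → Fin n => l = fun _ => l ⟨x0, hx0⟩) =
        Finset.univ.image (fun i : Fin n => fun _ : A => i) := by
      ext l
      simp only [Finset.mem_filter, Finset.mem_univ, true_and, Finset.mem_image]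
      constructor
      · intro h; exact ⟨_, h.symm⟩
      · rintro ⟨i, rfl⟩; rfl
    rw [this, Finset.card_image_of_injective _
      (fun i i' h => congrFun h ⟨x0, hx0⟩), Finset.card_univ, Fintype.card_fin, nsmul_eq_mul]
    ring
  · intro l _
    rw [Finset.prod_const, Finset.card_univ, Fintype.card_coe]
    split_ifs with h
    · congr 1
      rw [← cum_copy hW hF (l ⟨x0, hx0⟩), ← cum_subtype _ hA]
      congr 1
      ext x ω
      conv_lhs => rw [h]
    · have : ∃ x : A, l x ≠ l ⟨x0, hx0⟩ := by
        by_contra hcon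
        push Not at hcon
        exact h (funext hcon)
      obtain ⟨x, hx⟩ := this
      rw [cum_copies_eq_zero hW (F := fun x : A => F x) (fun x => hF x) (fun x => (l x : ℕ))
        (Finset.mem_univ x) (Finset.mem_univ ⟨x0, hx0⟩) (fun h => hx (Fin.ext h)), mul_zero]

end Copies

/-! ### Traces of powers as sums over cyclic index sequences -/

section Trace

/-- The sum over all the paths of length `m` of the product of the entries of `M`, weighted by the
end points. -/
theorem sum_path {V R : Type*} [Fintype V] [DecidableEq V] [CommRing R] (M : Matrix V V R) (m : ℕ)
    (f : V → V → R) :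
    ∑ j : Fin (m + 1) → V, (∏ i : Fin m, M (j i.castSucc) (j i.succ)) * f (j 0) (j (Fin.last m)) =
      ∑ u, ∑ v, (M ^ m) u v * f u v := by
  induction m generalizing f with
  | zero =>
    rw [← (Equiv.funUnique (Fin 1) V).symm.sum_comp]
    simp [Matrix.one_apply]
  | succ m ih =>
    rw [← (Fin.consEquiv (fun _ : Fin (m + 2) => V)).sum_comp, Fintype.sum_prod_type]
    refine Finset.sum_congr rfl fun u _ => ?_
    have := ih (fun w v => M u w * f u v)
    rw [Finset.sum_comm] at this
    calc _ = ∑ j : Fin (m + 1) → V, (∏ i : Fin m, M (j i.castSucc) (j i.succ)) *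
          (M u (j 0) * f u (j (Fin.last m))) := by
          refine Finset.sum_congr rfl fun j _ => ?_
          rw [Fin.prod_univ_succ]
          simp only [Fin.consEquiv, Equiv.coe_fn_mk, Fin.castSucc_zero, Fin.cons_zero,
            Fin.cons_succ, ← Fin.succ_castSucc, ← Fin.succ_last]
          ring
      _ = _ := by
          rw [this]
          refine Finset.sum_congr rfl fun v _ => ?_
          rw [pow_succ', Matrix.mul_apply, Finset.sum_mul]
          refine Finset.sum_congr rfl fun w _ => ?_
          ring

theorem prod_finRotate {R : Type*} [CommMonoid R] {V : Type*} (F : V → V → R) (m : ℕ)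
    (j : Fin (m + 1) → V) : ∏ i, F (j i) (j (finRotate (m + 1) i)) =
      (∏ i : Fin m, F (j i.castSucc) (j i.succ)) * F (j (Fin.last m)) (j 0) := by
  rw [Fin.prod_univ_castSucc, finRotate_last]
  congr 1
  refine Finset.prod_congr rfl fun i _ => ?_
  have : finRotate (m + 1) i.castSucc = i.succ := finRotate_of_lt i.2
  rw [this]

theorem trace_pow {V R : Type*} [Fintype V] [DecidableEq V] [CommRing R] (M : Matrix V V R)
    {k : ℕ} (hk : 0 < k) :
    (M ^ k).trace = ∑ j : Fin k → V, ∏ i, M (j i) (j (finRotate k i)) := by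
  obtain ⟨m, rfl⟩ := Nat.exists_eq_add_of_lt hk
  rw [zero_add]
  rw [Finset.sum_congr rfl (fun j _ => prod_finRotate (fun u v => M u v) m j),
    sum_path M m (fun u v => M v u)]
  simp only [Matrix.trace, Matrix.diag, pow_succ, Matrix.mul_apply]

end Trace

section Expansion

variable {Ω Ω₀ : Type*} [MeasurableSpace Ω] [MeasurableSpace Ω₀]
  {P : Measure Ω} [IsProbabilityMeasure P] {P₀ : Measure Ω₀} [IsProbabilityMeasure P₀]
  {W : ℕ → ℤ → Ω → ℝ} {Z : ℤ → Ω₀ → ℝ}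

/-- The index type of a product of cyclic words: letter `x.2` of the word number `x.1`. -/
abbrev Letter {r : ℕ} (k : Fin r → ℕ) : Type := Σ s : Fin r, Fin (k s)

/-- The cyclic successor of a letter in its word. -/
def nextLetter {r : ℕ} {k : Fin r → ℕ} (x : Letter k) : Letter k := ⟨x.1, finRotate (k x.1) x.2⟩

/-- The joint cumulants of the products `Z (u x) * Z (v x)`. -/
def pairCum {ι : Type*} [DecidableEq ι] [Fintype ι] (P₀ : Measure Ω₀) (Z : ℤ → Ω₀ → ℝ)
    (u v : ι → ℤ) : Finset ι → ℝ := cum P₀ (fun x ω => Z (u x) ω * Z (v x) ω)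

theorem bandedCov_apply (W : ℕ → ℤ → Ω → ℝ) (n p : ℕ) (b : ℝ) (ω : Ω) (i j : Fin p) :
    bandedCov W n p b ω i j = bandMatrix p b i j *
      ∑ l : Fin n, (n : ℝ)⁻¹ * (W l (((i : ℕ) : ℤ) + 1) ω * W l (((j : ℕ) : ℤ) + 1) ω) := by
  simp only [bandedCov, Matrix.of_apply, Matrix.mul_apply, Matrix.transpose_apply, dataMatrix]
  congr 1
  refine Finset.sum_congr rfl fun l _ => ?_
  rw [div_mul_div_comm, Real.mul_self_sqrt (Nat.cast_nonneg n)]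
  ring

/-- The joint cumulants of the traces, as sums over the indices `j` of the matrix entries and over
the partitions `σ` of these entries that connect the traces. -/
theorem jointCumulant_trace (hW : IsIIDCopies P P₀ W Z) (hZ : ∀ j, HasMoments P₀ (Z j))
    (n p : ℕ) (b : ℝ) {r : ℕ} (hr : 0 < r) (k : Fin r → ℕ) (hk : ∀ s, 0 < k s) :
    jointCumulant P (fun s ω => ((bandedCov W n p b ω) ^ (k s)).trace) =
      ∑ j : Letter k → Fin p, (∏ x, bandMatrix p b (j x) (j (nextLetter x))) *
        ∑ σ ∈ conn (Sigma.fst : Letter k → Fin r) Finset.univ,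
          ∏ A ∈ σ, ((n : ℝ)⁻¹ ^ A.card * n * pairCum P₀ Z (fun x => ((j x : ℕ) : ℤ) + 1)
            (fun x => ((j (nextLetter x) : ℕ) : ℤ) + 1) A) := by
  classical
  have hWm := fun i j => hW.hasMoments hZ i j
  set S : Fin p → Fin p → Ω → ℝ := fun u v ω =>
    ∑ l : Fin n, (n : ℝ)⁻¹ * (W l (((u : ℕ) : ℤ) + 1) ω * W l (((v : ℕ) : ℤ) + 1) ω) with hS
  have hSm : ∀ u v, HasMoments P (S u v) := fun u v =>
    hasMoments_sum _ fun l _ => ((hWm _ _).mul (hWm _ _)).const_mul _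
  have e1 : (fun s ω => ((bandedCov W n p b ω) ^ (k s)).trace) =
      fun (s : Fin r) ω => ∑ j : Fin (k s) → Fin p,
        (∏ i, bandMatrix p b (j i) (j (finRotate (k s) i))) *
          ∏ i, S (j i) (j (finRotate (k s) i)) ω := by
    ext s ω
    rw [trace_pow _ (hk s)]
    refine Finset.sum_congr rfl fun j _ => ?_
    rw [← Finset.prod_mul_distrib]
    exact Finset.prod_congr rfl fun i _ => bandedCov_apply W n p b ω _ _
  have hY : ∀ (s : Fin r) (j : Fin (k s) → Fin p),
      HasMoments P (fun ω => ∏ i, S (j i) (j (finRotate (k s) i)) ω) := fun s j =>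
    hasMoments_prod _ fun i _ => hSm _ _
  rw [e1, jointCumulant_eq_cum (fun s => hasMoments_sum _ fun j _ => (hY s j).const_mul _) hr,
    cum_sum hY, ← (Equiv.piCurry (fun (s : Fin r) (_ : Fin (k s)) => Fin p)).sum_comp]
  refine Finset.sum_congr rfl fun j _ => ?_
  rw [Fintype.prod_sigma]
  congr 1
  have e2 : (fun (s : Fin r) ω => ∏ i, S (Equiv.piCurry (fun (s : Fin r) (_ : Fin (k s)) => Fin p) j s i)
      (Equiv.piCurry (fun (s : Fin r) (_ : Fin (k s)) => Fin p) j s (finRotate (k s) i)) ω) =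
      fun s ω => ∏ x ∈ Finset.univ.filter (fun x : Letter k => x.1 = s),
        S (j x) (j (nextLetter x)) ω := by
    ext s ω
    rw [Finset.prod_filter, Fintype.prod_sigma, Finset.prod_eq_single s]
    · simp [nextLetter, Sigma.curry]
    · intro t _ hts; simp [hts]
    · simp
  rw [e2, cum_prod_fibres (X := fun x => S (j x) (j (nextLetter x))) (Sigma.fst : Letter k → Fin r)
    ⟨⟨0, hr⟩, Finset.mem_univ _⟩]
  refine Finset.sum_congr rfl fun σ hσ => Finset.prod_congr rfl fun A hA => ?_
  have hA : A.Nonempty := Finset.nonempty_iff_ne_empty.2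
    (fun h0 : A = ∅ => (mem_parts.1 (mem_conn.1 hσ).1).2.1 (h0 ▸ hA))
  exact cum_sum_copies hW
    (F := fun x z => z (((j x : ℕ) : ℤ) + 1) * z (((j (nextLetter x) : ℕ) : ℤ) + 1))
    (fun x => (measurable_pi_apply _).mul (measurable_pi_apply _))
    (fun i x => (hWm _ _).mul (hWm _ _)) n _ hA

end Expansion

/-! ### Summation over lattice configurations by exploration -/

section Exploration

open scoped ENNReal

variable {ι : Type*}

/-- The sum of `F` over all configurations that agree with `j` off the set `V`. -/
def marg (V : Finset ι) (F : (ι → ℤ) → ℝ≥0∞) (j : ι → ℤ) : ℝ≥0∞ :=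
  open Classical in
  ∑' y : ι → ℤ, if ∀ x, x ∉ V → y x = j x then F y else 0

theorem marg_mono {V V' : Finset ι} (hV : V ⊆ V') {F G : (ι → ℤ) → ℝ≥0∞} (h : ∀ y, F y ≤ G y)
    (j : ι → ℤ) : marg V F j ≤ marg V' G j := by
  classical
  refine ENNReal.tsum_le_tsum fun y => ?_
  split_ifs with h1 h2
  · exact h y
  · exact absurd (fun x hx => h1 x (fun hxV => hx (hV hxV))) h2
  · exact zero_le
  · exact le_rfl

theorem le_marg (V : Finset ι) (F : (ι → ℤ) → ℝ≥0∞) (j : ι → ℤ) : F j ≤ marg V F j := by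
  classical
  unfold marg
  refine le_trans ?_ (ENNReal.le_tsum j)
  simp

theorem marg_univ [Fintype ι] (F : (ι → ℤ) → ℝ≥0∞) (j : ι → ℤ) :
    marg Finset.univ F j = ∑' y, F y := by
  simp [marg]

theorem marg_union_le [DecidableEq ι] (U V : Finset ι) (F : (ι → ℤ) → ℝ≥0∞) (j : ι → ℤ) :
    marg (U ∪ V) F j ≤ marg U (marg V F) j := by
  classical
  have e : marg U (marg V F) j = ∑' y : ι → ℤ, ∑' z : ι → ℤ,
      if ∀ x, x ∉ U → z x = j x then (if ∀ x, x ∉ V → y x = z x then F y else 0) else 0 := by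
    rw [ENNReal.tsum_comm]
    refine tsum_congr fun z => ?_
    split_ifs
    · rfl
    · simp
  rw [e]
  refine ENNReal.tsum_le_tsum fun y => ?_
  split_ifs with h
  · refine le_trans ?_ (ENNReal.le_tsum (fun x => if x ∈ U then y x else j x))
    rw [if_pos, if_pos]
    · intro x hx
      by_cases hxU : x ∈ U
      · simp [hxU]
      · simp only [if_neg hxU]
        exact h x (by simp [hxU, hx])
    · intro x hx; simp [hx]
  · exact zero_le

theorem marg_const_mul_le [DecidableEq ι] {V : Finset ι} {F G H : (ι → ℤ) → ℝ≥0∞} {K : ℝ≥0∞}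
    (hF : ∀ y, F y ≤ K * G y * H y) (hG : ∀ y z : ι → ℤ, (∀ x, x ∉ V → y x = z x) → G y = G z)
    (j : ι → ℤ) : marg V F j ≤ K * G j * marg V H j := by
  classical
  simp only [marg]
  rw [← ENNReal.tsum_mul_left]
  refine ENNReal.tsum_le_tsum fun y => ?_
  split_ifs with h
  · rw [← hG y j h]; exact hF y
  · exact zero_le

theorem marg_le_tsum_of_injOn {V : Finset ι} {F : (ι → ℤ) → ℝ≥0∞} {j : ι → ℤ} {β : Type*}
    (φ : (ι → ℤ) → β) (G : β → ℝ≥0∞)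
    (hinj : ∀ y z : ι → ℤ, (∀ x, x ∉ V → y x = j x) → (∀ x, x ∉ V → z x = j x) → φ y = φ z → y = z)
    (h : ∀ y : ι → ℤ, (∀ x, x ∉ V → y x = j x) → F y ≤ G (φ y)) : marg V F j ≤ ∑' b, G b := by
  classical
  set s : Set (ι → ℤ) := {y | ∀ x, x ∉ V → y x = j x} with hs
  have e : marg V F j = ∑' y : s, F y := by
    rw [tsum_subtype s F]
    refine tsum_congr fun y => ?_
    simp [Set.indicator, hs]
  rw [e]
  calc ∑' y : s, F y ≤ ∑' y : s, G (φ y) := ENNReal.tsum_le_tsum fun y => h y y.2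
    _ ≤ ∑' b, G b := ENNReal.tsum_comp_le_tsum_of_injective
        (f := fun y : s => φ y) (fun y z hyz => Subtype.ext (hinj y z y.2 z.2 hyz)) G

variable [DecidableEq ι] [Fintype ι] {E : Type*} [Fintype E] [DecidableEq E]

/-- The part of the weight that is determined by the configuration on `U`: a weight `ρ` at the root
`a`, the weights `f e` of the clusters `J e`, and the weights `ℓ` of the links `x → next x`. -/
def exploreWeight (J : E → Finset ι) (f : E → (ι → ℤ) → ℝ≥0∞) (next : ι → ι) (a : ι)
    (ρ ℓ : ℤ → ℝ≥0∞) (U : Finset ι) (j : ι → ℤ) : ℝ≥0∞ :=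
  ρ (j a) * (∏ e, if J e ⊆ U then f e j else 1) *
    ∏ x, if x ∈ U ∧ next x ∈ U then ℓ (j x - j (next x)) else 1

/-- The functions modulo `2` that are constant on the clusters and vanish off `U`. -/
def clusterSpace (J : E → Finset ι) (U : Finset ι) : Submodule (ZMod 2) (ι → ZMod 2) where
  carrier := {h | (∀ e, ∀ x ∈ J e, ∀ y ∈ J e, h x = h y) ∧ ∀ x, x ∉ U → h x = 0}
  add_mem' := by
    rintro h h' ⟨h1, h2⟩ ⟨h1', h2'⟩
    refine ⟨fun e x hx y hy => ?_, fun x hx => ?_⟩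
    · simp [h1 e x hx y hy, h1' e x hx y hy]
    · simp [h2 x hx, h2' x hx]
  zero_mem' := by simp
  smul_mem' := by
    rintro c h ⟨h1, h2⟩
    refine ⟨fun e x hx y hy => ?_, fun x hx => ?_⟩
    · simp [h1 e x hx y hy]
    · simp [h2 x hx]

theorem mem_clusterSpace {J : E → Finset ι} {U : Finset ι} {h : ι → ZMod 2} :
    h ∈ clusterSpace J U ↔
      (∀ e, ∀ x ∈ J e, ∀ y ∈ J e, h x = h y) ∧ ∀ x, x ∉ U → h x = 0 := Iff.rfl

/-- The sum of the weight over the configurations on `U` is at most `M * N * D ^ m`: the root has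
total weight `N`, each of `m` links has total weight `D`, and the clusters cost the constant `M`,
which does not depend on the weights of the root and of the links. -/
def Explored (J : E → Finset ι) (f : E → (ι → ℤ) → ℝ≥0∞) (next : ι → ι) (a : ι) (U : Finset ι)
    (m : ℕ) : Prop :=
  a ∈ U ∧ ∃ M : ℝ≥0∞, M ≠ ∞ ∧ ∀ (ρ ℓ : ℤ → ℝ≥0∞) (N D : ℝ≥0∞), ∑' z, ρ z ≤ N → ∑' z, ℓ z ≤ D →
    (∀ z, ℓ z ≤ 1) → ∀ j, marg U (exploreWeight J f next a ρ ℓ U) j ≤ M * N * D ^ m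

/-- `U` is a union of clusters and of unclustered points. -/
def Saturated (J : E → Finset ι) (U : Finset ι) : Prop :=
  ∀ e, ∀ x ∈ J e, x ∈ U → J e ⊆ U

section Steps

variable {J : E → Finset ι} {f : E → (ι → ℤ) → ℝ≥0∞} {next : ι → ι} {a : ι} {C : ℝ≥0∞}

theorem exploreWeight_congr (hdep : ∀ e, ∀ y z : ι → ℤ, (∀ x ∈ J e, y x = z x) → f e y = f e z)
    (ρ ℓ : ℤ → ℝ≥0∞) {U : Finset ι} (ha : a ∈ U) {y z : ι → ℤ} (h : ∀ x ∈ U, y x = z x) :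
    exploreWeight J f next a ρ ℓ U y = exploreWeight J f next a ρ ℓ U z := by
  unfold exploreWeight
  rw [h a ha]
  congr 1
  · congr 1
    refine Finset.prod_congr rfl fun e _ => ?_
    split_ifs with he
    · exact hdep e y z fun x hx => h x (he hx)
    · rfl
  · refine Finset.prod_congr rfl fun x _ => ?_
    split_ifs with hx
    · rw [h x hx.1, h _ hx.2]
    · rfl

theorem explored_base (hC : 1 ≤ C) (hC' : C ≠ ∞) (hbd : ∀ e j, f e j ≤ C) :
    Explored J f next a {a} 0 := by
  refine ⟨Finset.mem_singleton_self a, C ^ Fintype.card E, ENNReal.pow_ne_top hC',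
    fun ρ ℓ N D hρ hℓ hℓ1 j => ?_⟩
  rw [pow_zero, mul_one]
  have h1 : ∀ y, exploreWeight J f next a ρ ℓ {a} y ≤ C ^ Fintype.card E * ρ (y a) := by
    intro y
    have h2 : (∏ e, if J e ⊆ {a} then f e y else 1) ≤ C ^ Fintype.card E := by
      refine (Finset.prod_le_prod' (g := fun _ => C) fun e _ => ?_).trans (by simp)
      split_ifs
      · exact hbd e y
      · exact hC
    have h3 : (∏ x, if x ∈ ({a} : Finset ι) ∧ next x ∈ ({a} : Finset ι)
        then ℓ (y x - y (next x)) else 1) ≤ 1 := by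
      refine Finset.prod_le_one' fun x _ => ?_
      split_ifs
      · exact hℓ1 _
      · exact le_rfl
    calc _ ≤ ρ (y a) * C ^ Fintype.card E * 1 := by
          unfold exploreWeight; gcongr
      _ = _ := by ring
  refine (marg_le_tsum_of_injOn (fun y => y a) (fun z => C ^ Fintype.card E * ρ z) ?_
    (fun y _ => h1 y)).trans ?_
  · intro y z hy hz hyz
    ext x
    by_cases hx : x = a
    · subst hx; exact hyz
    · rw [hy x (by simpa using hx), hz x (by simpa using hx)]
  · rw [ENNReal.tsum_mul_left]
    gcongr

/-- Enlarging the explored set by a set `V` whose weight `H` is summable. -/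
theorem marg_explore_le (hdep : ∀ e, ∀ y z : ι → ℤ, (∀ x ∈ J e, y x = z x) → f e y = f e z)
    {U V : Finset ι} (ha : a ∈ U) (hUV : Disjoint U V) {ρ ℓ : ℤ → ℝ≥0∞} {H : (ι → ℤ) → ℝ≥0∞}
    {K c : ℝ≥0∞} (hW : ∀ y, exploreWeight J f next a ρ ℓ (U ∪ V) y ≤
      K * exploreWeight J f next a ρ ℓ U y * H y) (hH : ∀ j, marg V H j ≤ c) (j : ι → ℤ) :
    marg (U ∪ V) (exploreWeight J f next a ρ ℓ (U ∪ V)) j ≤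
      K * c * marg U (exploreWeight J f next a ρ ℓ U) j := by
  refine (marg_union_le U V _ j).trans ?_
  have h1 : ∀ y, marg V (exploreWeight J f next a ρ ℓ (U ∪ V)) y ≤
      K * c * exploreWeight J f next a ρ ℓ U y := by
    intro y
    refine (marg_const_mul_le hW (fun y z hyz => exploreWeight_congr hdep ρ ℓ ha fun x hx =>
      hyz x (Finset.disjoint_left.1 hUV hx)) y).trans ?_
    calc _ ≤ K * exploreWeight J f next a ρ ℓ U y * c := by gcongr; exact hH y
      _ = _ := by ring
  refine (marg_mono (Finset.Subset.refl U) h1 j).trans ?_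
  classical
  simp only [marg]
  rw [← ENNReal.tsum_mul_left]
  refine ENNReal.tsum_le_tsum fun y => ?_
  split_ifs
  · exact le_rfl
  · exact zero_le

theorem prod_cluster_le (hC : 1 ≤ C) (hbd : ∀ e j, f e j ≤ C) {U U' : Finset ι} (hU : U ⊆ U')
    (y : ι → ℤ) : (∏ e, if J e ⊆ U' then f e y else 1) ≤
      C ^ Fintype.card E * ∏ e, if J e ⊆ U then f e y else 1 := by
  rw [← Finset.card_univ, ← Finset.prod_const, ← Finset.prod_mul_distrib]
  refine Finset.prod_le_prod' fun e _ => ?_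
  split_ifs with h1 h2 h2
  · exact le_mul_of_one_le_left' hC
  · simpa using hbd e y
  · exact absurd (h2.trans hU) h1
  · simpa using hC

theorem prod_link_le {ℓ : ℤ → ℝ≥0∞} (hℓ1 : ∀ z, ℓ z ≤ 1) {U U' : Finset ι} (hU : U ⊆ U')
    (y : ι → ℤ) : (∏ x, if x ∈ U' ∧ next x ∈ U' then ℓ (y x - y (next x)) else 1) ≤
      ∏ x, if x ∈ U ∧ next x ∈ U then ℓ (y x - y (next x)) else 1 := by
  refine Finset.prod_le_prod' fun x _ => ?_
  split_ifs with h1 h2 h2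
  · exact le_rfl
  · exact hℓ1 _
  · exact absurd ⟨hU h2.1, hU h2.2⟩ h1
  · exact le_rfl

/-- A cluster that meets the explored set is explored at a bounded cost, since its weight is
summable over its other points. -/
theorem Explored.cluster (hC : 1 ≤ C) (hC' : C ≠ ∞) (hbd : ∀ e j, f e j ≤ C)
    (hdep : ∀ e, ∀ y z : ι → ℤ, (∀ x ∈ J e, y x = z x) → f e y = f e z)
    (hmarg : ∀ e, ∀ x ∈ J e, ∀ j, marg (J e \ {x}) (f e) j ≤ C)
    {U : Finset ι} {m : ℕ} (h : Explored J f next a U m) {e : E} {x : ι} (hx : x ∈ J e)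
    (hxU : x ∈ U) (he : ¬ J e ⊆ U) : Explored J f next a (U ∪ (J e \ U)) m := by
  obtain ⟨ha, M, hM, h⟩ := h
  refine ⟨Finset.mem_union_left _ ha, C ^ Fintype.card E * C * M,
    ENNReal.mul_ne_top (ENNReal.mul_ne_top (ENNReal.pow_ne_top hC') hC') hM,
    fun ρ ℓ N D hρ hℓ hℓ1 j => ?_⟩
  refine (marg_explore_le hdep ha Finset.disjoint_sdiff (H := f e) (K := C ^ Fintype.card E)
    (c := C) (fun y => ?_) (fun j => ?_) j).trans ?_
  · unfold exploreWeight
    have h1 : (∏ e', if J e' ⊆ U ∪ (J e \ U) then f e' y else 1) ≤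
        C ^ Fintype.card E * (∏ e', if J e' ⊆ U then f e' y else 1) * f e y := by
      have h2 : (∏ e', if e' = e then f e y else 1) = f e y := by
        rw [Finset.prod_ite_eq' Finset.univ e (fun _ => f e y)]; simp
      rw [← Finset.card_univ, ← Finset.prod_const, ← Finset.prod_mul_distrib, ← h2,
        ← Finset.prod_mul_distrib]
      refine Finset.prod_le_prod' fun e' _ => ?_
      by_cases hee : e' = e
      · subst hee
        simp only [if_neg he, if_true, mul_one]
        split_ifs
        · exact le_mul_of_one_le_left' hC
        · rename_i hcon
          exact absurd (fun x hx => by simp [hx]) hcon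
      · simp only [if_neg hee, mul_one]
        split_ifs with h3 h4 h4
        · exact le_mul_of_one_le_left' hC
        · simpa using hbd e' y
        · exact absurd (h4.trans Finset.subset_union_left) h3
        · simpa using hC
    calc _ ≤ ρ (y a) * (C ^ Fintype.card E * (∏ e', if J e' ⊆ U then f e' y else 1) * f e y) *
          ∏ x, if x ∈ U ∧ next x ∈ U then ℓ (y x - y (next x)) else 1 := by
          exact mul_le_mul' (mul_le_mul' le_rfl h1) (prod_link_le hℓ1 Finset.subset_union_left y)
      _ = _ := by ring
  · refine (marg_mono (fun z hz => ?_) (fun _ => le_rfl) j).trans (hmarg e x hx j)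
    rw [Finset.mem_sdiff] at hz ⊢
    exact ⟨hz.1, fun hzx => hz.2 (by rw [Finset.mem_singleton.1 hzx]; exact hxU)⟩
  · calc _ ≤ C ^ Fintype.card E * C * (M * N * D ^ m) := by
          gcongr; exact h ρ ℓ N D hρ hℓ hℓ1 j
      _ = _ := by ring

/-- Leaving the explored set along a link costs a factor `D`. -/
theorem Explored.link (hC : 1 ≤ C) (hC' : C ≠ ∞) (hbd : ∀ e j, f e j ≤ C)
    (hdep : ∀ e, ∀ y z : ι → ℤ, (∀ x ∈ J e, y x = z x) → f e y = f e z)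
    {U : Finset ι} {m : ℕ} (h : Explored J f next a U m) {x : ι}
    (hxU : x ∈ U) (hx : next x ∉ U) : Explored J f next a (U ∪ {next x}) (m + 1) := by
  obtain ⟨ha, M, hM, h⟩ := h
  refine ⟨Finset.mem_union_left _ ha, C ^ Fintype.card E * M,
    ENNReal.mul_ne_top (ENNReal.pow_ne_top hC') hM,
    fun ρ ℓ N D hρ hℓ hℓ1 j => ?_⟩
  have hne : x ≠ next x := fun h => hx (h ▸ hxU)
  refine (marg_explore_le hdep ha (Finset.disjoint_singleton_right.2 hx)
    (H := fun y => ℓ (y x - y (next x))) (K := C ^ Fintype.card E)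
    (c := D) (fun y => ?_) (fun j => ?_) j).trans ?_
  · unfold exploreWeight
    have h1 : (∏ x', if x' ∈ U ∪ {next x} ∧ next x' ∈ U ∪ {next x} then
          ℓ (y x' - y (next x')) else 1) ≤
        (∏ x', if x' ∈ U ∧ next x' ∈ U then ℓ (y x' - y (next x')) else 1) *
          ℓ (y x - y (next x)) := by
      have h2 : (∏ x', if x' = x then ℓ (y x - y (next x)) else 1) = ℓ (y x - y (next x)) := by
        rw [Finset.prod_ite_eq' Finset.univ x (fun _ => ℓ (y x - y (next x)))]; simp
      rw [← h2, ← Finset.prod_mul_distrib]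
      refine Finset.prod_le_prod' fun x' _ => ?_
      by_cases hxx : x' = x
      · subst hxx
        simp [hx, hxU]
      · simp only [if_neg hxx, mul_one]
        split_ifs with h3 h4 h4
        · exact le_rfl
        · exact hℓ1 _
        · exact absurd ⟨Finset.mem_union_left _ h4.1, Finset.mem_union_left _ h4.2⟩ h3
        · exact le_rfl
    calc _ ≤ ρ (y a) * (C ^ Fintype.card E * (∏ e', if J e' ⊆ U then f e' y else 1)) *
          ((∏ x', if x' ∈ U ∧ next x' ∈ U then ℓ (y x' - y (next x')) else 1) *
            ℓ (y x - y (next x))) := by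
          exact mul_le_mul' (mul_le_mul' le_rfl
            (prod_cluster_le hC hbd Finset.subset_union_left y)) h1
      _ = _ := by ring
  · refine (marg_le_tsum_of_injOn (fun y => y x - y (next x)) ℓ ?_ (fun y _ => le_rfl)).trans hℓ
    intro y z hy hz hyz
    have h1 : y x = z x := by rw [hy x (by simpa using hne), hz x (by simpa using hne)]
    ext w
    by_cases hw : w = next x
    · subst hw
      linarith
    · rw [hy w (by simpa using hw), hz w (by simpa using hw)]
  · calc _ ≤ C ^ Fintype.card E * D * (M * N * D ^ m) := by
          gcongr; exact h ρ ℓ N D hρ hℓ hℓ1 j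
      _ = _ := by ring

/-- All the clusters that can be reached from the explored set are explored at a bounded cost. -/
theorem Explored.saturate (hC : 1 ≤ C) (hC' : C ≠ ∞) (hbd : ∀ e j, f e j ≤ C)
    (hdep : ∀ e, ∀ y z : ι → ℤ, (∀ x ∈ J e, y x = z x) → f e y = f e z)
    (hmarg : ∀ e, ∀ x ∈ J e, ∀ j, marg (J e \ {x}) (f e) j ≤ C)
    {U : Finset ι} {m : ℕ} (h : Explored J f next a U m) :
    ∃ U', U ⊆ U' ∧ Saturated J U' ∧ Explored J f next a U' m := by
  induction hn : (Uᶜ).card using Nat.strong_induction_on generalizing U with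
  | _ n ih =>
    by_cases hs : Saturated J U
    · exact ⟨U, Finset.Subset.refl U, hs, h⟩
    · unfold Saturated at hs
      push Not at hs
      obtain ⟨e, x, hx, hxU, he⟩ := hs
      have h' := h.cluster hC hC' hbd hdep hmarg hx hxU he
      obtain ⟨z, hz, hzU⟩ := Finset.not_subset.1 he
      have hlt : ((U ∪ (J e \ U))ᶜ).card < n := by
        rw [← hn]
        refine Finset.card_lt_card (Finset.ssubset_iff_subset_ne.2 ⟨?_, fun heq => ?_⟩)
        · exact Finset.compl_subset_compl.2 Finset.subset_union_left
        · have : z ∈ (U ∪ (J e \ U))ᶜ := by rw [heq]; exact Finset.mem_compl.2 hzU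
          simp [hz, hzU] at this
      obtain ⟨U', h1, h2, h3⟩ := ih _ hlt h' rfl
      exact ⟨U', Finset.subset_union_left.trans h1, h2, h3⟩

theorem indicator_mem_clusterSpace {U : Finset ι} (hs : Saturated J U) :
    (fun x => if x ∈ U then (1 : ZMod 2) else 0) ∈ clusterSpace J U := by
  rw [mem_clusterSpace]
  refine ⟨fun e x hx y hy => ?_, fun x hx => by simp [hx]⟩
  by_cases hxU : x ∈ U
  · rw [if_pos hxU, if_pos (hs e x hx hxU hy)]
  · rw [if_neg hxU, if_neg fun hyU => hxU (hs e y hy hyU hx)]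

/-- The exploration reaches all points, with fewer links than the dimension of the space of
functions that are constant on clusters: every link followed by a saturation enlarges the space of
such functions supported in the explored set by the indicator function of that set. -/
theorem exists_explored_univ (hC : 1 ≤ C) (hC' : C ≠ ∞) (hbd : ∀ e j, f e j ≤ C)
    (hdep : ∀ e, ∀ y z : ι → ℤ, (∀ x ∈ J e, y x = z x) → f e y = f e z)
    (hmarg : ∀ e, ∀ x ∈ J e, ∀ j, marg (J e \ {x}) (f e) j ≤ C)
    (hconn : ∀ U : Finset ι, U.Nonempty → Saturated J U → (∀ x ∈ U, next x ∈ U) → U = Finset.univ)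
    (a : ι) : ∃ m, m + 1 ≤ Module.finrank (ZMod 2) (clusterSpace J Finset.univ) ∧
      Explored J f next a Finset.univ m := by
  have key : ∀ n : ℕ, ∀ U : Finset ι, ∀ m, (Uᶜ).card = n → Saturated J U →
      Explored J f next a U m → m + 1 ≤ Module.finrank (ZMod 2) (clusterSpace J U) →
      ∃ m, m + 1 ≤ Module.finrank (ZMod 2) (clusterSpace J Finset.univ) ∧
        Explored J f next a Finset.univ m := by
    intro n
    induction n using Nat.strong_induction_on with
    | _ n ih =>
      intro U m hn hs h hm
      by_cases hU : ∀ x ∈ U, next x ∈ U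
      · have := hconn U ⟨a, h.1⟩ hs hU
        subst this
        exact ⟨m, hm, h⟩
      · push Not at hU
        obtain ⟨x, hxU, hx⟩ := hU
        obtain ⟨U', hUU', hs', h'⟩ :=
          (h.link hC hC' hbd hdep hxU hx).saturate hC hC' hbd hdep hmarg
        have hxU' : next x ∈ U' := hUU' (by simp)
        have hsub : U ⊆ U' := Finset.subset_union_left.trans hUU'
        refine ih _ ?_ U' (m + 1) rfl hs' h' ?_
        · rw [← hn]
          refine Finset.card_lt_card (Finset.ssubset_iff_subset_ne.2 ⟨?_, fun heq => ?_⟩)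
          · exact Finset.compl_subset_compl.2 hsub
          · have : next x ∈ U'ᶜ := by rw [heq]; exact Finset.mem_compl.2 hx
            exact Finset.mem_compl.1 this hxU'
        · refine Nat.succ_le_of_lt (lt_of_le_of_lt hm (Submodule.finrank_lt_finrank_of_lt ?_))
          refine lt_of_le_of_ne (fun h hh => ⟨hh.1, fun y hy => hh.2 y fun hyU => hy (hsub hyU)⟩) ?_
          intro heq
          have := indicator_mem_clusterSpace hs'
          rw [← heq] at this
          have := this.2 _ hx
          simp [hxU'] at this
  obtain ⟨U, hU, hs, h⟩ := (explored_base (J := J) (f := f) (next := next) (a := a)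
    hC hC' hbd).saturate hC hC' hbd hdep hmarg
  refine key _ U 0 rfl hs h ?_
  rw [zero_add, Submodule.one_le_finrank_iff]
  intro hbot
  have := indicator_mem_clusterSpace hs
  rw [hbot, Submodule.mem_bot] at this
  have := congrFun this a
  simp [h.1] at this

end Steps

end Exploration

/-! ### Counting components by linear algebra modulo two -/

section Counting

variable {α : Type*} [DecidableEq α] [Fintype α]

/-- The functions modulo `2` that are constant on the blocks of the partition `π`. -/
abbrev blockSpace (π : Finset (Finset α)) : Submodule (ZMod 2) (α → ZMod 2) :=
  clusterSpace (fun B : π => (B : Finset α)) Finset.univ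

theorem mem_blockSpace {π : Finset (Finset α)} {h : α → ZMod 2} :
    h ∈ blockSpace π ↔ ∀ B ∈ π, ∀ x ∈ B, ∀ y ∈ B, h x = h y := by
  rw [mem_clusterSpace]
  simp

theorem finrank_blockSpace_le {π : Finset (Finset α)} (hπ : π ∈ parts Finset.univ) :
    Module.finrank (ZMod 2) (blockSpace π) ≤ π.card := by
  obtain ⟨-, h2, -, h4⟩ := mem_parts.1 hπ
  have hne : ∀ B : π, (B : Finset α).Nonempty := fun B =>
    Finset.nonempty_iff_ne_empty.2 (fun h0 => h2 (h0 ▸ B.2))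
  let T : blockSpace π →ₗ[ZMod 2] (π → ZMod 2) :=
    { toFun := fun f B => f.1 (hne B).choose
      map_add' := fun _ _ => rfl
      map_smul' := fun _ _ => rfl }
  have hT : Function.Injective T := by
    intro f f' hff
    refine Subtype.ext (funext fun x => ?_)
    obtain ⟨B, hB, hx⟩ := h4 x (Finset.mem_univ x)
    have e := congrFun hff ⟨B, hB⟩
    rw [mem_blockSpace.1 f.2 B hB x hx _ (hne ⟨B, hB⟩).choose_spec,
      mem_blockSpace.1 f'.2 B hB x hx _ (hne ⟨B, hB⟩).choose_spec]
    exact e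
  simpa using LinearMap.finrank_le_finrank_of_injective hT

theorem le_finrank_blockSpace {π : Finset (Finset α)} (hπ : π ∈ parts Finset.univ) :
    π.card ≤ Module.finrank (ZMod 2) (blockSpace π) := by
  obtain ⟨-, h2, h3, h4⟩ := mem_parts.1 hπ
  have hex : ∀ x, ∃ B : π, x ∈ (B : Finset α) := fun x => by
    obtain ⟨B, hB, hx⟩ := h4 x (Finset.mem_univ x)
    exact ⟨⟨B, hB⟩, hx⟩
  choose b hb using hex
  have hb' : ∀ B ∈ π, ∀ x ∈ B, (b x : Finset α) = B := fun B hB x hx =>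
    h3 _ (b x).2 B hB x (hb x) hx
  let T : (π → ZMod 2) →ₗ[ZMod 2] blockSpace π :=
    { toFun := fun w => ⟨fun x => w (b x), mem_blockSpace.2 fun B hB x hx y hy => by
        rw [Subtype.ext ((hb' B hB x hx).trans (hb' B hB y hy).symm)]⟩
      map_add' := fun _ _ => rfl
      map_smul' := fun _ _ => rfl }
  have hT : Function.Injective T := by
    intro w w' hww
    ext B
    obtain ⟨x, hx⟩ := Finset.nonempty_iff_ne_empty.2 (fun h0 : (B : Finset α) = ∅ => h2 (h0 ▸ B.2))
    have e := congrFun (congrArg Subtype.val hww) x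
    have : b x = B := Subtype.ext (hb' B B.2 x hx)
    have e' : w (b x) = w' (b x) := e
    rwa [this] at e'
  simpa using LinearMap.finrank_le_finrank_of_injective hT

theorem sum_card_parts {π : Finset (Finset α)} (hπ : π ∈ parts Finset.univ) :
    ∑ B ∈ π, B.card = Fintype.card α := by
  obtain ⟨-, h2, h3, h4⟩ := mem_parts.1 hπ
  rw [← Finset.card_univ, ← Finset.card_biUnion]
  · congr 1
    ext x
    simpa using h4 x (Finset.mem_univ x)
  · intro B hB C hC hBC
    exact Finset.disjoint_left.2 fun x hx hx' => hBC (h3 B hB C hC x hx hx')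

theorem finrank_le_one_of_const {M : Submodule (ZMod 2) (α → ZMod 2)}
    (h : ∀ f ∈ M, ∀ x y, f x = f y) : Module.finrank (ZMod 2) M ≤ 1 := by
  rcases isEmpty_or_nonempty α with he | ⟨⟨a⟩⟩
  · have h1 := Submodule.finrank_le M
    rw [Module.finrank_fintype_fun_eq_card, Fintype.card_eq_zero] at h1
    omega
  let T : M →ₗ[ZMod 2] ZMod 2 :=
    { toFun := fun f => f.1 a
      map_add' := fun _ _ => rfl
      map_smul' := fun _ _ => rfl }
  have hT : Function.Injective T := by
    intro f f' hff
    refine Subtype.ext (funext fun x => ?_)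
    rw [h f f.2 x a, h f' f'.2 x a]
    exact hff
  simpa using LinearMap.finrank_le_finrank_of_injective hT

variable {S : Type*} [DecidableEq S] [Fintype S]

theorem pre_univ (g : α → S) : pre g Finset.univ = Finset.univ := by ext; simp

/-- A function that is constant on the fibres of `g` and on the blocks of a connecting partition is
constant. -/
theorem const_of_conn {g : α → S} {σ : Finset (Finset α)} (hσ : σ ∈ conn g Finset.univ)
    {h : α → ZMod 2} (hb : h ∈ blockSpace σ) (hg : ∀ x y, g x = g y → h x = h y) (x y : α) :
    h x = h y := by
  classical
  set U := (Finset.univ.filter fun z => h z = h x).image g with hU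
  have hmem : ∀ z, g z ∈ U ↔ h z = h x := by
    intro z
    simp only [hU, Finset.mem_image, Finset.mem_filter, Finset.mem_univ, true_and]
    constructor
    · rintro ⟨w, hw, hwz⟩; rw [← hg w z hwz, hw]
    · intro hz; exact ⟨z, hz, rfl⟩
  have := (mem_conn.1 hσ).2 U (Finset.subset_univ _) ⟨g x, (hmem x).2 rfl⟩ (by
    intro B hB z hz w hw hzU
    rw [hmem] at hzU ⊢
    rw [← hzU]
    exact mem_blockSpace.1 hb B hB w hw z hz)
  have hy : g y ∈ U := by rw [this]; exact Finset.mem_univ _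
  exact ((hmem y).1 hy).symm

/-- A connecting partition of `α` has at most `|α| + 1 - |S|` blocks. -/
theorem card_conn_add_le {g : α → S} (hg : Function.Surjective g) {σ : Finset (Finset α)}
    (hσ : σ ∈ conn g Finset.univ) : σ.card + Fintype.card S ≤ Fintype.card α + 1 := by
  have hp : σ ∈ parts Finset.univ := by
    have := (mem_conn.1 hσ).1
    rwa [pre_univ] at this
  set T : (S → ZMod 2) →ₗ[ZMod 2] (α → ZMod 2) := LinearMap.funLeft (ZMod 2) (ZMod 2) g with hT
  have hTi : Function.Injective T := LinearMap.funLeft_injective_of_surjective _ _ g hg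
  have h1 : Module.finrank (ZMod 2) (LinearMap.range T) = Fintype.card S := by
    rw [LinearMap.finrank_range_of_inj hTi, Module.finrank_fintype_fun_eq_card]
  have h2 := Submodule.finrank_sup_add_finrank_inf_eq (blockSpace σ) (LinearMap.range T)
  have h3 : Module.finrank (ZMod 2) ↥(blockSpace σ ⊓ LinearMap.range T) ≤ 1 := by
    refine finrank_le_one_of_const fun f hf x y => const_of_conn hσ hf.1 ?_ x y
    obtain ⟨h, rfl⟩ := hf.2
    intro x y hxy
    simp [hT, LinearMap.funLeft_apply, hxy]
  have h4 := Submodule.finrank_le (blockSpace σ ⊔ LinearMap.range T)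
  rw [Module.finrank_fintype_fun_eq_card] at h4
  have h5 := le_finrank_blockSpace hp
  omega

/-- The vertex of a half-edge: the edge `x` joins the vertices `x` and `next x`. -/
def vtx (next : α → α) (x : α × Bool) : α := if x.2 then next x.1 else x.1

theorem sum_halfEdges (g : α → S) (s : S) (F : α × Bool → ZMod 2) :
    ∑ x ∈ Finset.univ.filter (fun x : α × Bool => g x.1 = s), F x =
      ∑ x ∈ Finset.univ.filter (fun x : α => g x = s), (F (x, true) + F (x, false)) := by
  rw [Finset.sum_filter, Fintype.sum_prod_type, Finset.sum_filter]
  refine Finset.sum_congr rfl fun x _ => ?_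
  by_cases h : g x = s <;> simp [h]

/-- Let `σ` be a partition of the edges that connects at least two cycles, and
let `π` be a partition of the half-edges without singletons that refines and connects the blocks of
`σ`. Then the number of blocks of `σ` and the number of classes of vertices generated by `π` add up
to at most the number of edges.

The functions on half-edges that are constant on the blocks of `σ`, and those induced by functions
on vertex classes, span a subspace of the functions that are constant on the blocks of `π`, and meet
in the constants. Both vanish under summation over the half-edges of a fixed cycle, modulo `2`;
if all blocks of `π` have size two, one of them meets that cycle in one half-edge. -/
theorem finrank_clusterSpace_add_card_le {g : α → S} {next : α → α}
    (hnext : Function.Bijective next) (hgn : ∀ x, g (next x) = g x)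
    (htrans : ∀ h : α → ZMod 2, (∀ x, h (next x) = h x) → ∀ x y, g x = g y → h x = h y)
    {σ : Finset (Finset α)} (hσ : σ ∈ conn g Finset.univ) (hS : 1 < Fintype.card S)
    {π : Finset (Finset (α × Bool))} (hπ : π ∈ parts Finset.univ)
    (hπσ : ∀ B ∈ π, ∃ A ∈ σ, ∀ x ∈ B, x.1 ∈ A)
    (hπc : ∀ A ∈ σ, ∀ U ⊆ A, U.Nonempty →
      (∀ B ∈ π, ∀ x ∈ B, ∀ y ∈ B, x.1 ∈ U → y.1 ∈ U) → U = A)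
    (h2 : ∀ B ∈ π, 2 ≤ B.card) :
    Module.finrank (ZMod 2) (clusterSpace (fun B : π => (B : Finset (α × Bool)).image (vtx next))
      Finset.univ) + σ.card ≤ Fintype.card α := by
  classical
  obtain ⟨p1, p2, p3, p4⟩ := mem_parts.1 hπ
  have hp : σ ∈ parts Finset.univ := by
    have := (mem_conn.1 hσ).1
    rwa [pre_univ] at this
  set CS := clusterSpace (fun B : π => (B : Finset (α × Bool)).image (vtx next)) Finset.univ with hCS
  set T0 : (α → ZMod 2) →ₗ[ZMod 2] (α × Bool → ZMod 2) :=
    LinearMap.funLeft (ZMod 2) (ZMod 2) Prod.fst with hT0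
  set T1 : (α → ZMod 2) →ₗ[ZMod 2] (α × Bool → ZMod 2) :=
    LinearMap.funLeft (ZMod 2) (ZMod 2) (vtx next) with hT1
  have i0 : Function.Injective T0 :=
    LinearMap.funLeft_injective_of_surjective _ _ _ fun x => ⟨(x, false), rfl⟩
  have i1 : Function.Injective T1 :=
    LinearMap.funLeft_injective_of_surjective _ _ _ fun x => ⟨(x, false), by simp [vtx]⟩
  set U0 := (blockSpace σ).map T0 with hU0
  set U1 := CS.map T1 with hU1
  have d0 : Module.finrank (ZMod 2) U0 = Module.finrank (ZMod 2) (blockSpace σ) :=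
    LinearEquiv.finrank_eq (Submodule.equivMapOfInjective T0 i0 _).symm
  have d1 : Module.finrank (ZMod 2) U1 = Module.finrank (ZMod 2) CS :=
    LinearEquiv.finrank_eq (Submodule.equivMapOfInjective T1 i1 _).symm
  have hdim := Submodule.finrank_sup_add_finrank_inf_eq U0 U1
  have hinf : Module.finrank (ZMod 2) ↥(U0 ⊓ U1) ≤ 1 := by
    refine finrank_le_one_of_const fun f hf x y => ?_
    obtain ⟨⟨h, hh, rfl⟩, ⟨h', -, hh'⟩⟩ := hf
    have e1 : ∀ x, h' x = h x := fun x => by simpa [hT0, hT1, vtx] using congrFun hh' (x, false)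
    have e2 : ∀ x, h' (next x) = h x := fun x => by
      simpa [hT0, hT1, vtx] using congrFun hh' (x, true)
    exact const_of_conn hσ hh (htrans h fun x => by rw [← e1 (next x), e2]) x.1 y.1
  obtain ⟨s⟩ : Nonempty S := Fintype.card_pos_iff.1 (by omega)
  let φ : (α × Bool → ZMod 2) →ₗ[ZMod 2] ZMod 2 :=
    { toFun := fun f => ∑ x ∈ Finset.univ.filter (fun x : α × Bool => g x.1 = s), f x
      map_add' := fun f f' => by simp [Finset.sum_add_distrib]
      map_smul' := fun c f => by simp [Finset.mul_sum] }
  have hφ : ∀ f, φ f = ∑ x ∈ Finset.univ.filter (fun x : α × Bool => g x.1 = s), f x :=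
    fun f => rfl
  have htwo : ∀ z : ZMod 2, z + z = 0 := by decide
  have hsup : U0 ⊔ U1 ≤ blockSpace π ⊓ LinearMap.ker φ := by
    refine sup_le ?_ ?_
    · rintro _ ⟨h, hh, rfl⟩
      refine ⟨mem_blockSpace.2 fun B hB x hx y hy => ?_, ?_⟩
      · obtain ⟨A, hA, hBA⟩ := hπσ B hB
        exact mem_blockSpace.1 hh A hA _ (hBA x hx) _ (hBA y hy)
      · rw [SetLike.mem_coe, LinearMap.mem_ker, hφ, sum_halfEdges]
        refine Finset.sum_eq_zero fun x _ => ?_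
        simp [hT0, htwo]
    · rintro _ ⟨h, hh, rfl⟩
      refine ⟨mem_blockSpace.2 fun B hB x hx y hy => ?_, ?_⟩
      · exact hh.1 ⟨B, hB⟩ _ (Finset.mem_image_of_mem _ hx) _ (Finset.mem_image_of_mem _ hy)
      · rw [SetLike.mem_coe, LinearMap.mem_ker, hφ, sum_halfEdges]
        simp only [hT1, LinearMap.funLeft_apply, vtx, if_true, Bool.false_eq_true, if_false]
        rw [Finset.sum_add_distrib]
        have : ∑ x ∈ Finset.univ.filter (fun x : α => g x = s), h (next x) =
            ∑ x ∈ Finset.univ.filter (fun x : α => g x = s), h x := by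
          refine Finset.sum_bij (fun x _ => next x) ?_ ?_ ?_ ?_
          · intro x hx; simpa [hgn] using hx
          · intro x _ y _ hxy; exact hnext.1 hxy
          · intro y hy
            obtain ⟨x, rfl⟩ := hnext.2 y
            exact ⟨x, by simpa [hgn] using hy, rfl⟩
          · intro x _; rfl
        rw [this, htwo]
  have hle := Submodule.finrank_mono hsup
  have hsum := sum_card_parts hπ
  rw [Fintype.card_prod, Fintype.card_bool] at hsum
  have hcard : π.card * 2 ≤ Fintype.card α * 2 := by
    rw [← hsum, ← smul_eq_mul]
    exact Finset.card_nsmul_le_sum _ _ _ h2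
  have hVπ := finrank_blockSpace_le hπ
  have hσd := le_finrank_blockSpace hp
  have hmono : Module.finrank (ZMod 2) ↥(blockSpace π ⊓ LinearMap.ker φ) ≤
      Module.finrank (ZMod 2) (blockSpace π) := Submodule.finrank_mono inf_le_left
  have hlt : Module.finrank (ZMod 2) ↥(blockSpace π ⊓ LinearMap.ker φ) + 1 ≤ Fintype.card α := by
    rcases Nat.lt_or_ge π.card (Fintype.card α) with hlt | hge
    · omega
    -- all blocks have size two
    have hall : ∀ B ∈ π, B.card = 2 := by
      have : ∑ B ∈ π, 2 = ∑ B ∈ π, B.card := by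
        rw [hsum, Finset.sum_const, smul_eq_mul]; omega
      intro B hB
      exact ((Finset.sum_eq_sum_iff_of_le h2).1 this B hB).symm
    -- a block of `σ` that meets the cycle `s` and another cycle
    have hns : ¬ IsClosedUnder g σ {s} := by
      intro hc
      have := (mem_conn.1 hσ).2 {s} (Finset.subset_univ _) ⟨s, by simp⟩ hc
      have := congrArg Finset.card this
      rw [Finset.card_singleton, Finset.card_univ] at this
      omega
    unfold IsClosedUnder at hns
    push Not at hns
    obtain ⟨A, hA, x, hx, y, hy, hxs, hys⟩ := hns
    rw [Finset.mem_singleton] at hxs hys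
    set U := A.filter (fun z => g z = s) with hU
    have hUA : U ≠ A := fun h => by
      have : y ∈ U := by rw [h]; exact hy
      exact hys (Finset.mem_filter.1 this).2
    have hnc : ¬ ∀ B ∈ π, ∀ x ∈ B, ∀ y ∈ B, x.1 ∈ U → y.1 ∈ U := fun hc =>
      hUA (hπc A hA U (Finset.filter_subset _ _) ⟨x, Finset.mem_filter.2 ⟨hx, hxs⟩⟩ hc)
    push Not at hnc
    obtain ⟨B, hB, z, hz, w, hw, hzU, hwU⟩ := hnc
    obtain ⟨A', hA', hBA'⟩ := hπσ B hB
    obtain ⟨hzA, hzs⟩ := Finset.mem_filter.1 hzU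
    have hAA' : A' = A := (mem_parts.1 hp).2.2.1 A' hA' A hA z.1 (hBA' z hz) hzA
    have hws : g w.1 ≠ s := fun h => hwU (Finset.mem_filter.2 ⟨hAA' ▸ hBA' w hw, h⟩)
    have hzw : z ≠ w := fun h => hws (h ▸ hzs)
    have hBzw : B = {z, w} := by
      symm
      refine Finset.eq_of_subset_of_card_le (fun v hv => ?_) ?_
      · rcases Finset.mem_insert.1 hv with rfl | hv
        · exact hz
        · rw [Finset.mem_singleton.1 hv]; exact hw
      · rw [hall B hB, Finset.card_pair hzw]
    have hstrict : blockSpace π ⊓ LinearMap.ker φ < blockSpace π := by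
      refine lt_of_le_of_ne inf_le_left fun heq => ?_
      have hf : (fun v => if v ∈ B then (1 : ZMod 2) else 0) ∈ blockSpace π := by
        refine mem_blockSpace.2 fun C hC u hu v hv => ?_
        by_cases hCB : C = B
        · subst hCB; simp [hu, hv]
        · rw [if_neg fun h => hCB (p3 C hC B hB u hu h), if_neg fun h => hCB (p3 C hC B hB v hv h)]
      rw [← heq] at hf
      have h0 := LinearMap.mem_ker.1 hf.2
      rw [hφ, ← Finset.sum_filter, Finset.sum_const, Finset.filter_filter] at h0
      have : Finset.univ.filter (fun v : α × Bool => g v.1 = s ∧ v ∈ B) = {z} := by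
        ext v
        simp only [Finset.mem_filter, Finset.mem_univ, true_and, Finset.mem_singleton, hBzw,
          Finset.mem_insert]
        constructor
        · rintro ⟨h1, rfl | rfl⟩
          · rfl
          · exact absurd h1 hws
        · rintro rfl; exact ⟨hzs, Or.inl rfl⟩
      rw [this] at h0
      simp at h0
    have := Submodule.finrank_lt_finrank_of_lt hstrict
    omega
  omega

end Counting

/-! ### Summability of the joint cumulants of a stationary sequence -/

section Stationary

open scoped ENNReal

variable {Ω₀ : Type*} [MeasurableSpace Ω₀] {P₀ : Measure Ω₀} [IsProbabilityMeasure P₀]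
  {Z : ℤ → Ω₀ → ℝ}

theorem mom_shift (hs : IsStationary P₀ Z) {α : Type*} (u : α → ℤ) (m : ℤ) :
    mom P₀ (fun x => Z (u x + m)) = mom P₀ (fun x => Z (u x)) := by
  ext A
  have := (hs.shift m).comp (Finset.measurable_prod A fun x _ => measurable_pi_apply (u x) :
    Measurable fun z : ℤ → ℝ => ∏ x ∈ A, z (u x))
  exact this.integral_eq

theorem cum_shift (hs : IsStationary P₀ Z) {α : Type*} [DecidableEq α] [Fintype α] (u : α → ℤ)
    (m : ℤ) : cum P₀ (fun x => Z (u x + m)) = cum P₀ (fun x => Z (u x)) := by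
  unfold cum; rw [mom_shift hs]

theorem integral_eq_zero (hs : IsStationary P₀ Z) (hm : MomentConditions P₀ Z) (j : ℤ) :
    ∫ ω, Z j ω ∂P₀ = 0 := by
  have := congrFun (mom_shift (P₀ := P₀) hs (fun _ : Unit => 0) j) Finset.univ
  simpa [mom, hm.mean_zero] using this

theorem cum_singleton {Ω : Type*} [MeasurableSpace Ω] {P : Measure Ω} [IsProbabilityMeasure P]
    {α : Type*} [DecidableEq α] [Fintype α] (X : α → Ω → ℝ) (x : α) :
    cum P X {x} = ∫ ω, X x ω ∂P := by
  have h := (isCumulant_cum (P := P) X).rec_eq (A := {x}) (a := x) (by simp)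
  have e : ({x} : Finset α).powerset.filter (fun B => x ∈ B) = {{x}} := by
    ext B
    simp only [Finset.mem_filter, Finset.mem_powerset, Finset.mem_singleton,
      Finset.subset_singleton_iff]
    constructor
    · rintro ⟨rfl | rfl, h⟩
      · simp at h
      · rfl
    · rintro rfl; simp
  rw [e, Finset.sum_singleton] at h
  have h0 : mom P X ∅ = 1 := by simp [mom]
  rw [Finset.sdiff_self, h0, mul_one] at h
  rw [← h]
  simp [mom]

/-- The sum of the absolute values of the joint cumulants of `Z 0` and `r` further variables. -/
def cumulantNorm (P₀ : Measure Ω₀) (Z : ℤ → Ω₀ → ℝ) (r : ℕ) : ℝ≥0∞ :=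
  ∑' j : Fin r → ℤ, ENNReal.ofReal
    |jointCumulant P₀ (fun s : Fin (r + 1) => Z ((Fin.cons 0 j : Fin (r + 1) → ℤ) s))|

theorem cumulantNorm_ne_top (hm : MomentConditions P₀ Z) {r : ℕ} (hr : 1 ≤ r) :
    cumulantNorm P₀ Z r ≠ ∞ := (hm.cumulant_summable r hr).tsum_ofReal_ne_top

theorem jointCumulant_shift (hs : IsStationary P₀ Z) (hm : MomentConditions P₀ Z) {k : ℕ}
    (hk : 0 < k) (u : Fin k → ℤ) (m : ℤ) :
    jointCumulant P₀ (fun s => Z (u s + m)) = jointCumulant P₀ (fun s => Z (u s)) := by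
  rw [jointCumulant_eq_cum (fun i => hs.hasMoments hm _) hk,
    jointCumulant_eq_cum (fun i => hs.hasMoments hm _) hk, cum_shift hs]

/-- The joint cumulants of the variables at the positions `y (v x)`, `x ∈ B`, are summable over the
positions other than a fixed one. -/
theorem marg_cum_le (hs : IsStationary P₀ Z) (hm : MomentConditions P₀ Z) {α V : Type*}
    [DecidableEq α] [Fintype α] [DecidableEq V] (v : α → V) {B : Finset α} {a : V}
    (ha : a ∈ B.image v) (j : V → ℤ) :
    marg (B.image v \ {a}) (fun y => ENNReal.ofReal |cum P₀ (fun x => Z (y (v x))) B|) j ≤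
      cumulantNorm P₀ Z (B.card - 1) := by
  obtain ⟨x0, hx0, rfl⟩ := Finset.mem_image.1 ha
  obtain ⟨r, hr⟩ : ∃ r, B.card = r + 1 := ⟨B.card - 1, by
    have := Finset.card_pos.2 ⟨x0, hx0⟩; omega⟩
  rw [hr, Nat.add_sub_cancel]
  let e0 := (B.equivFinOfCardEq hr).symm
  let e1 : Fin (r + 1) ≃ B := (Equiv.swap 0 (e0.symm ⟨x0, hx0⟩)).trans e0
  have he1 : (e1 0 : α) = x0 := by simp [e1]
  let e : Fin (r + 1) ↪ α := e1.toEmbedding.trans (Function.Embedding.subtype (· ∈ B))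
  have he0 : e 0 = x0 := he1
  have hmap : Finset.univ.map e = B := by
    ext x
    simp only [Finset.mem_map, Finset.mem_univ, true_and]
    constructor
    · rintro ⟨i, rfl⟩; exact (e1 i).2
    · intro hx; exact ⟨e1.symm ⟨x, hx⟩, by simp [e]⟩
  have hF : ∀ y : V → ℤ, cum P₀ (fun x => Z (y (v x))) B = jointCumulant P₀
      (fun s : Fin (r + 1) => Z ((Fin.cons 0 (fun i : Fin r => y (v (e i.succ)) - y (v x0)) :
        Fin (r + 1) → ℤ) s)) := by
    intro y
    conv_lhs => rw [← hmap]
    rw [← cum_comap (fun x => Z (y (v x))) e ⟨0, Finset.mem_univ _⟩,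
      ← jointCumulant_eq_cum (fun i => hs.hasMoments hm _) (Nat.succ_pos r)]
    refine Eq.trans ?_ (jointCumulant_shift hs hm (Nat.succ_pos r) _ (y (v x0)))
    congr 1
    ext s ω
    congr 1
    refine Fin.cases ?_ (fun i => ?_) s
    · simp [he0]
    · simp
  refine marg_le_tsum_of_injOn (fun y i => y (v (e (Fin.succ i))) - y (v x0))
    (fun j : Fin r → ℤ => ENNReal.ofReal
      |jointCumulant P₀ (fun s : Fin (r + 1) => Z ((Fin.cons 0 j : Fin (r + 1) → ℤ) s))|)
    ?_ (fun y _ => by rw [hF])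
  intro y z hy hz hyz
  have h0 : y (v x0) = z (v x0) := by
    rw [hy _ (by simp), hz _ (by simp)]
  have hi : ∀ i : Fin (r + 1), y (v (e i)) = z (v (e i)) := by
    intro i
    refine Fin.cases ?_ (fun i => ?_) i
    · rw [he0, h0]
    · have := congrFun hyz i
      simp only [h0] at this
      linarith
  ext w
  by_cases hw : w ∈ B.image v
  · obtain ⟨x, hx, rfl⟩ := Finset.mem_image.1 hw
    rw [← hmap, Finset.mem_map] at hx
    obtain ⟨i, -, rfl⟩ := hx
    exact hi i
  · rw [hy w (fun h => hw (Finset.sdiff_subset h)), hz w (fun h => hw (Finset.sdiff_subset h))]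

end Stationary

/-! ### The bound on the contribution of a partition -/

section Bound

open scoped ENNReal

variable {Ω₀ : Type*} [MeasurableSpace Ω₀] {P₀ : Measure Ω₀} [IsProbabilityMeasure P₀]
  {Z : ℤ → Ω₀ → ℝ}
variable {α S : Type*} [DecidableEq α] [Fintype α] [DecidableEq S] [Fintype S]

/-- The positions `1, …, p` of the columns. -/
def pos {p : ℕ} (j : α → Fin p) : α → ℤ := fun x => ((j x : ℕ) : ℤ) + 1

theorem pos_injective {p : ℕ} : Function.Injective (pos : (α → Fin p) → α → ℤ) := by
  intro j j' h
  ext x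
  have := congrFun h x
  simp only [pos] at this
  omega

/-- `π` is a partition of the half-edges `(x, false)`, `(x, true)` of the edges `x`. It refines the
partition `σ` of the edges, and connects the edges within each block of `σ`. -/
structure Refines (σ : Finset (Finset α)) (π : Finset (Finset (α × Bool))) : Prop where
  parts : π ∈ parts Finset.univ
  le : ∀ B ∈ π, ∃ A ∈ σ, ∀ x ∈ B, x.1 ∈ A
  connects : ∀ A ∈ σ, ∀ U ⊆ A, U.Nonempty →
    (∀ B ∈ π, ∀ x ∈ B, ∀ y ∈ B, x.1 ∈ U → y.1 ∈ U) → U = A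

/-- `next` is a permutation of the letters whose cycles are the fibres of `g`. -/
structure IsCyclicOn (g : α → S) (next : α → α) : Prop where
  bijective : Function.Bijective next
  fibre : ∀ x, g (next x) = g x
  trans : ∀ h : α → ZMod 2, (∀ x, h (next x) = h x) → ∀ x y, g x = g y → h x = h y

/-- A set of vertices that is closed under `next` and under the blocks of half-edges is a union of
cycles and of blocks of `σ`, so that it contains everything because `σ` connects the cycles. -/
theorem eq_univ_of_saturated {g : α → S} {next : α → α} (hc : IsCyclicOn g next)
    {σ : Finset (Finset α)} (hσ : σ ∈ conn g Finset.univ) {π : Finset (Finset (α × Bool))}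
    (hπ : Refines σ π) {U : Finset α} (hU : U.Nonempty)
    (hs : Saturated (fun B : π => (B : Finset (α × Bool)).image (vtx next)) U)
    (hn : ∀ x ∈ U, next x ∈ U) : U = Finset.univ := by
  classical
  have hp : σ ∈ BandedCovariance.parts Finset.univ := by
    have := (mem_conn.1 hσ).1
    rwa [pre_univ] at this
  have himg : U.image next = U := by
    refine Finset.eq_of_subset_of_card_le (fun y hy => ?_) ?_
    · obtain ⟨x, hx, rfl⟩ := Finset.mem_image.1 hy
      exact hn x hx
    · rw [Finset.card_image_of_injective _ hc.bijective.1]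
  have hn' : ∀ x, next x ∈ U ↔ x ∈ U := by
    intro x
    refine ⟨fun h => ?_, hn x⟩
    rw [← himg] at h
    obtain ⟨y, hy, hyx⟩ := Finset.mem_image.1 h
    rwa [← hc.bijective.1 hyx]
  have hfib : ∀ x y, g x = g y → x ∈ U → y ∈ U := by
    intro x y hxy hx
    have := hc.trans (fun x => if x ∈ U then 1 else 0) (fun x => by simp only [hn']) x y hxy
    by_contra hy
    simp [hx, hy] at this
  have hv : ∀ z : α × Bool, vtx next z ∈ U ↔ z.1 ∈ U := by
    rintro ⟨x, _ | _⟩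
    · simp [vtx]
    · simpa [vtx] using hn' x
  have hA : ∀ A ∈ σ, ∀ x ∈ A, x ∈ U → A ⊆ U := by
    intro A hA x hx hxU
    have := hπ.connects A hA (A ∩ U) Finset.inter_subset_left ⟨x, Finset.mem_inter.2 ⟨hx, hxU⟩⟩ (by
      intro B hB z hz w hw hzU
      rw [Finset.mem_inter] at hzU ⊢
      obtain ⟨A', hA', hBA'⟩ := hπ.le B hB
      have hAA' : A' = A := (mem_parts.1 hp).2.2.1 A' hA' A hA z.1 (hBA' z hz) hzU.1
      refine ⟨hAA' ▸ hBA' w hw, ?_⟩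
      rw [← hv]
      exact hs ⟨B, hB⟩ (vtx next z) (Finset.mem_image_of_mem _ hz) ((hv z).2 hzU.2)
        (Finset.mem_image_of_mem _ hw))
    rw [← this]
    exact Finset.inter_subset_right
  have himage : U.image g = Finset.univ := by
    refine (mem_conn.1 hσ).2 _ (Finset.subset_univ _) (hU.image g) ?_
    intro A hAσ x hx y hy hxU
    obtain ⟨x', hx', hxx'⟩ := Finset.mem_image.1 hxU
    exact Finset.mem_image_of_mem g (hA A hAσ x hx (hfib x' x hxx' hx') hy)
  rw [Finset.eq_univ_iff_forall]
  intro y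
  have : g y ∈ U.image g := by rw [himage]; exact Finset.mem_univ _
  obtain ⟨x, hx, hxy⟩ := Finset.mem_image.1 this
  exact hfib x y hxy hx

theorem tsum_indicator_le {b : ℝ} (hb : 1 ≤ b) :
    ∑' z : ℤ, (if |(z : ℝ)| ≤ b then (1 : ℝ≥0∞) else 0) ≤ ENNReal.ofReal (3 * b) := by
  have hb0 : 0 ≤ b := by linarith
  have h1 : ∀ z : ℤ, (if |(z : ℝ)| ≤ b then (1 : ℝ≥0∞) else 0) ≠ 0 →
      z ∈ Finset.Icc (-(⌊b⌋₊ : ℤ)) (⌊b⌋₊ : ℤ) := by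
    intro z hz
    have hz : |(z : ℝ)| ≤ b := by by_contra h; simp [h] at hz
    have h2 : z.natAbs ≤ ⌊b⌋₊ := by
      refine Nat.le_floor ?_
      rwa [Nat.cast_natAbs, Int.cast_abs]
    rw [Finset.mem_Icc]
    omega
  rw [tsum_eq_sum (s := Finset.Icc (-(⌊b⌋₊ : ℤ)) (⌊b⌋₊ : ℤ))
    (fun z hz => by by_contra h; exact hz (h1 z h))]
  calc _ ≤ ∑ z ∈ Finset.Icc (-(⌊b⌋₊ : ℤ)) (⌊b⌋₊ : ℤ), (1 : ℝ≥0∞) := by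
        refine Finset.sum_le_sum fun z _ => ?_
        split_ifs <;> simp
    _ = ((2 * ⌊b⌋₊ + 1 : ℕ) : ℝ≥0∞) := by
        rw [Finset.sum_const, Int.card_Icc, nsmul_eq_mul, mul_one]
        congr 1
        omega
    _ = ENNReal.ofReal ((2 * ⌊b⌋₊ + 1 : ℕ) : ℝ) := (ENNReal.ofReal_natCast _).symm
    _ ≤ _ := by
        refine ENNReal.ofReal_le_ofReal ?_
        push_cast
        have := Nat.floor_le hb0
        linarith

theorem bandMatrix_nonneg (p : ℕ) (b : ℝ) (i j : Fin p) : 0 ≤ bandMatrix p b i j := by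
  classical
  simp only [bandMatrix, Matrix.of_apply]
  split_ifs <;> norm_num

theorem bandMatrix_eq_pos {p : ℕ} (b : ℝ) (j : α → Fin p) (x y : α) :
    ENNReal.ofReal (bandMatrix p b (j x) (j y)) =
      if |((pos j x - pos j y : ℤ) : ℝ)| ≤ b then 1 else 0 := by
  classical
  simp only [bandMatrix, Matrix.of_apply, pos]
  push_cast
  rw [show ((j x : ℕ) : ℝ) + 1 - (((j y : ℕ) : ℝ) + 1) = ((j x : ℕ) : ℝ) - ((j y : ℕ) : ℝ) by ring]
  split_ifs <;> simp

/-- The weighted sum over the indices for a fixed refining partition of the half-edges. The points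
of the exploration are the letters, the clusters are the blocks of half-edges, weighted by their
cumulants, and the links are the steps within the band. -/
theorem refines_bound (hs : IsStationary P₀ Z) (hm : MomentConditions P₀ Z) {g : α → S}
    {next : α → α} (hc : IsCyclicOn g next) (hS : 1 < Fintype.card S)
    {σ : Finset (Finset α)} (hσ : σ ∈ conn g Finset.univ) {π : Finset (Finset (α × Bool))}
    (hπ : Refines σ π) : ∃ M : ℝ, ∀ (p : ℕ) (b : ℝ), 1 ≤ b →
      ∑ j : α → Fin p, (∏ x, bandMatrix p b (j x) (j (next x))) *
        ∏ B ∈ π, |cum P₀ (fun x => Z (pos j (vtx next x))) B| ≤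
        M * p * b ^ (Fintype.card α - σ.card - 1) := by
  classical
  have hπne : ∀ B ∈ π, B.Nonempty := fun B hB =>
    Finset.nonempty_iff_ne_empty.2 (fun h0 => (mem_parts.1 hπ.parts).2.1 (h0 ▸ hB))
  by_cases h2 : ∀ B ∈ π, 2 ≤ B.card
  swap
  · -- a singleton contributes the first cumulant, which vanishes
    push Not at h2
    obtain ⟨B, hB, hlt⟩ := h2
    have h1 : B.card = 1 := by have := Finset.card_pos.2 (hπne B hB); omega
    obtain ⟨x, rfl⟩ := Finset.card_eq_one.1 h1
    refine ⟨0, fun p b _ => le_of_eq ?_⟩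
    rw [zero_mul, zero_mul]
    refine Finset.sum_eq_zero fun j _ => ?_
    rw [Finset.prod_eq_zero hB, mul_zero]
    rw [cum_singleton, integral_eq_zero hs hm, abs_zero]
  set J : π → Finset α := fun B => (B : Finset (α × Bool)).image (vtx next) with hJ
  set f : π → (α → ℤ) → ℝ≥0∞ := fun B y =>
    ENNReal.ofReal |cum P₀ (fun x => Z (y (vtx next x))) B| with hf
  set C : ℝ≥0∞ := 1 + ∑ B : π, cumulantNorm P₀ Z ((B : Finset (α × Bool)).card - 1) with hC
  have hC1 : 1 ≤ C := le_self_add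
  have hCt : C ≠ ∞ := by
    refine ENNReal.add_ne_top.2 ⟨ENNReal.one_ne_top, (ENNReal.sum_ne_top).2 fun B _ => ?_⟩
    exact cumulantNorm_ne_top hm (by have := h2 B B.2; omega)
  have hBC : ∀ B : π, cumulantNorm P₀ Z ((B : Finset (α × Bool)).card - 1) ≤ C := fun B =>
    (Finset.single_le_sum (f := fun B : π => cumulantNorm P₀ Z ((B : Finset (α × Bool)).card - 1))
      (fun _ _ => zero_le) (Finset.mem_univ B)).trans le_add_self
  have hmarg : ∀ e, ∀ x ∈ J e, ∀ j, marg (J e \ {x}) (f e) j ≤ C := fun e x hx j =>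
    (marg_cum_le hs hm (vtx next) hx j).trans (hBC e)
  have hbd : ∀ e j, f e j ≤ C := by
    intro e j
    obtain ⟨x, hx⟩ := (hπne e e.2).image (vtx next)
    exact (le_marg _ _ j).trans (hmarg e x hx j)
  have hdep : ∀ e, ∀ y z : α → ℤ, (∀ x ∈ J e, y x = z x) → f e y = f e z := by
    intro e y z hyz
    simp only [hf]
    rw [← cum_subtype _ (hπne e e.2), ← cum_subtype _ (hπne e e.2)]
    have : (fun x : (e : Finset (α × Bool)) => Z (y (vtx next x))) =
        fun x : (e : Finset (α × Bool)) => Z (z (vtx next x)) := by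
      ext x
      rw [hyz _ (Finset.mem_image_of_mem _ x.2)]
    rw [this]
  -- the letters are nonempty since the partition `σ` connects at least two words
  obtain ⟨a⟩ : Nonempty α := by
    by_contra hne
    rw [not_nonempty_iff] at hne
    obtain ⟨s, t, hst⟩ := Fintype.one_lt_card_iff.1 hS
    have := (mem_conn.1 hσ).2 {s} (Finset.subset_univ _) ⟨s, by simp⟩
      (fun B _ x _ => (hne.false x).elim)
    have ht : t ∈ ({s} : Finset S) := by rw [this]; exact Finset.mem_univ _
    exact hst (Finset.mem_singleton.1 ht).symm
  obtain ⟨m, hm1, -, M, hM, hMb⟩ := exists_explored_univ (J := J) (f := f) (next := next) hC1 hCt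
    hbd hdep hmarg (fun U hU hsat hn => eq_univ_of_saturated hc hσ hπ hU hsat hn) a
  have hdim : Module.finrank (ZMod 2) (clusterSpace J Finset.univ) + σ.card ≤ Fintype.card α :=
    finrank_clusterSpace_add_card_le hc.bijective hc.fibre hc.trans hσ hS hπ.parts
    hπ.le hπ.connects h2
  have hmK : m ≤ Fintype.card α - σ.card - 1 := by omega
  refine ⟨M.toReal * 3 ^ m, fun p b hb => ?_⟩
  have hb0 : 0 ≤ b := by linarith
  set ρ : ℤ → ℝ≥0∞ := fun z => if z ∈ Finset.Icc (1 : ℤ) p then 1 else 0 with hρ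
  set ℓ : ℤ → ℝ≥0∞ := fun z => if |(z : ℝ)| ≤ b then 1 else 0 with hℓ
  have hρs : ∑' z, ρ z ≤ (p : ℝ≥0∞) := by
    rw [tsum_eq_sum (s := Finset.Icc (1 : ℤ) p) (fun z hz => by simp only [hρ, if_neg hz]),
      Finset.sum_congr rfl (g := fun _ => (1 : ℝ≥0∞)) (fun z hz => by simp only [hρ, if_pos hz])]
    simp
  have key := hMb ρ ℓ p (ENNReal.ofReal (3 * b)) hρs (tsum_indicator_le hb)
    (fun z => by simp only [hℓ]; split_ifs <;> simp) 0
  rw [marg_univ] at key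
  have hterm : ∀ j : α → Fin p, ENNReal.ofReal ((∏ x, bandMatrix p b (j x) (j (next x))) *
        ∏ B ∈ π, |cum P₀ (fun x => Z (pos j (vtx next x))) B|) =
      exploreWeight J f next a ρ ℓ Finset.univ (pos j) := by
    intro j
    have h1 : ρ (pos j a) = 1 := by
      simp only [hρ, pos]
      rw [if_pos]
      rw [Finset.mem_Icc]
      have := (j a).2
      omega
    rw [exploreWeight, h1, one_mul, ENNReal.ofReal_mul
      (Finset.prod_nonneg fun x _ => bandMatrix_nonneg _ _ _ _),
      ENNReal.ofReal_prod_of_nonneg fun x _ => bandMatrix_nonneg _ _ _ _,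
      ENNReal.ofReal_prod_of_nonneg fun B _ => abs_nonneg _, mul_comm, ← Finset.prod_coe_sort π]
    congr 1
    · simp [hf]
    · refine Finset.prod_congr rfl fun x _ => ?_
      rw [bandMatrix_eq_pos]
      simp [hℓ]
  have hsum : ENNReal.ofReal (∑ j : α → Fin p, (∏ x, bandMatrix p b (j x) (j (next x))) *
        ∏ B ∈ π, |cum P₀ (fun x => Z (pos j (vtx next x))) B|) ≤
      M * p * ENNReal.ofReal (3 * b) ^ m := by
    rw [ENNReal.ofReal_sum_of_nonneg (fun j _ => mul_nonneg
      (Finset.prod_nonneg fun x _ => bandMatrix_nonneg _ _ _ _)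
      (Finset.prod_nonneg fun B _ => abs_nonneg _))]
    refine le_trans ?_ key
    rw [Finset.sum_congr rfl fun j _ => hterm j, ← tsum_fintype (L := .unconditional _)]
    exact ENNReal.tsum_comp_le_tsum_of_injective pos_injective _
  have hfin : M * p * ENNReal.ofReal (3 * b) ^ m ≠ ∞ :=
    ENNReal.mul_ne_top (ENNReal.mul_ne_top hM (ENNReal.natCast_ne_top p))
      (ENNReal.pow_ne_top ENNReal.ofReal_ne_top)
  have hreal := (ENNReal.ofReal_le_iff_le_toReal hfin).1 hsum
  refine hreal.trans ?_
  rw [ENNReal.toReal_mul, ENNReal.toReal_mul, ENNReal.toReal_pow, ENNReal.toReal_natCast,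
    ENNReal.toReal_ofReal (by positivity), mul_pow]
  calc M.toReal * p * (3 ^ m * b ^ m) = M.toReal * 3 ^ m * p * b ^ m := by ring
    _ ≤ _ := by
      gcongr

/-- The half-edge `(x, false)` sits at the letter `x`, and `(x, true)` at the next letter. -/
theorem pairCum_eq_sum (next : α → α) (y : α → ℤ) {A : Finset α} (hA : A.Nonempty) :
    pairCum P₀ Z y (fun x => y (next x)) A =
      ∑ π ∈ conn (Prod.fst : α × Bool → α) A, wt (cum P₀ (fun x => Z (y (vtx next x)))) π := by
  rw [← cum_prod_fibres _ _ hA, pairCum]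
  congr 1
  ext x ω
  have : Finset.univ.filter (fun z : α × Bool => z.1 = x) = {(x, false), (x, true)} := by
    ext ⟨z, c⟩
    cases c <;> simp
  rw [this, Finset.prod_pair (by simp)]
  simp [vtx]

/-- The choice of a connecting partition in each block of `σ` gives a refining partition. -/
theorem refines_biUnion {σ : Finset (Finset α)} (hσ : σ ∈ parts Finset.univ)
    (q : σ → Finset (Finset (α × Bool)))
    (hq : ∀ A : σ, q A ∈ conn (Prod.fst : α × Bool → α) A) :
    Refines σ (Finset.univ.biUnion q) := by
  obtain ⟨s1, s2, s3, s4⟩ := mem_parts.1 hσ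
  have hmem : ∀ B, B ∈ Finset.univ.biUnion q ↔ ∃ A, B ∈ q A := by simp
  have hsub : ∀ A, ∀ B ∈ q A, ∀ x ∈ B, x.1 ∈ (A : Finset α) := by
    intro A B hB x hx
    simpa using (mem_parts.1 (mem_conn.1 (hq A)).1).1 B hB hx
  refine ⟨mem_parts.2 ⟨fun B _ => Finset.subset_univ B, ?_, ?_, ?_⟩, ?_, ?_⟩
  · rw [hmem]
    rintro ⟨A, hA⟩
    exact (mem_parts.1 (mem_conn.1 (hq A)).1).2.1 hA
  · intro B hB C hC x hx hx'
    obtain ⟨A, hA⟩ := (hmem B).1 hB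
    obtain ⟨A', hA'⟩ := (hmem C).1 hC
    have : A = A' := Subtype.ext (s3 A A.2 A' A'.2 x.1 (hsub A B hA x hx) (hsub A' C hA' x hx'))
    subst this
    exact (mem_parts.1 (mem_conn.1 (hq A)).1).2.2.1 B hA C hA' x hx hx'
  · intro x _
    obtain ⟨A, hA, hxA⟩ := s4 x.1 (Finset.mem_univ _)
    obtain ⟨B, hB, hx⟩ := (mem_parts.1 (mem_conn.1 (hq ⟨A, hA⟩)).1).2.2.2 x (by simpa using hxA)
    exact ⟨B, (hmem B).2 ⟨_, hB⟩, hx⟩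
  · intro B hB
    obtain ⟨A, hA⟩ := (hmem B).1 hB
    exact ⟨A, A.2, hsub A B hA⟩
  · intro A hA U hU hne hcl
    exact (mem_conn.1 (hq ⟨A, hA⟩)).2 U hU hne fun B hB => hcl B ((hmem B).2 ⟨_, hB⟩)

/-- The sum over the indices of the contribution of a partition `σ` that connects at least two
traces is of order at most `p * b ^ (|α| - |σ| - 1)`. -/
theorem partition_bound (hs : IsStationary P₀ Z) (hm : MomentConditions P₀ Z) {g : α → S}
    {next : α → α} (hc : IsCyclicOn g next) (hS : 1 < Fintype.card S)
    {σ : Finset (Finset α)} (hσ : σ ∈ conn g Finset.univ) :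
    ∃ M : ℝ, ∀ (p : ℕ) (b : ℝ), 1 ≤ b →
      ∑ j : α → Fin p, (∏ x, bandMatrix p b (j x) (j (next x))) *
        ∏ A ∈ σ, |pairCum P₀ Z (pos j) (fun x => pos j (next x)) A| ≤
        M * p * b ^ (Fintype.card α - σ.card - 1) := by
  classical
  have hp : σ ∈ parts Finset.univ := by
    have := (mem_conn.1 hσ).1
    rwa [pre_univ] at this
  have hne : ∀ A : σ, (A : Finset α).Nonempty := fun A =>
    Finset.nonempty_iff_ne_empty.2 (fun h0 => (mem_parts.1 hp).2.1 (h0 ▸ A.2))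
  set Q := Fintype.piFinset (fun A : σ => conn (Prod.fst : α × Bool → α) (A : Finset α)) with hQ
  have hex : ∀ q : σ → Finset (Finset (α × Bool)), ∃ M : ℝ, q ∈ Q → ∀ (p : ℕ) (b : ℝ), 1 ≤ b →
      ∑ j : α → Fin p, (∏ x, bandMatrix p b (j x) (j (next x))) *
        ∏ B ∈ Finset.univ.biUnion q, |cum P₀ (fun x => Z (pos j (vtx next x))) B| ≤
        M * p * b ^ (Fintype.card α - σ.card - 1) := by
    intro q
    by_cases hq : q ∈ Q
    · obtain ⟨M, hM⟩ := refines_bound hs hm hc hS hσ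
        (refines_biUnion hp q (fun A => Fintype.mem_piFinset.1 hq A))
      exact ⟨M, fun _ => hM⟩
    · exact ⟨0, fun h => absurd h hq⟩
  choose M hM using hex
  refine ⟨∑ q ∈ Q, M q, fun p b hb => ?_⟩
  have h1 : ∀ j : α → Fin p, ∏ A ∈ σ, |pairCum P₀ Z (pos j) (fun x => pos j (next x)) A| ≤
      ∑ q ∈ Q, ∏ B ∈ Finset.univ.biUnion q, |cum P₀ (fun x => Z (pos j (vtx next x))) B| := by
    intro j
    calc _ ≤ ∏ A : σ, ∑ π ∈ conn (Prod.fst : α × Bool → α) (A : Finset α),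
          ∏ B ∈ π, |cum P₀ (fun x => Z (pos j (vtx next x))) B| := by
          rw [← Finset.prod_coe_sort σ]
          refine Finset.prod_le_prod (fun _ _ => abs_nonneg _) fun A _ => ?_
          rw [pairCum_eq_sum next (pos j) (hne A)]
          refine (Finset.abs_sum_le_sum_abs _ _).trans (le_of_eq ?_)
          refine Finset.sum_congr rfl fun π _ => ?_
          rw [wt, Finset.abs_prod]
      _ = _ := by
          rw [Finset.prod_univ_sum]
          refine Finset.sum_congr rfl fun q hq => ?_
          have hq := fun A => Fintype.mem_piFinset.1 hq A
          rw [Finset.prod_biUnion]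
          intro A _ A' _ hAA'
          have hdis : Disjoint (A : Finset α) (A' : Finset α) := by
            rw [Finset.disjoint_left]
            intro x hx hx'
            exact hAA' (Subtype.ext ((mem_parts.1 hp).2.2.1 A A.2 A' A'.2 x hx hx'))
          exact disjoint_parts (disjoint_pre _ hdis) (mem_conn.1 (hq A)).1 (mem_conn.1 (hq A')).1
  calc _ ≤ ∑ j : α → Fin p, (∏ x, bandMatrix p b (j x) (j (next x))) *
        ∑ q ∈ Q, ∏ B ∈ Finset.univ.biUnion q, |cum P₀ (fun x => Z (pos j (vtx next x))) B| := by
        refine Finset.sum_le_sum fun j _ => mul_le_mul_of_nonneg_left (h1 j) ?_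
        exact Finset.prod_nonneg fun x _ => bandMatrix_nonneg _ _ _ _
    _ = ∑ q ∈ Q, ∑ j : α → Fin p, (∏ x, bandMatrix p b (j x) (j (next x))) *
        ∏ B ∈ Finset.univ.biUnion q, |cum P₀ (fun x => Z (pos j (vtx next x))) B| := by
        simp only [Finset.mul_sum]
        exact Finset.sum_comm
    _ ≤ ∑ q ∈ Q, M q * p * b ^ (Fintype.card α - σ.card - 1) :=
        Finset.sum_le_sum fun q hq => hM q hq p b hb
    _ = _ := by rw [← Finset.sum_mul, ← Finset.sum_mul]

end Bound

/-! ### Convolution powers and sums over paths -/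

section Convolution

variable {Ω₀ : Type*} [MeasurableSpace Ω₀] {P₀ : Measure Ω₀} {Z : ℤ → Ω₀ → ℝ}

theorem summable_mul_bounded {β : Type*} {f h : β → ℝ} (hf : Summable f) {C : ℝ}
    (hh : ∀ i, |h i| ≤ C) : Summable (fun i => f i * h i) := by
  refine Summable.of_norm_bounded (hf.abs.mul_right C) fun i => ?_
  rw [Real.norm_eq_abs, abs_mul]
  exact mul_le_mul_of_nonneg_left (hh i) (abs_nonneg _)

theorem abs_tsum_mul_le {β : Type*} {f h : β → ℝ} (hf : Summable f) {C : ℝ}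
    (hh : ∀ i, |h i| ≤ C) : |∑' i, f i * h i| ≤ (∑' i, |f i|) * C := by
  have h1 := (summable_mul_bounded hf hh).norm
  rw [← tsum_mul_right]
  refine (norm_tsum_le_tsum_norm h1).trans ?_
  refine Summable.tsum_le_tsum (fun i => ?_) h1 (hf.abs.mul_right C)
  rw [Real.norm_eq_abs, abs_mul]
  exact mul_le_mul_of_nonneg_left (hh i) (abs_nonneg _)

/-- The change of variables `(x, k) ↦ (x + k, k)`. -/
def shear : ℤ × ℤ ≃ ℤ × ℤ where
  toFun q := (q.1 + q.2, q.2)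
  invFun q := (q.1 - q.2, q.2)
  left_inv q := by simp
  right_inv q := by simp

theorem summable_mul_prod {β γ : Type*} {F : β → ℝ} {G : γ → ℝ} (hF : Summable F)
    (hG : Summable G) : Summable (fun q : β × γ => F q.1 * G q.2) :=
  summable_mul_of_summable_norm hF.norm hG.norm

theorem summable_conv_prod {F G : ℤ → ℝ} (hF : Summable F) (hG : Summable G) :
    Summable (fun q : ℤ × ℤ => F (q.1 - q.2) * G q.2) := by
  rw [← shear.summable_iff]
  simpa [shear, Function.comp_def] using summable_mul_prod hF hG

theorem summable_conv {F G : ℤ → ℝ} (hF : Summable F) (hG : Summable G) : Summable (conv F G) :=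
  (summable_conv_prod hF hG).prod

theorem tsum_conv_mul {F G h : ℤ → ℝ} (hF : Summable F) (hG : Summable G) {C : ℝ}
    (hh : ∀ i, |h i| ≤ C) :
    ∑' j, conv F G j * h j = ∑' x, F x * ∑' k, G k * h (x + k) := by
  have h1 : Summable (fun q : ℤ × ℤ => F (q.1 - q.2) * G q.2 * h q.1) :=
    summable_mul_bounded (summable_conv_prod hF hG) fun q => hh q.1
  have h2 : Summable (fun q : ℤ × ℤ => F q.1 * G q.2 * h (q.1 + q.2)) :=
    summable_mul_bounded (summable_mul_prod hF hG) fun q => hh _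
  calc ∑' j, conv F G j * h j = ∑' q : ℤ × ℤ, F (q.1 - q.2) * G q.2 * h q.1 := by
        rw [h1.tsum_prod]
        refine tsum_congr fun j => ?_
        change (∑' c, F (j - c) * G c) * h j = ∑' c, F (j - c) * G c * h j
        rw [tsum_mul_right]
    _ = ∑' q : ℤ × ℤ, F q.1 * G q.2 * h (q.1 + q.2) := by
        rw [← shear.tsum_eq]
        simp [shear]
    _ = _ := by
        rw [h2.tsum_prod]
        refine tsum_congr fun x => ?_
        rw [← tsum_mul_left]
        exact tsum_congr fun k => by ring

variable (hR : Summable (autocov P₀ Z))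

include hR

theorem summable_autocovPow (m : ℕ) : Summable (autocovPow P₀ Z m) := by
  induction m with
  | zero =>
    refine summable_of_ne_finset_zero (s := {0}) fun i hi => ?_
    simp only [autocovPow]
    rw [if_neg (by simpa using hi)]
  | succ m ih => exact summable_conv hR ih

theorem exists_abs_autocovPow_le (m : ℕ) : ∃ C, ∀ i, |autocovPow P₀ Z m i| ≤ C :=
  ⟨∑' i, |autocovPow P₀ Z m i|, fun i =>
    (summable_autocovPow hR m).abs.le_tsum i fun _ _ => abs_nonneg _⟩

omit hR in
theorem tsum_autocovPow_zero (h : ℤ → ℝ) : ∑' i, autocovPow P₀ Z 0 i * h i = h 0 := by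
  rw [tsum_eq_single 0]
  · simp [autocovPow]
  · intro i hi; simp [autocovPow, hi]

theorem tsum_autocovPow_succ (m : ℕ) {h : ℤ → ℝ} {C : ℝ} (hh : ∀ i, |h i| ≤ C) :
    ∑' i, autocovPow P₀ Z (m + 1) i * h i =
      ∑' x, autocov P₀ Z x * ∑' k, autocovPow P₀ Z m k * h (x + k) :=
  tsum_conv_mul hR (summable_autocovPow hR m) hh

/-- Integration against a convolution of powers is iterated integration. -/
theorem tsum_autocovPow_add (m n : ℕ) {h : ℤ → ℝ} {C : ℝ} (hh : ∀ i, |h i| ≤ C) :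
    ∑' i, autocovPow P₀ Z (m + n) i * h i =
      ∑' i, autocovPow P₀ Z m i * ∑' j, autocovPow P₀ Z n j * h (i + j) := by
  induction m generalizing h with
  | zero => rw [tsum_autocovPow_zero, zero_add]; simp
  | succ m ih =>
    rw [Nat.add_right_comm, tsum_autocovPow_succ hR _ hh,
      tsum_autocovPow_succ hR m (h := fun i => ∑' j, autocovPow P₀ Z n j * h (i + j))
        (fun i => abs_tsum_mul_le (summable_autocovPow hR n) fun j => hh _)]
    refine tsum_congr fun x => ?_
    rw [ih fun i => hh (x + i)]
    simp only [add_assoc]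

/-- The convolution powers of `R` are even. -/
theorem tsum_autocovPow_neg (hev : ∀ j, autocov P₀ Z (-j) = autocov P₀ Z j) (m : ℕ) {h : ℤ → ℝ}
    {C : ℝ} (hh : ∀ i, |h i| ≤ C) :
    ∑' i, autocovPow P₀ Z m i * h (-i) = ∑' i, autocovPow P₀ Z m i * h i := by
  induction m generalizing h with
  | zero => rw [tsum_autocovPow_zero (h := fun i => h (-i)), tsum_autocovPow_zero, neg_zero]
  | succ m ih =>
    rw [tsum_autocovPow_succ hR m hh, tsum_autocovPow_succ hR m (h := fun i => h (-i))
      (fun i => hh _), ← (Equiv.neg ℤ).tsum_eq]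
    refine tsum_congr fun x => ?_
    rw [Equiv.neg_apply, hev, ← ih (h := fun k => h (x + k)) fun i => hh _]
    congr 1
    refine tsum_congr fun k => ?_
    congr 2
    ring

omit hR in
theorem autocovPow_eq_tsum (m : ℕ) (i : ℤ) :
    autocovPow P₀ Z m i = ∑' j, autocovPow P₀ Z m j * (if j = i then 1 else 0) := by
  rw [tsum_eq_single i]
  · simp
  · intro j hj; simp [hj]

omit hR in
theorem autocovPow_one (i : ℤ) : autocovPow P₀ Z 1 i = autocov P₀ Z i := by
  simp only [autocovPow, conv]
  rw [tsum_eq_single 0]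
  · simp
  · intro j hj; simp [hj]

omit hR in
theorem autocovPow_two (i : ℤ) :
    autocovPow P₀ Z 2 i = ∑' l, autocov P₀ Z (i - l) * autocov P₀ Z l := by
  rw [show (2 : ℕ) = 1 + 1 from rfl, autocovPow, conv]
  exact tsum_congr fun l => by rw [autocovPow_one]

theorem autocovPow_neg (hev : ∀ j, autocov P₀ Z (-j) = autocov P₀ Z j) (m : ℕ) (i : ℤ) :
    autocovPow P₀ Z m (-i) = autocovPow P₀ Z m i := by
  rw [autocovPow_eq_tsum m i, autocovPow_eq_tsum m (-i),
    ← tsum_autocovPow_neg hR hev m (h := fun j => if j = i then (1 : ℝ) else 0) (C := 1)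
      (fun j => by split_ifs <;> simp)]
  simp only [neg_eq_iff_eq_neg]

/-- Closing two paths by a double step; the paths are traversed in opposite directions in
`tsum_close_sub`, which makes no difference because `R` is even. -/
theorem tsum_close_add (hev : ∀ j, autocov P₀ Z (-j) = autocov P₀ Z j) (m n : ℕ) :
    ∑' i, autocovPow P₀ Z m i * ∑' j, autocovPow P₀ Z n j * autocovPow P₀ Z 2 (i + j) =
      autocovPow P₀ Z (m + n + 2) 0 := by
  have hb : ∀ j : ℤ, |(if j = 0 then (1 : ℝ) else 0)| ≤ 1 := fun j => by split_ifs <;> simp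
  rw [autocovPow_eq_tsum, add_assoc, tsum_autocovPow_add hR m (n + 2) hb]
  refine tsum_congr fun i => ?_
  rw [tsum_autocovPow_add hR n 2 (h := fun j => if i + j = 0 then (1 : ℝ) else 0) fun j => hb _]
  congr 1
  refine tsum_congr fun j => ?_
  rw [← autocovPow_neg hR hev 2 (i + j), autocovPow_eq_tsum 2 (-(i + j))]
  congr 1
  refine tsum_congr fun l => ?_
  congr 1
  exact if_congr (by constructor <;> intro h <;> omega) rfl rfl

theorem tsum_close_sub (hev : ∀ j, autocov P₀ Z (-j) = autocov P₀ Z j) (m n : ℕ) :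
    ∑' i, autocovPow P₀ Z m i * ∑' j, autocovPow P₀ Z n j * autocovPow P₀ Z 2 (i - j) =
      autocovPow P₀ Z (m + n + 2) 0 := by
  rw [← tsum_close_add hR hev]
  refine tsum_congr fun i => ?_
  obtain ⟨C, hC⟩ := exists_abs_autocovPow_le hR 2
  rw [← tsum_autocovPow_neg hR hev n (h := fun j => autocovPow P₀ Z 2 (i + j)) fun j => hC _]
  simp only [sub_eq_add_neg]

theorem summable_prod_path (m : ℕ) :
    Summable (fun a : Fin m → ℤ => ∏ i, autocov P₀ Z (a i)) := by
  induction m with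
  | zero => exact (hasSum_fintype _).summable
  | succ m ih =>
    rw [← (Fin.consEquiv (fun _ : Fin (m + 1) => ℤ)).summable_iff]
    have := summable_mul_prod hR ih
    refine this.congr fun q => ?_
    simp [Fin.consEquiv, Fin.prod_univ_succ]

/-- The sum over the paths of length `m`, as a sum over the end point. -/
theorem tsum_path (m : ℕ) {h : ℤ → ℝ} {C : ℝ} (hh : ∀ i, |h i| ≤ C) :
    ∑' a : Fin m → ℤ, (∏ i, autocov P₀ Z (a i)) * h (∑ i, a i) =
      ∑' i, autocovPow P₀ Z m i * h i := by
  induction m generalizing h with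
  | zero => rw [tsum_autocovPow_zero, tsum_fintype (L := .unconditional _)]; simp
  | succ m ih =>
    rw [tsum_autocovPow_succ hR m hh, ← (Fin.consEquiv (fun _ : Fin (m + 1) => ℤ)).tsum_eq]
    have hs : Summable (fun q : ℤ × (Fin m → ℤ) =>
        (autocov P₀ Z q.1 * ∏ i, autocov P₀ Z (q.2 i)) * h (q.1 + ∑ i, q.2 i)) :=
      summable_mul_bounded
        (f := fun q : ℤ × (Fin m → ℤ) => autocov P₀ Z q.1 * ∏ i, autocov P₀ Z (q.2 i))
        (h := fun q => h (q.1 + ∑ i, q.2 i)) (summable_mul_prod (F := autocov P₀ Z)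
          (G := fun a : Fin m → ℤ => ∏ i, autocov P₀ Z (a i)) hR (summable_prod_path hR m))
        fun q => hh (q.1 + ∑ i, q.2 i)
    have e : ∀ q : ℤ × (Fin m → ℤ), (∏ i, autocov P₀ Z
        ((Fin.consEquiv (fun _ : Fin (m + 1) => ℤ)) q i)) *
          h (∑ i, (Fin.consEquiv (fun _ : Fin (m + 1) => ℤ)) q i) =
        (autocov P₀ Z q.1 * ∏ i, autocov P₀ Z (q.2 i)) * h (q.1 + ∑ i, q.2 i) := fun q => by
      simp [Fin.consEquiv, Fin.prod_univ_succ, Fin.sum_univ_succ]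
    rw [tsum_congr e, hs.tsum_prod]
    refine tsum_congr fun x => ?_
    rw [← ih (h := fun k => h (x + k)) fun i => hh _, ← tsum_mul_left]
    exact tsum_congr fun a => by ring

omit hR in
theorem summable_kernel {β γ : Type*} {w : β → ℝ} (hw : Summable w) {κ : β → γ → ℝ} {C : ℝ}
    (hκ : ∀ q, Summable (κ q)) (hC : ∀ q, ∑' l, |κ q l| ≤ C) :
    Summable (fun q : β × γ => w q.1 * κ q.1 q.2) := by
  rw [← summable_norm_iff, summable_prod_of_nonneg fun _ => norm_nonneg _]
  constructor
  · intro q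
    exact ((hκ q).mul_left (w q)).norm
  · refine Summable.of_nonneg_of_le (fun q => tsum_nonneg fun _ => norm_nonneg _) (fun q => ?_)
      (hw.abs.mul_right C)
    simp only [norm_mul, Real.norm_eq_abs]
    rw [tsum_mul_left]
    exact mul_le_mul_of_nonneg_left (hC q) (abs_nonneg _)

/-- Two paths, joined by a kernel `κ` of their displacements that is summable over the distance of
their starting points. -/
theorem summable_two_paths (m n : ℕ) {κ : ℤ → ℤ → ℤ → ℝ} {C : ℝ}
    (hκ : ∀ i j, Summable (κ i j)) (hC : ∀ i j, ∑' l, |κ i j l| ≤ C) :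
    Summable (fun q : ((Fin m → ℤ) × (Fin n → ℤ)) × ℤ =>
      ((∏ i, autocov P₀ Z (q.1.1 i)) * ∏ i, autocov P₀ Z (q.1.2 i)) *
        κ (∑ i, q.1.1 i) (∑ i, q.1.2 i) q.2) := by
  have h1 : Summable (fun q : (Fin m → ℤ) × (Fin n → ℤ) =>
      (∏ i, autocov P₀ Z (q.1 i)) * ∏ i, autocov P₀ Z (q.2 i)) :=
    summable_mul_prod (F := fun a : Fin m → ℤ => ∏ i, autocov P₀ Z (a i))
      (G := fun a : Fin n → ℤ => ∏ i, autocov P₀ Z (a i))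
      (summable_prod_path hR m) (summable_prod_path hR n)
  exact summable_kernel h1 (fun q => hκ (∑ i, q.1 i) (∑ i, q.2 i))
    fun q => hC (∑ i, q.1 i) (∑ i, q.2 i)

theorem tsum_two_paths (m n : ℕ) {κ : ℤ → ℤ → ℤ → ℝ} {C : ℝ}
    (hκ : ∀ i j, Summable (κ i j)) (hC : ∀ i j, ∑' l, |κ i j l| ≤ C) :
    ∑' q : ((Fin m → ℤ) × (Fin n → ℤ)) × ℤ,
      ((∏ i, autocov P₀ Z (q.1.1 i)) * ∏ i, autocov P₀ Z (q.1.2 i)) *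
        κ (∑ i, q.1.1 i) (∑ i, q.1.2 i) q.2 =
      ∑' i, autocovPow P₀ Z m i * ∑' j, autocovPow P₀ Z n j * ∑' l, κ i j l := by
  have hb : ∀ i j, |∑' l, κ i j l| ≤ C := fun i j => by
    have := norm_tsum_le_tsum_norm (hκ i j).norm
    simp only [Real.norm_eq_abs] at this
    exact this.trans (hC i j)
  have h1 : Summable (fun q : (Fin m → ℤ) × (Fin n → ℤ) =>
      (∏ i, autocov P₀ Z (q.1 i)) * ∏ i, autocov P₀ Z (q.2 i)) :=
    summable_mul_prod (F := fun a : Fin m → ℤ => ∏ i, autocov P₀ Z (a i))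
      (G := fun a : Fin n → ℤ => ∏ i, autocov P₀ Z (a i))
      (summable_prod_path hR m) (summable_prod_path hR n)
  have h2 : Summable (fun q : (Fin m → ℤ) × (Fin n → ℤ) =>
      ((∏ i, autocov P₀ Z (q.1 i)) * ∏ i, autocov P₀ Z (q.2 i)) *
        ∑' l, κ (∑ i, q.1 i) (∑ i, q.2 i) l) :=
    summable_mul_bounded (h := fun q : (Fin m → ℤ) × (Fin n → ℤ) =>
      ∑' l, κ (∑ i, q.1 i) (∑ i, q.2 i) l) h1 fun q => hb (∑ i, q.1 i) (∑ i, q.2 i)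
  rw [(summable_two_paths hR m n hκ hC).tsum_prod]
  simp only [tsum_mul_left]
  rw [h2.tsum_prod, ← tsum_path hR m (h := fun i => ∑' j, autocovPow P₀ Z n j * ∑' l, κ i j l)
    (fun i => abs_tsum_mul_le (summable_autocovPow hR n) fun j => hb i j)]
  refine tsum_congr fun a => ?_
  rw [← tsum_path hR n (h := fun j => ∑' l, κ (∑ i, a i) j l) fun j => hb _ j, ← tsum_mul_left]
  exact tsum_congr fun a' => by ring

end Convolution

/-! ### Cumulants of orders two and four -/

section LowOrder

variable {Ω : Type*} [MeasurableSpace Ω] {P : Measure Ω} [IsProbabilityMeasure P]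

theorem cum_pair {ι : Type*} [DecidableEq ι] [Fintype ι] (X : ι → Ω → ℝ) {x y : ι} (hxy : x ≠ y) :
    cum P X {x, y} = ∫ ω, X x ω * X y ω ∂P - (∫ ω, X x ω ∂P) * ∫ ω, X y ω ∂P := by
  have h := (isCumulant_cum (P := P) X).rec_eq (A := {x, y}) (a := x) (by simp)
  have e : ({x, y} : Finset ι).powerset.filter (fun B => x ∈ B) = {{x}, {x, y}} := by
    ext B
    simp only [Finset.mem_filter, Finset.mem_powerset, Finset.mem_insert, Finset.mem_singleton]
    constructor
    · rintro ⟨h1, h2⟩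
      by_cases hy : y ∈ B
      · exact Or.inr (h1.antisymm (by
          intro z hz
          rcases Finset.mem_insert.1 hz with rfl | hz
          · exact h2
          · rwa [Finset.mem_singleton.1 hz]))
      · refine Or.inl (Finset.Subset.antisymm (fun z hz => ?_) (by simpa using h2))
        rcases Finset.mem_insert.1 (h1 hz) with rfl | hz'
        · simp
        · exact absurd (Finset.mem_singleton.1 hz' ▸ hz) hy
    · rintro (rfl | rfl) <;> simp
  have hne : ({x} : Finset ι) ≠ {x, y} := fun h' => hxy.symm (by
    have : y ∈ ({x} : Finset ι) := h' ▸ by simp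
    simpa using this)
  have hd : ({x, y} : Finset ι) \ {x} = {y} := by
    ext z; simp only [Finset.mem_sdiff, Finset.mem_insert, Finset.mem_singleton]
    constructor
    · rintro ⟨h1 | h1, h2⟩
      · exact absurd h1 h2
      · exact h1
    · rintro rfl; exact ⟨Or.inr rfl, hxy.symm⟩
  rw [e, Finset.sum_pair hne, hd, Finset.sdiff_self, cum_singleton] at h
  simp only [mom, Finset.prod_empty, integral_const, probReal_univ, smul_eq_mul, mul_one,
    Finset.prod_singleton, Finset.prod_pair hxy] at h
  linarith

/-- The fourth moment of centered variables, in terms of the fourth cumulant. -/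
theorem integral_mul_four (X : Fin 4 → Ω → ℝ) (h0 : ∀ i, ∫ ω, X i ω ∂P = 0) :
    ∫ ω, (X 0 ω * X 1 ω) * (X 2 ω * X 3 ω) ∂P = cum P X Finset.univ +
      (∫ ω, X 0 ω * X 1 ω ∂P) * (∫ ω, X 2 ω * X 3 ω ∂P) +
      (∫ ω, X 0 ω * X 2 ω ∂P) * (∫ ω, X 1 ω * X 3 ω ∂P) +
      (∫ ω, X 0 ω * X 3 ω ∂P) * (∫ ω, X 1 ω * X 2 ω ∂P) := by
  have h := (isCumulant_cum (P := P) X).rec_eq (A := Finset.univ) (a := 0) (by simp)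
  have e : (Finset.univ : Finset (Fin 4)).powerset.filter (fun B => 0 ∈ B) =
      {{0}, {0, 1}, {0, 2}, {0, 3}, {0, 1, 2}, {0, 1, 3}, {0, 2, 3}, Finset.univ} := by decide
  rw [e, Finset.sum_insert (by decide), Finset.sum_insert (by decide),
    Finset.sum_insert (by decide), Finset.sum_insert (by decide), Finset.sum_insert (by decide),
    Finset.sum_insert (by decide), Finset.sum_insert (by decide), Finset.sum_singleton,
    cum_singleton, cum_pair X (by decide), cum_pair X (by decide), cum_pair X (by decide),
    show Finset.univ \ ({0, 1} : Finset (Fin 4)) = {2, 3} by decide,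
    show Finset.univ \ ({0, 2} : Finset (Fin 4)) = {1, 3} by decide,
    show Finset.univ \ ({0, 3} : Finset (Fin 4)) = {1, 2} by decide,
    show Finset.univ \ ({0, 1, 2} : Finset (Fin 4)) = {3} by decide,
    show Finset.univ \ ({0, 1, 3} : Finset (Fin 4)) = {2} by decide,
    show Finset.univ \ ({0, 2, 3} : Finset (Fin 4)) = {1} by decide,
    Finset.sdiff_self] at h
  simp only [mom, Finset.prod_empty, integral_const, probReal_univ, smul_eq_mul, mul_one,
    Finset.prod_singleton, h0, zero_mul, mul_zero, sub_zero, zero_add] at h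
  simp only [Finset.prod_pair (show (2 : Fin 4) ≠ 3 by decide),
    Finset.prod_pair (show (1 : Fin 4) ≠ 3 by decide),
    Finset.prod_pair (show (1 : Fin 4) ≠ 2 by decide), Fin.prod_univ_four] at h
  simp only [← mul_assoc] at h ⊢
  rw [h]
  ring

end LowOrder

section Kernel

variable {Ω₀ : Type*} [MeasurableSpace Ω₀] {P₀ : Measure Ω₀} [IsProbabilityMeasure P₀]
  {Z : ℤ → Ω₀ → ℝ}

theorem integral_mul_eq_autocov (hs : IsStationary P₀ Z) (hm : MomentConditions P₀ Z) (u v : ℤ) :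
    ∫ ω, Z u ω * Z v ω ∂P₀ = autocov P₀ Z (v - u) := by
  have h := congrFun (mom_shift (P₀ := P₀) hs ![0, v - u] u) Finset.univ
  simp only [mom, Fin.prod_univ_two, Matrix.cons_val_zero, Matrix.cons_val_one, zero_add,
    sub_add_cancel] at h
  have hL : ∀ j, MemLp (Z j) 2 P₀ := fun j => by exact_mod_cast hs.hasMoments hm j 2
  rw [h, autocov, covariance_eq_sub (hL _) (hL _), hm.mean_zero, zero_mul, sub_zero]
  rfl

theorem autocov_neg (hs : IsStationary P₀ Z) (hm : MomentConditions P₀ Z) (j : ℤ) :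
    autocov P₀ Z (-j) = autocov P₀ Z j := by
  have h1 := integral_mul_eq_autocov hs hm j 0
  have h2 := integral_mul_eq_autocov hs hm 0 j
  rw [zero_sub] at h1
  rw [sub_zero] at h2
  rw [← h1, ← h2]
  simp only [mul_comm]

theorem summable_autocov (hs : IsStationary P₀ Z) (hm : MomentConditions P₀ Z) :
    Summable (autocov P₀ Z) := by
  have h := hm.cumulant_summable 1 le_rfl
  have h2 := h.comp_injective (i := fun j : ℤ => fun _ : Fin 1 => j)
    fun a b hab => congrFun hab 0
  rw [← summable_abs_iff]
  refine h2.congr fun j => ?_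
  simp only [Function.comp]
  rw [jointCumulant_eq_cum (fun i => hs.hasMoments hm _) (by norm_num),
    show (Finset.univ : Finset (Fin (1 + 1))) = {0, 1} from rfl, cum_pair _ (by decide)]
  simp only [Fin.cons_zero, hm.mean_zero, zero_mul, sub_zero]
  rw [integral_mul_eq_autocov hs hm]
  simp [Fin.cons_one]

theorem QTerm_eq_cum (hs : IsStationary P₀ Z) (hm : MomentConditions P₀ Z) (i j l : ℤ) :
    QTerm P₀ Z i j l = cum P₀ (fun s => Z (![i, 0, j + l, l] s)) Finset.univ := by
  have e : ![Z i, Z 0, Z (j + l), Z l] = fun s => Z (![i, 0, j + l, l] s) := by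
    funext s; fin_cases s <;> rfl
  rw [QTerm, e, jointCumulant_eq_cum (fun s => hs.hasMoments hm _) (by norm_num)]

theorem summable_QTerm (hs : IsStationary P₀ Z) (hm : MomentConditions P₀ Z) :
    Summable (fun q : (ℤ × ℤ) × ℤ => QTerm P₀ Z q.1.1 q.1.2 q.2) := by
  have h := hm.cumulant_summable 3 (by norm_num)
  have h2 := h.comp_injective (i := fun q : (ℤ × ℤ) × ℤ => ![q.1.1, q.1.2 + q.2, q.2]) (by
    rintro ⟨⟨a, b⟩, c⟩ ⟨⟨a', b'⟩, c'⟩ h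
    have h0 := congrFun h 0
    have h1 := congrFun h 1
    have h2 := congrFun h 2
    simp at h0 h1 h2
    subst h0; subst h2
    simpa using h1)
  rw [← summable_abs_iff]
  refine h2.congr fun q => ?_
  simp only [Function.comp]
  rw [QTerm_eq_cum hs hm, jointCumulant_eq_cum (fun i => hs.hasMoments hm _) (by norm_num)]
  -- the cumulant is symmetric; the variable `Z 0` has to come first
  have h3 := cum_comap (P := P₀)
    (fun s : Fin (3 + 1) => Z ((Fin.cons 0 ![q.1.1, q.1.2 + q.2, q.2] : Fin (3 + 1) → ℤ) s))
    (Equiv.swap 0 1).toEmbedding (A := Finset.univ) ⟨0, Finset.mem_univ _⟩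
  rw [Finset.univ_map_equiv_to_embedding] at h3
  rw [← h3]
  congr 3
  funext s
  fin_cases s <;> rfl

theorem summable_abs_QTerm (hs : IsStationary P₀ Z) (hm : MomentConditions P₀ Z) (i j : ℤ) :
    Summable (fun l => |QTerm P₀ Z i j l|) :=
  ((summable_QTerm hs hm).prod_factor (i, j)).abs

theorem summable_Q (hs : IsStationary P₀ Z) (hm : MomentConditions P₀ Z) :
    Summable (fun q : ℤ × ℤ => Q P₀ Z q.1 q.2) :=
  (summable_QTerm hs hm).prod

theorem tsum_abs_QTerm_le (hs : IsStationary P₀ Z) (hm : MomentConditions P₀ Z) (i j : ℤ) :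
    ∑' l, |QTerm P₀ Z i j l| ≤ ∑' q : (ℤ × ℤ) × ℤ, |QTerm P₀ Z q.1.1 q.1.2 q.2| := by
  have h := (summable_QTerm hs hm).abs
  rw [h.tsum_prod]
  exact h.prod.le_tsum (i, j) fun _ _ => tsum_nonneg fun _ => abs_nonneg _

theorem exists_abs_autocov_le (hs : IsStationary P₀ Z) (hm : MomentConditions P₀ Z) :
    ∃ C, ∀ i, |autocov P₀ Z i| ≤ C :=
  ⟨∑' i, |autocov P₀ Z i|, fun i =>
    (summable_autocov hs hm).abs.le_tsum i fun _ _ => abs_nonneg _⟩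

theorem summable_conv_term (hs : IsStationary P₀ Z) (hm : MomentConditions P₀ Z) (m : ℕ) (i : ℤ) :
    Summable (fun l : ℤ => |autocov P₀ Z (i - l) * autocovPow P₀ Z m l|) := by
  obtain ⟨C, hC⟩ := exists_abs_autocov_le hs hm
  refine (summable_mul_bounded (h := fun l => autocov P₀ Z (i - l))
    (summable_autocovPow (summable_autocov hs hm) m) fun l => hC (i - l)).abs.congr fun l => ?_
  rw [mul_comm]

theorem summable_pow_Q_pow (hs : IsStationary P₀ Z) (hm : MomentConditions P₀ Z) (m n : ℕ) :
    Summable (fun ij : ℤ × ℤ =>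
      autocovPow P₀ Z m ij.1 * Q P₀ Z ij.1 ij.2 * autocovPow P₀ Z n ij.2) := by
  have hR := summable_autocov hs hm
  obtain ⟨C, hC⟩ := exists_abs_autocovPow_le hR m
  obtain ⟨C', hC'⟩ := exists_abs_autocovPow_le hR n
  have h1 := summable_mul_bounded (h := fun ij : ℤ × ℤ => autocovPow P₀ Z m ij.1)
    (summable_Q hs hm) fun q => hC q.1
  refine (summable_mul_bounded (h := fun ij : ℤ × ℤ => autocovPow P₀ Z n ij.2) h1
    fun q => hC' q.2).congr fun q => ?_
  ring

/-- The covariance of `Z_i Z_0` and `Z_{j+l} Z_l`. -/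
def pairKernel (P₀ : Measure Ω₀) (Z : ℤ → Ω₀ → ℝ) (i j l : ℤ) : ℝ :=
  QTerm P₀ Z i j l + autocov P₀ Z (i - j - l) * autocov P₀ Z l +
    autocov P₀ Z (i - l) * autocov P₀ Z (l + j)

theorem pairCum_pair (hs : IsStationary P₀ Z) (hm : MomentConditions P₀ Z) {α : Type*}
    [DecidableEq α] [Fintype α] (u v : α → ℤ) {x y : α} (hxy : x ≠ y) :
    pairCum P₀ Z u v {x, y} = pairKernel P₀ Z (u x - v x) (u y - v y) (v y - v x) := by
  rw [pairCum, cum_pair _ hxy]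
  have h := integral_mul_four (P := P₀) (fun s => Z (![u x, v x, u y, v y] s))
    fun _ => integral_eq_zero hs hm _
  have hq := congrFun (cum_shift (P₀ := P₀) hs
    ![u x - v x, 0, (u y - v y) + (v y - v x), v y - v x] (v x)) Finset.univ
  rw [← QTerm_eq_cum hs hm] at hq
  have e : (fun s : Fin 4 => Z (![u x - v x, 0, (u y - v y) + (v y - v x), v y - v x] s + v x)) =
      fun s => Z (![u x, v x, u y, v y] s) := by
    funext s; fin_cases s <;> simp
  rw [e] at hq
  rw [hq] at h
  have e2 : ∀ a b : ℤ, autocov P₀ Z (a - b) = autocov P₀ Z (b - a) := fun a b => by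
    rw [← autocov_neg hs hm, neg_sub]
  simp only [Matrix.cons_val, integral_mul_eq_autocov hs hm] at h ⊢
  rw [h, pairKernel, show u x - v x - (u y - v y) - (v y - v x) = u x - u y by ring,
    show u x - v x - (v y - v x) = u x - v y by ring,
    show v y - v x + (u y - v y) = u y - v x by ring, e2 (u x) (u y), e2 (u x) (v y)]
  ring

theorem summable_pairKernel (hs : IsStationary P₀ Z) (hm : MomentConditions P₀ Z) :
    (∀ i j, Summable (pairKernel P₀ Z i j)) ∧ ∃ C, ∀ i j, ∑' l, |pairKernel P₀ Z i j l| ≤ C := by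
  have hR := summable_autocov hs hm
  obtain ⟨C, hC⟩ := exists_abs_autocov_le hs hm
  have hR2 : ∀ j : ℤ, Summable (fun l => autocov P₀ Z (l + j)) := fun j =>
    ((Equiv.addRight j).summable_iff (f := autocov P₀ Z)).2 hR
  have s1 : ∀ i j, Summable (fun l => autocov P₀ Z (i - j - l) * autocov P₀ Z l) := fun i j =>
    (summable_mul_bounded (h := fun l => autocov P₀ Z (i - j - l)) hR
      fun l => hC (i - j - l)).congr fun l => mul_comm _ _
  have s2 : ∀ i j, Summable (fun l => autocov P₀ Z (i - l) * autocov P₀ Z (l + j)) := fun i j =>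
    (summable_mul_bounded (h := fun l => autocov P₀ Z (i - l)) (hR2 j)
      fun l => hC (i - l)).congr fun l => mul_comm _ _
  have s0 : ∀ i j, Summable (QTerm P₀ Z i j) := fun i j => (summable_abs_QTerm hs hm i j).of_abs
  refine ⟨fun i j => ((s0 i j).add (s1 i j)).add (s2 i j),
    ∑' q : (ℤ × ℤ) × ℤ, |QTerm P₀ Z q.1.1 q.1.2 q.2| + C * ∑' l, |autocov P₀ Z l| +
      C * ∑' l, |autocov P₀ Z l|, fun i j => ?_⟩
  have b1 : ∑' l, |autocov P₀ Z (i - j - l) * autocov P₀ Z l| ≤ C * ∑' l, |autocov P₀ Z l| := by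
    rw [← tsum_mul_left]
    refine Summable.tsum_le_tsum (fun l => ?_) (s1 i j).abs (hR.abs.mul_left C)
    rw [abs_mul]
    exact mul_le_mul_of_nonneg_right (hC _) (abs_nonneg _)
  have b2 : ∑' l, |autocov P₀ Z (i - l) * autocov P₀ Z (l + j)| ≤
      C * ∑' l, |autocov P₀ Z l| := by
    rw [← (Equiv.addRight j).tsum_eq (fun l => |autocov P₀ Z l|), ← tsum_mul_left]
    refine Summable.tsum_le_tsum (fun l => ?_) (s2 i j).abs ((hR2 j).abs.mul_left C)
    rw [abs_mul]
    exact mul_le_mul_of_nonneg_right (hC _) (abs_nonneg _)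
  calc ∑' l, |pairKernel P₀ Z i j l|
      ≤ ∑' l, (|QTerm P₀ Z i j l| + |autocov P₀ Z (i - j - l) * autocov P₀ Z l| +
          |autocov P₀ Z (i - l) * autocov P₀ Z (l + j)|) :=
        Summable.tsum_le_tsum (fun l => abs_add_three _ _ _)
          (((s0 i j).add (s1 i j)).add (s2 i j)).abs
          (((s0 i j).abs.add (s1 i j).abs).add (s2 i j).abs)
    _ = _ := by
        rw [((s0 i j).abs.add (s1 i j).abs).tsum_add (s2 i j).abs,
          (s0 i j).abs.tsum_add (s1 i j).abs]
    _ ≤ _ := add_le_add (add_le_add (tsum_abs_QTerm_le hs hm i j) b1) b2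

theorem tsum_pairKernel (hs : IsStationary P₀ Z) (hm : MomentConditions P₀ Z) (i j : ℤ) :
    ∑' l, pairKernel P₀ Z i j l =
      Q P₀ Z i j + autocovPow P₀ Z 2 (i - j) + autocovPow P₀ Z 2 (i + j) := by
  have hR := summable_autocov hs hm
  obtain ⟨C, hC⟩ := exists_abs_autocov_le hs hm
  have hR2 : Summable (fun l => autocov P₀ Z (l + j)) :=
    ((Equiv.addRight j).summable_iff (f := autocov P₀ Z)).2 hR
  have s1 : Summable (fun l => autocov P₀ Z (i - j - l) * autocov P₀ Z l) :=
    (summable_mul_bounded (h := fun l => autocov P₀ Z (i - j - l)) hR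
      fun l => hC (i - j - l)).congr fun l => mul_comm _ _
  have s2 : Summable (fun l => autocov P₀ Z (i - l) * autocov P₀ Z (l + j)) :=
    (summable_mul_bounded (h := fun l => autocov P₀ Z (i - l)) hR2
      fun l => hC (i - l)).congr fun l => mul_comm _ _
  have s0 : Summable (QTerm P₀ Z i j) := (summable_abs_QTerm hs hm i j).of_abs
  simp only [pairKernel]
  rw [(s0.add s1).tsum_add s2, s0.tsum_add s1, autocovPow_two, autocovPow_two, Q]
  congr 1
  rw [← (Equiv.addRight j).tsum_eq (fun l => autocov P₀ Z (i + j - l) * autocov P₀ Z l)]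
  refine tsum_congr fun l => ?_
  rw [Equiv.coe_addRight, show i + j - (l + j) = i - l by ring]

/-- The limiting covariance of the traces: the kernel summed over closed pairs of paths. -/
theorem tsum_paths_pairKernel (hs : IsStationary P₀ Z) (hm : MomentConditions P₀ Z) (m n : ℕ) :
    ∑' i, autocovPow P₀ Z m i * ∑' j, autocovPow P₀ Z n j * ∑' l, pairKernel P₀ Z i j l =
      2 * autocovPow P₀ Z (m + n + 2) 0 + ∑' ij : ℤ × ℤ,
        autocovPow P₀ Z m ij.1 * Q P₀ Z ij.1 ij.2 * autocovPow P₀ Z n ij.2 := by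
  have hR := summable_autocov hs hm
  have hev := autocov_neg hs hm
  obtain ⟨C, hC⟩ := exists_abs_autocovPow_le hR 2
  obtain ⟨D, hD⟩ := summable_pairKernel hs hm |>.2
  have hQ : ∀ i j, |Q P₀ Z i j| ≤ ∑' q : ℤ × ℤ, |Q P₀ Z q.1 q.2| := fun i j =>
    (summable_Q hs hm).abs.le_tsum (i, j) fun _ _ => abs_nonneg _
  have hm' := summable_autocovPow hR m
  have hn := summable_autocovPow hR n
  have a0 : ∀ i, Summable (fun j => autocovPow P₀ Z n j * Q P₀ Z i j) := fun i =>
    summable_mul_bounded hn fun j => hQ i j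
  have a1 : ∀ i, Summable (fun j => autocovPow P₀ Z n j * autocovPow P₀ Z 2 (i - j)) := fun i =>
    summable_mul_bounded (h := fun j => autocovPow P₀ Z 2 (i - j)) hn fun j => hC (i - j)
  have a2 : ∀ i, Summable (fun j => autocovPow P₀ Z n j * autocovPow P₀ Z 2 (i + j)) := fun i =>
    summable_mul_bounded (h := fun j => autocovPow P₀ Z 2 (i + j)) hn fun j => hC (i + j)
  have b0 : Summable (fun i => autocovPow P₀ Z m i * ∑' j, autocovPow P₀ Z n j * Q P₀ Z i j) :=
    summable_mul_bounded hm' fun i => abs_tsum_mul_le hn fun j => hQ i j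
  have b1 : Summable (fun i => autocovPow P₀ Z m i *
      ∑' j, autocovPow P₀ Z n j * autocovPow P₀ Z 2 (i - j)) :=
    summable_mul_bounded hm' fun i =>
      abs_tsum_mul_le (h := fun j => autocovPow P₀ Z 2 (i - j)) hn fun j => hC (i - j)
  have b2 : Summable (fun i => autocovPow P₀ Z m i *
      ∑' j, autocovPow P₀ Z n j * autocovPow P₀ Z 2 (i + j)) :=
    summable_mul_bounded hm' fun i =>
      abs_tsum_mul_le (h := fun j => autocovPow P₀ Z 2 (i + j)) hn fun j => hC (i + j)
  have key : ∀ i, autocovPow P₀ Z m i * ∑' j, autocovPow P₀ Z n j * ∑' l, pairKernel P₀ Z i j l =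
      autocovPow P₀ Z m i * (∑' j, autocovPow P₀ Z n j * Q P₀ Z i j) +
      autocovPow P₀ Z m i * (∑' j, autocovPow P₀ Z n j * autocovPow P₀ Z 2 (i - j)) +
      autocovPow P₀ Z m i * ∑' j, autocovPow P₀ Z n j * autocovPow P₀ Z 2 (i + j) := fun i => by
    rw [← mul_add, ← mul_add, ← (a0 i).tsum_add (a1 i), ← ((a0 i).add (a1 i)).tsum_add (a2 i)]
    congr 1
    refine tsum_congr fun j => ?_
    rw [tsum_pairKernel hs hm, mul_add, mul_add]
  rw [tsum_congr key, (b0.add b1).tsum_add b2, b0.tsum_add b1, tsum_close_add hR hev,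
    tsum_close_sub hR hev, (summable_pow_Q_pow hs hm m n).tsum_prod]
  have : ∀ i, autocovPow P₀ Z m i * ∑' j, autocovPow P₀ Z n j * Q P₀ Z i j =
      ∑' j, autocovPow P₀ Z m i * Q P₀ Z i j * autocovPow P₀ Z n j := fun i => by
    rw [← tsum_mul_left]
    exact tsum_congr fun j => by ring
  rw [tsum_congr this]
  ring

end Kernel

/-! ### Averages over configurations in a long interval -/

section Lattice

variable {A T : Type*}

/-- `A`-indexed configurations of integers modulo translations are parametrized by `T`: `shape`
is the parameter of a configuration, and `height` the configuration with a given parameter and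
the letter `base` at the origin. -/
structure IsShape (base : A) (shape : (A → ℤ) → T) (height : T → A → ℤ) : Prop where
  height_shape : ∀ g a, height (shape g) a = g a - g base
  shape_height : ∀ y x, shape (fun a => x + height y a) = y

variable [Fintype A] [DecidableEq A] {base : A} {shape : (A → ℤ) → T} {height : T → A → ℤ}

open Classical in
/-- The number of configurations of shape `y` in `{1, …, p}`. -/
def shapeCount (shape : (A → ℤ) → T) (p : ℕ) (y : T) : ℕ :=
  (Finset.univ.filter fun j : A → Fin p => shape (pos j) = y).card

theorem IsShape.height_base (h : IsShape base shape height) (y : T) : height y base = 0 := by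
  have := h.height_shape (fun a => 0 + height y a) base
  rwa [h.shape_height, sub_self] at this

/-- A configuration is determined by its shape and its base point. -/
theorem shapeCount_le (h : IsShape base shape height) (p : ℕ) (y : T) :
    shapeCount shape p y ≤ p := by
  classical
  have := Finset.card_le_card_of_injOn (s := Finset.univ.filter fun j : A → Fin p =>
    shape (pos j) = y) (t := (Finset.univ : Finset (Fin p))) (fun j => j base) (fun _ _ => by simp)
    (by
      intro j hj j' hj' hjj
      have e1 : shape (pos j) = y := by simpa using hj
      have e2 : shape (pos j') = y := by simpa using hj'
      apply pos_injective
      funext a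
      have h1 := h.height_shape (pos j) a
      have h2 := h.height_shape (pos j') a
      have h3 : pos j base = pos j' base := by
        simp only [pos]
        rw [show j base = j' base from hjj]
      rw [e1] at h1
      rw [e2] at h2
      linarith)
  simpa [shapeCount] using this

/-- A shape fits into `{1, …, p}` at all base points that are not close to the boundary. -/
theorem le_shapeCount (h : IsShape base shape height) (p : ℕ) (y : T) :
    p - 2 * ∑ a, (height y a).natAbs ≤ shapeCount shape p y := by
  classical
  set M := ∑ a, (height y a).natAbs with hM
  have hle : ∀ a, (height y a).natAbs ≤ M := fun a =>
    Finset.single_le_sum (f := fun a => (height y a).natAbs) (fun _ _ => Nat.zero_le _)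
      (Finset.mem_univ a)
  have hx : ∀ x ∈ Finset.Ico M (p - M), ∀ a, 0 ≤ (x : ℤ) + height y a ∧
      ((x : ℤ) + height y a).toNat < p := by
    intro x hx a
    have := hle a
    rw [Finset.mem_Ico] at hx
    omega
  have hs := Finset.card_le_card_of_surjOn (s := Finset.univ.filter fun j : A → Fin p =>
    shape (pos j) = y) (t := Finset.Ico M (p - M)) (fun j => (j base : ℕ)) (by
      intro x hx'
      refine ⟨fun a => ⟨((x : ℤ) + height y a).toNat, (hx x hx' a).2⟩, ?_, ?_⟩
      · have : pos (fun a => (⟨((x : ℤ) + height y a).toNat, (hx x hx' a).2⟩ : Fin p)) =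
            fun a => ((x : ℤ) + 1) + height y a := by
          funext a
          have := (hx x hx' a).1
          simp only [pos]
          omega
        simp [this, h.shape_height]
      · simp [h.height_base])
  rw [Nat.card_Ico] at hs
  rw [shapeCount]
  omega

theorem tendsto_shapeCount (h : IsShape base shape height) (y : T) :
    Tendsto (fun p : ℕ => (p : ℝ)⁻¹ * shapeCount shape p y) atTop (𝓝 1) := by
  set M := ∑ a, (height y a).natAbs with hM
  have h1 : Tendsto (fun p : ℕ => 1 - (2 * M : ℝ) * (p : ℝ)⁻¹) atTop (𝓝 1) := by
    have := (tendsto_inv_atTop_nhds_zero_nat (𝕜 := ℝ)).const_mul (2 * M : ℝ)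
    simpa using this.const_sub 1
  refine tendsto_of_tendsto_of_tendsto_of_le_of_le' h1 tendsto_const_nhds ?_ ?_
  · filter_upwards [eventually_gt_atTop 0] with p hp
    have hp' : (0 : ℝ) < p := by exact_mod_cast hp
    have h2 : (p : ℝ) - 2 * M ≤ shapeCount shape p y := by
      have := le_shapeCount h p y
      have h3 : p ≤ shapeCount shape p y + 2 * M := by omega
      have h4 : (p : ℝ) ≤ shapeCount shape p y + 2 * M := by exact_mod_cast h3
      linarith
    calc 1 - (2 * M : ℝ) * (p : ℝ)⁻¹ = (p : ℝ)⁻¹ * (p - 2 * M) := by field_simp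
      _ ≤ _ := mul_le_mul_of_nonneg_left h2 (by positivity)
  · filter_upwards [eventually_gt_atTop 0] with p hp
    have hp' : (0 : ℝ) < p := by exact_mod_cast hp
    rw [inv_mul_le_iff₀ hp', mul_one]
    exact_mod_cast shapeCount_le h p y

theorem sum_shape (p : ℕ) (f : T → ℝ) :
    ∑ j : A → Fin p, f (shape (pos j)) = ∑' y, (shapeCount shape p y : ℝ) * f y := by
  classical
  rw [Finset.sum_comp f (fun j : A → Fin p => shape (pos j)),
    tsum_eq_sum (s := Finset.univ.image fun j : A → Fin p => shape (pos j))]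
  · refine Finset.sum_congr rfl fun y _ => ?_
    rw [nsmul_eq_mul, shapeCount]
  · intro y hy
    have : shapeCount shape p y = 0 := by
      rw [shapeCount, Finset.card_eq_zero, Finset.filter_eq_empty_iff]
      intro j _ hj
      exact hy (Finset.mem_image.2 ⟨j, Finset.mem_univ _, hj⟩)
    rw [this, Nat.cast_zero, zero_mul]

/-- The band constraint as a function of the shape. -/
def bandShape (next : A → A) (height : T → A → ℤ) (b : ℝ) (y : T) : ℝ :=
  open Classical in
  ∏ a, if |((height y a - height y (next a) : ℤ) : ℝ)| ≤ b then 1 else 0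

theorem prod_bandMatrix (h : IsShape base shape height) (next : A → A) {p : ℕ} (b : ℝ)
    (j : A → Fin p) : ∏ a, bandMatrix p b (j a) (j (next a)) =
      bandShape next height b (shape (pos j)) := by
  classical
  refine Finset.prod_congr rfl fun a _ => ?_
  rw [h.height_shape, h.height_shape]
  simp only [bandMatrix, Matrix.of_apply, pos]
  push_cast
  congr 3
  ring

theorem abs_bandShape_le (next : A → A) (height : T → A → ℤ) (b : ℝ) (y : T) :
    |bandShape next height b y| ≤ 1 := by
  classical
  rw [bandShape, Finset.abs_prod]
  refine Finset.prod_le_one (fun _ _ => abs_nonneg _) fun a _ => ?_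
  split_ifs <;> simp

/-- The average over the configurations in `{1, …, p}` of a summable function of their shape,
cut off at a growing band width, tends to the sum over all the shapes. -/
theorem tendsto_average (h : IsShape base shape height) (next : A → A) {b : ℕ → ℝ}
    (hb : Tendsto b atTop atTop) {F : T → ℝ} (hF : Summable F) :
    Tendsto (fun p : ℕ => (p : ℝ)⁻¹ * ∑ j : A → Fin p,
      (∏ a, bandMatrix p (b p) (j a) (j (next a))) * F (shape (pos j))) atTop (𝓝 (∑' y, F y)) := by
  classical
  have e : ∀ p : ℕ, (p : ℝ)⁻¹ * ∑ j : A → Fin p,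
      (∏ a, bandMatrix p (b p) (j a) (j (next a))) * F (shape (pos j)) =
      ∑' y, (p : ℝ)⁻¹ * shapeCount shape p y * bandShape next height (b p) y * F y := fun p => by
    simp only [prod_bandMatrix h]
    rw [sum_shape p fun y => bandShape next height (b p) y * F y, ← tsum_mul_left]
    exact tsum_congr fun y => by ring
  simp only [e]
  refine tendsto_tsum_of_dominated_convergence (bound := fun y => |F y|) hF.abs (fun y => ?_) ?_
  · have h1 : Tendsto (fun p => bandShape next height (b p) y) atTop (𝓝 1) := by
      refine tendsto_const_nhds.congr' ?_
      have : ∀ a, ∀ᶠ p in atTop, |((height y a - height y (next a) : ℤ) : ℝ)| ≤ b p := fun a =>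
        hb.eventually_ge_atTop _
      filter_upwards [eventually_all.2 this] with p hp
      rw [bandShape, Finset.prod_congr rfl fun a _ => if_pos (hp a), Finset.prod_const_one]
    simpa using ((tendsto_shapeCount h y).mul h1).mul_const (F y)
  · refine Eventually.of_forall fun p y => ?_
    rw [Real.norm_eq_abs, abs_mul, abs_mul, abs_mul]
    have h1 : |(p : ℝ)⁻¹| * |(shapeCount shape p y : ℝ)| ≤ 1 := by
      rw [abs_of_nonneg (by positivity), abs_of_nonneg (by positivity)]
      have : (shapeCount shape p y : ℝ) ≤ p := by exact_mod_cast shapeCount_le h p y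
      exact (mul_le_mul_of_nonneg_left this (by positivity)).trans inv_mul_le_one
    have h2 := abs_bandShape_le next height (b p) y
    calc _ ≤ 1 * 1 * |F y| := by gcongr
      _ = |F y| := by ring

end Lattice

/-! ### Pairs of cyclic words -/

section TwoWords

variable {m n : ℕ}

/-- The cyclic successor in a pair of cyclic words. -/
def nextSum (x : Fin (m + 1) ⊕ Fin (n + 1)) : Fin (m + 1) ⊕ Fin (n + 1) :=
  Sum.map (finRotate (m + 1)) (finRotate (n + 1)) x

/-- The increments along the two words, and the distance of their starting points. -/
def pathShape (g : Fin (m + 1) ⊕ Fin (n + 1) → ℤ) : ((Fin m → ℤ) × (Fin n → ℤ)) × ℤ :=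
  ((fun i => g (Sum.inl i.succ) - g (Sum.inl i.castSucc),
    fun i => g (Sum.inr i.succ) - g (Sum.inr i.castSucc)), g (Sum.inr 0) - g (Sum.inl 0))

/-- The configuration with given increments that starts at the origin. -/
def pathHeight (y : ((Fin m → ℤ) × (Fin n → ℤ)) × ℤ) : Fin (m + 1) ⊕ Fin (n + 1) → ℤ :=
  Sum.elim (Fin.partialSum y.1.1) (fun i => y.2 + Fin.partialSum y.1.2 i)

theorem partialSum_sub {m : ℕ} (g : Fin (m + 1) → ℤ) (i : Fin (m + 1)) :
    Fin.partialSum (fun l : Fin m => g l.succ - g l.castSucc) i = g i - g 0 := by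
  induction i using Fin.induction with
  | zero => simp
  | succ i ih => rw [Fin.partialSum_succ, ih]; ring

theorem isShape_path : IsShape (Sum.inl 0) (pathShape (m := m) (n := n)) pathHeight where
  height_shape g a := by
    rcases a with i | i
    · exact partialSum_sub (fun l => g (Sum.inl l)) i
    · simp only [pathHeight, pathShape, Sum.elim_inr]
      rw [partialSum_sub (fun l => g (Sum.inr l)) i]
      ring
  shape_height y x := by
    obtain ⟨⟨y1, y2⟩, d⟩ := y
    simp only [pathShape, pathHeight, Sum.elim_inl, Sum.elim_inr, Fin.partialSum_succ,
      Fin.partialSum_zero]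
    refine Prod.ext (Prod.ext (funext fun i => ?_) (funext fun i => ?_)) ?_ <;> dsimp only <;> ring

theorem sum_path_increments {m : ℕ} (g : Fin (m + 1) → ℤ) :
    ∑ i : Fin m, (g i.succ - g i.castSucc) = g (Fin.last m) - g 0 := by
  have h1 := Fin.sum_univ_succ g
  have h2 := Fin.sum_univ_castSucc g
  rw [Finset.sum_sub_distrib]
  linarith

variable {Ω₀ : Type*} [MeasurableSpace Ω₀] {P₀ : Measure Ω₀} [IsProbabilityMeasure P₀]
  {Z : ℤ → Ω₀ → ℝ}

/-- Two cyclic words whose last steps interact, while every other step has the weight `R`. -/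
def wordWeight (P₀ : Measure Ω₀) (Z : ℤ → Ω₀ → ℝ) (g : Fin (m + 1) ⊕ Fin (n + 1) → ℤ) : ℝ :=
  pairKernel P₀ Z (g (Sum.inl (Fin.last m)) - g (Sum.inl 0))
    (g (Sum.inr (Fin.last n)) - g (Sum.inr 0)) (g (Sum.inr 0) - g (Sum.inl 0)) *
  ∏ x, if x = Sum.inl (Fin.last m) ∨ x = Sum.inr (Fin.last n) then 1
    else autocov P₀ Z (g (nextSum x) - g x)

theorem wordWeight_eq (g : Fin (m + 1) ⊕ Fin (n + 1) → ℤ) :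
    wordWeight P₀ Z g = ((∏ i, autocov P₀ Z ((pathShape g).1.1 i)) *
      ∏ i, autocov P₀ Z ((pathShape g).1.2 i)) *
        pairKernel P₀ Z (∑ i, (pathShape g).1.1 i) (∑ i, (pathShape g).1.2 i) (pathShape g).2 := by
  have hr : ∀ {m : ℕ} (i : Fin m), finRotate (m + 1) i.castSucc = i.succ := fun i =>
    finRotate_of_lt i.2
  rw [wordWeight, Fintype.prod_sum_type, Fin.prod_univ_castSucc, Fin.prod_univ_castSucc]
  simp only [pathShape, nextSum, Sum.map_inl, Sum.map_inr, hr, Sum.inl.injEq, Sum.inr.injEq,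
    reduceCtorEq, or_false, false_or, Fin.castSucc_ne_last, if_false, if_true, mul_one]
  rw [sum_path_increments (fun i => g (Sum.inl i)), sum_path_increments (fun i => g (Sum.inr i))]
  ring

theorem tendsto_wordWeight (hs : IsStationary P₀ Z) (hm : MomentConditions P₀ Z) (m n : ℕ)
    {b : ℕ → ℝ} (hb : Tendsto b atTop atTop) :
    Tendsto (fun p : ℕ => (p : ℝ)⁻¹ * ∑ j : Fin (m + 1) ⊕ Fin (n + 1) → Fin p,
      (∏ x, bandMatrix p (b p) (j x) (j (nextSum x))) * wordWeight P₀ Z (pos j)) atTop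
      (𝓝 (2 * autocovPow P₀ Z (m + n + 2) 0 + ∑' ij : ℤ × ℤ,
        autocovPow P₀ Z m ij.1 * Q P₀ Z ij.1 ij.2 * autocovPow P₀ Z n ij.2)) := by
  have hR := summable_autocov hs hm
  obtain ⟨hκ, C, hC⟩ := summable_pairKernel hs hm
  rw [← tsum_paths_pairKernel hs hm, ← tsum_two_paths hR m n hκ hC]
  simp only [wordWeight_eq]
  exact tendsto_average isShape_path nextSum hb (summable_two_paths hR m n hκ hC)

end TwoWords

/-! ### The partitions with one block of two letters -/

section PairPartition

variable {α : Type*} [DecidableEq α] [Fintype α]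

/-- The partition with the block `{x, y}`, all of whose other blocks are singletons. -/
def pairPart (x y : α) : Finset (Finset α) :=
  insert {x, y} ((Finset.univ \ {x, y}).image fun z => {z})

theorem pair_notMem_image {x y : α} (hxy : x ≠ y) :
    ({x, y} : Finset α) ∉ (Finset.univ \ {x, y}).image fun z : α => ({z} : Finset α) := by
  intro h
  obtain ⟨z, -, hz⟩ := Finset.mem_image.1 h
  have := Finset.card_pair hxy
  rw [← hz, Finset.card_singleton] at this
  omega

theorem prod_pairPart {x y : α} (hxy : x ≠ y) (f : Finset α → ℝ) :
    ∏ B ∈ pairPart x y, f B = f {x, y} * ∏ z, if z = x ∨ z = y then 1 else f {z} := by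
  rw [pairPart, Finset.prod_insert (pair_notMem_image hxy),
    Finset.prod_image fun a _ b _ h => Finset.singleton_injective h]
  congr 1
  rw [← Finset.prod_subset (Finset.sdiff_subset (s := Finset.univ) (t := {x, y}))]
  · refine Finset.prod_congr rfl fun z hz => ?_
    rw [if_neg (by simpa using hz)]
  · intro z _ hz
    rw [if_pos (by
      simpa only [Finset.mem_sdiff, Finset.mem_univ, true_and, not_not, Finset.mem_insert,
        Finset.mem_singleton] using hz)]

theorem card_pairPart {x y : α} (hxy : x ≠ y) :
    (pairPart x y).card + 1 = Fintype.card α := by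
  rw [pairPart, Finset.card_insert_of_notMem (pair_notMem_image hxy),
    Finset.card_image_of_injective _ Finset.singleton_injective, Finset.card_sdiff_of_subset
    (Finset.subset_univ _), Finset.card_pair hxy, Finset.card_univ]
  have : 2 ≤ Fintype.card α := by
    rw [← Finset.card_pair hxy]; exact Finset.card_le_univ _
  omega

theorem pairPart_mem_parts (x y : α) : pairPart x y ∈ parts Finset.univ := by
  rw [mem_parts]
  refine ⟨fun _ _ => Finset.subset_univ _, ?_, ?_, ?_⟩
  · simp only [pairPart, Finset.mem_insert, Finset.mem_image, not_or, not_exists, not_and]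
    exact ⟨(Finset.insert_ne_empty _ _).symm, fun z _ => Finset.singleton_ne_empty z⟩
  · intro B hB C hC z hzB hzC
    simp only [pairPart, Finset.mem_insert, Finset.mem_image, Finset.mem_sdiff,
      Finset.mem_univ, true_and, Finset.mem_singleton] at hB hC
    rcases hB with rfl | ⟨w, hw, rfl⟩ <;> rcases hC with rfl | ⟨w', hw', rfl⟩
    · rfl
    · simp only [Finset.mem_singleton] at hzC
      subst hzC
      simp at hzB
      exact absurd hzB hw'
    · simp only [Finset.mem_singleton] at hzB
      subst hzB
      simp at hzC
      exact absurd hzC hw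
    · simp only [Finset.mem_singleton] at hzB hzC
      rw [← hzB, ← hzC]
  · intro z _
    by_cases h : z = x ∨ z = y
    · exact ⟨{x, y}, by simp [pairPart], by simpa using h⟩
    · exact ⟨{z}, Finset.mem_insert_of_mem (Finset.mem_image.2 ⟨z, by simpa using h, rfl⟩), by simp⟩

theorem exists_eq_pairPart {σ : Finset (Finset α)} (hσ : σ ∈ parts Finset.univ)
    (hc : σ.card + 1 = Fintype.card α) : ∃ x y, x ≠ y ∧ σ = pairPart x y := by
  obtain ⟨-, h0, hd, hcov⟩ := mem_parts.1 hσ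
  have h1 : ∀ B ∈ σ, 1 ≤ B.card := fun B hB =>
    Finset.card_pos.2 (Finset.nonempty_iff_ne_empty.2 fun h : B = ∅ => h0 (h ▸ hB))
  have hsum : ∑ B ∈ σ, (B.card - 1) = 1 := by
    have e : ∑ B ∈ σ, (B.card - 1) + ∑ B ∈ σ, 1 = ∑ B ∈ σ, B.card := by
      rw [← Finset.sum_add_distrib]
      exact Finset.sum_congr rfl fun B hB => Nat.sub_add_cancel (h1 B hB)
    rw [sum_card_parts hσ, Finset.sum_const, smul_eq_mul, mul_one] at e
    omega
  obtain ⟨B, hB, hB0⟩ : ∃ B ∈ σ, B.card - 1 ≠ 0 := Finset.exists_ne_zero_of_sum_ne_zero (by omega)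
  rw [← Finset.add_sum_erase _ _ hB] at hsum
  have hB2 : B.card = 2 := by omega
  have hrest : ∀ C ∈ σ, C ≠ B → C.card = 1 := fun C hC hCB => by
    have := (Finset.sum_eq_zero_iff.1 (show ∑ C ∈ σ.erase B, (C.card - 1) = 0 by omega)) C
      (Finset.mem_erase.2 ⟨hCB, hC⟩)
    have := h1 C hC
    omega
  obtain ⟨x, y, hxy, rfl⟩ := Finset.card_eq_two.1 hB2
  refine ⟨x, y, hxy, ?_⟩
  ext C
  simp only [pairPart, Finset.mem_insert, Finset.mem_image, Finset.mem_sdiff,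
    Finset.mem_univ, true_and]
  constructor
  · intro hC
    by_cases hCB : C = {x, y}
    · exact Or.inl hCB
    · obtain ⟨z, rfl⟩ := Finset.card_eq_one.1 (hrest C hC hCB)
      exact Or.inr ⟨z, fun hz => hCB (hd _ hC _ hB z (by simp) (by simpa using hz)), rfl⟩
  · rintro (rfl | ⟨z, hz, rfl⟩)
    · exact hB
    · obtain ⟨C, hC, hzC⟩ := hcov z (Finset.mem_univ z)
      have hCB : C ≠ {x, y} := by
        rintro rfl
        exact hz (by simpa using hzC)
      obtain ⟨w, rfl⟩ := Finset.card_eq_one.1 (hrest C hC hCB)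
      rw [Finset.mem_singleton.1 hzC]
      exact hC

theorem pairPart_mem_conn_iff {g : α → Fin 2} {x y : α} (hxy : x ≠ y) :
    pairPart x y ∈ conn g Finset.univ ↔ g x ≠ g y := by
  rw [mem_conn, pre_univ]
  have hmem : ({x, y} : Finset α) ∈ pairPart x y := by simp [pairPart]
  constructor
  · rintro ⟨-, h⟩ hg
    have h2 := h {g x} (Finset.subset_univ _) (Finset.singleton_nonempty _) (by
      intro B hB z hz w hw hgz
      simp only [pairPart, Finset.mem_insert, Finset.mem_image] at hB
      rcases hB with rfl | ⟨v, -, rfl⟩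
      · simp only [Finset.mem_insert, Finset.mem_singleton] at hw ⊢
        rcases hw with rfl | rfl
        · rfl
        · exact hg.symm
      · rw [Finset.mem_singleton.1 hw, ← Finset.mem_singleton.1 hz]
        exact hgz)
    have := congrArg Finset.card h2
    simp at this
  · intro hg
    refine ⟨pairPart_mem_parts x y, fun U _ ⟨s, hs⟩ hcl => ?_⟩
    have hcov : ∀ t : Fin 2, t = g x ∨ t = g y := fun t => by omega
    have key : g x ∈ U ∧ g y ∈ U := by
      rcases hcov s with rfl | rfl
      · exact ⟨hs, hcl _ hmem x (by simp) y (by simp) hs⟩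
      · exact ⟨hcl _ hmem y (by simp) x (by simp) hs, hs⟩
    ext t
    simp only [Finset.mem_univ, iff_true]
    rcases hcov t with rfl | rfl
    · exact key.1
    · exact key.2

theorem pairPart_comm (x y : α) : pairPart x y = pairPart y x := by
  rw [pairPart, pairPart, Finset.pair_comm]

theorem pair_eq_of_pairPart_eq {x y x' y' : α} (hxy : x ≠ y) (h : pairPart x y = pairPart x' y') :
    ({x, y} : Finset α) = {x', y'} := by
  have hmem : ({x, y} : Finset α) ∈ pairPart x' y' := h ▸ by simp [pairPart]
  rcases Finset.mem_insert.1 hmem with h | h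
  · exact h
  · obtain ⟨z, -, hz⟩ := Finset.mem_image.1 h
    have := Finset.card_pair hxy
    rw [← hz, Finset.card_singleton] at this
    omega

end PairPartition

section PairLetters

variable {k : Fin 2 → ℕ}

/-- The partitions of the letters of two words that connect the words and have one block with two
letters are given by one letter of each word. -/
theorem leading_partitions :
    ((conn (Sigma.fst : Letter k → Fin 2) Finset.univ).filter
      fun σ => σ.card + 1 = Fintype.card (Letter k)) =
    (Finset.univ : Finset (Fin (k 0) × Fin (k 1))).image
      fun q => pairPart (⟨0, q.1⟩ : Letter k) ⟨1, q.2⟩ := by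
  ext σ
  simp only [Finset.mem_filter, Finset.mem_image, Finset.mem_univ, true_and]
  constructor
  · rintro ⟨h1, h2⟩
    have hp := (mem_conn.1 h1).1
    rw [pre_univ] at hp
    obtain ⟨x, y, hxy, rfl⟩ := exists_eq_pairPart hp h2
    have hg := (pairPart_mem_conn_iff hxy).1 h1
    obtain ⟨s, i⟩ := x
    obtain ⟨t, i'⟩ := y
    have : (s = 0 ∧ t = 1) ∨ (s = 1 ∧ t = 0) := by
      simp only [ne_eq] at hg
      omega
    rcases this with ⟨rfl, rfl⟩ | ⟨rfl, rfl⟩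
    · exact ⟨(i, i'), rfl⟩
    · exact ⟨(i', i), pairPart_comm _ _⟩
  · rintro ⟨q, rfl⟩
    have hne : (⟨0, q.1⟩ : Letter k) ≠ ⟨1, q.2⟩ := fun h => by
      have := congrArg Sigma.fst h
      simp at this
    exact ⟨(pairPart_mem_conn_iff hne).2 (by simp), card_pairPart hne⟩

theorem card_leading_partitions :
    ((conn (Sigma.fst : Letter k → Fin 2) Finset.univ).filter
      fun σ => σ.card + 1 = Fintype.card (Letter k)).card = k 0 * k 1 := by
  rw [leading_partitions, Finset.card_image_of_injective]
  · simp
  · intro q q' h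
    have hne : (⟨0, q.1⟩ : Letter k) ≠ ⟨1, q.2⟩ := fun h => by
      have := congrArg Sigma.fst h
      simp at this
    have h1 := pair_eq_of_pairPart_eq hne h
    have h2 : (⟨0, q.1⟩ : Letter k) ∈ ({⟨0, q'.1⟩, ⟨1, q'.2⟩} : Finset (Letter k)) :=
      h1 ▸ by simp
    have h3 : (⟨1, q.2⟩ : Letter k) ∈ ({⟨0, q'.1⟩, ⟨1, q'.2⟩} : Finset (Letter k)) :=
      h1 ▸ by simp
    simp at h2 h3
    exact Prod.ext h2 h3

theorem isCyclicOn_letter {r : ℕ} {k : Fin r → ℕ} :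
    IsCyclicOn (Sigma.fst : Letter k → Fin r) nextLetter where
  bijective := by
    refine Finite.injective_iff_bijective.1 ?_
    rintro ⟨s, i⟩ ⟨t, i'⟩ h
    simp only [nextLetter, Sigma.mk.injEq] at h
    obtain ⟨rfl, h⟩ := h
    rw [(finRotate (k s)).injective (eq_of_heq h)]
  fibre _ := rfl
  trans h hn := by
    rintro ⟨s, i⟩ ⟨t, i'⟩ hst
    simp only at hst
    subst hst
    have key : ∀ (l : ℕ) (f : Fin l → ZMod 2), (∀ i, f (finRotate l i) = f i) →
        ∀ i i', f i = f i' := by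
      intro l f hf
      cases l with
      | zero => exact fun i => i.elim0
      | succ l =>
        have h0 : ∀ i, f i = f 0 := fun i => by
          induction i using Fin.induction with
          | zero => rfl
          | succ i ih =>
            rw [← ih, ← hf i.castSucc]
            congr 1
            exact (finRotate_of_lt i.2).symm
        exact fun i i' => (h0 i).trans (h0 i').symm
    exact key _ (fun i => h ⟨s, i⟩) (fun i => hn ⟨s, i⟩) i i'

/-- The letters of two words as a disjoint sum, the words being rotated by `c` and by `d`. -/
def rotateWords {m n : ℕ} (c : Fin (m + 1)) (d : Fin (n + 1)) :
    Letter ![m + 1, n + 1] ≃ Fin (m + 1) ⊕ Fin (n + 1) where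
  toFun
    | ⟨0, i⟩ => Sum.inl ((show Fin (m + 1) from i) + c)
    | ⟨1, i⟩ => Sum.inr ((show Fin (n + 1) from i) + d)
  invFun
    | Sum.inl i => ⟨0, (i - c : Fin (m + 1))⟩
    | Sum.inr i => ⟨1, (i - d : Fin (n + 1))⟩
  left_inv := by
    rintro ⟨s, i⟩
    fin_cases s
    · exact Sigma.ext rfl (heq_of_eq (add_sub_cancel_right (G := Fin (m + 1)) i c))
    · exact Sigma.ext rfl (heq_of_eq (add_sub_cancel_right (G := Fin (n + 1)) i d))
  right_inv := by
    rintro (i | i)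
    · exact congrArg Sum.inl (sub_add_cancel i c)
    · exact congrArg Sum.inr (sub_add_cancel i d)

theorem rotateWords_next {m n : ℕ} (c : Fin (m + 1)) (d : Fin (n + 1))
    (x : Letter ![m + 1, n + 1]) :
    rotateWords c d (nextLetter x) = nextSum (rotateWords c d x) := by
  obtain ⟨s, i⟩ := x
  fin_cases s
  · change Fin (m + 1) at i
    change Sum.inl (finRotate (m + 1) i + c) = Sum.inl (finRotate (m + 1) (i + c))
    rw [finRotate_apply, finRotate_apply, add_right_comm]
  · change Fin (n + 1) at i
    change Sum.inr (finRotate (n + 1) i + d) = Sum.inr (finRotate (n + 1) (i + d))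
    rw [finRotate_apply, finRotate_apply, add_right_comm]

variable {Ω₀ : Type*} [MeasurableSpace Ω₀] {P₀ : Measure Ω₀} [IsProbabilityMeasure P₀]
  {Z : ℤ → Ω₀ → ℝ}

theorem prod_pairCum_pairPart (hs : IsStationary P₀ Z) (hm : MomentConditions P₀ Z) {α : Type*}
    [DecidableEq α] [Fintype α] (u v : α → ℤ) {x y : α} (hxy : x ≠ y) :
    ∏ B ∈ pairPart x y, pairCum P₀ Z u v B =
      pairKernel P₀ Z (u x - v x) (u y - v y) (v y - v x) *
        ∏ z, if z = x ∨ z = y then 1 else autocov P₀ Z (v z - u z) := by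
  rw [prod_pairPart hxy, pairCum_pair hs hm u v hxy]
  congr 1
  refine Finset.prod_congr rfl fun z _ => ?_
  rw [pairCum, cum_singleton, integral_mul_eq_autocov hs hm]

/-- All the leading partitions contribute the same amount: rotating the two words moves the letters
that interact to the ends. -/
theorem sum_leading_partition (hs : IsStationary P₀ Z) (hm : MomentConditions P₀ Z) {m n : ℕ}
    (i : Fin (m + 1)) (i' : Fin (n + 1)) (p : ℕ) (b : ℝ) :
    ∑ j : Letter ![m + 1, n + 1] → Fin p, (∏ x, bandMatrix p b (j x) (j (nextLetter x))) *
      ∏ B ∈ pairPart (⟨0, i⟩ : Letter ![m + 1, n + 1]) ⟨1, i'⟩,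
        pairCum P₀ Z (pos j) (fun x => pos j (nextLetter x)) B =
    ∑ j : Fin (m + 1) ⊕ Fin (n + 1) → Fin p,
      (∏ x, bandMatrix p b (j x) (j (nextSum x))) * wordWeight P₀ Z (pos j) := by
  set e := rotateWords (Fin.last m - i) (Fin.last n - i') with he
  have e0 : e ⟨0, i⟩ = Sum.inl (Fin.last m) := congrArg Sum.inl (add_sub_cancel i (Fin.last m))
  have e1 : e ⟨1, i'⟩ = Sum.inr (Fin.last n) := congrArg Sum.inr (add_sub_cancel i' (Fin.last n))
  have hne : (⟨0, i⟩ : Letter ![m + 1, n + 1]) ≠ ⟨1, i'⟩ := fun h => by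
    have := congrArg Sigma.fst h
    simp at this
  rw [← (e.arrowCongr (Equiv.refl (Fin p))).symm.sum_comp]
  refine Finset.sum_congr rfl fun j _ => ?_
  have hj : ∀ x, (e.arrowCongr (Equiv.refl (Fin p))).symm j x = j (e x) := fun x => rfl
  have hp : ∀ x, pos ((e.arrowCongr (Equiv.refl (Fin p))).symm j) x = pos j (e x) := fun x => rfl
  have hn : ∀ x, e (nextLetter x) = nextSum (e x) := rotateWords_next _ _
  have l0 : nextSum (Sum.inl (Fin.last m) : Fin (m + 1) ⊕ Fin (n + 1)) = Sum.inl 0 :=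
    congrArg Sum.inl finRotate_last
  have l1 : nextSum (Sum.inr (Fin.last n) : Fin (m + 1) ⊕ Fin (n + 1)) = Sum.inr 0 :=
    congrArg Sum.inr finRotate_last
  rw [prod_pairCum_pairPart hs hm _ _ hne]
  simp only [hj, hp, hn, e0, e1, l0, l1]
  rw [e.prod_comp (fun x => bandMatrix p b (j x) (j (nextSum x))), wordWeight,
    ← e.prod_comp (fun x => if x = Sum.inl (Fin.last m) ∨ x = Sum.inr (Fin.last n) then 1
      else autocov P₀ Z (pos j (nextSum x) - pos j x))]
  simp only [← e0, ← e1, e.injective.eq_iff]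

end PairLetters

/-! ### The asymptotics of the joint cumulants -/

section Asymptotics

variable {Ω Ω₀ : Type*} [MeasurableSpace Ω] [MeasurableSpace Ω₀]
  {P : Measure Ω} [IsProbabilityMeasure P] {P₀ : Measure Ω₀} [IsProbabilityMeasure P₀]
  {W : ℕ → ℤ → Ω → ℝ} {Z : ℤ → Ω₀ → ℝ} {r : ℕ}

/-- The contribution of the partition `σ` to the joint cumulant of the traces, up to its power
of the number of samples. -/
def partitionSum (P₀ : Measure Ω₀) (Z : ℤ → Ω₀ → ℝ) (k : Fin r → ℕ) (p : ℕ) (b : ℝ)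
    (σ : Finset (Finset (Letter k))) : ℝ :=
  ∑ j : Letter k → Fin p, (∏ x, bandMatrix p b (j x) (j (nextLetter x))) *
    ∏ A ∈ σ, pairCum P₀ Z (pos j) (fun x => pos j (nextLetter x)) A

theorem jointCumulant_trace_eq_sum (hW : IsIIDCopies P P₀ W Z) (hZ : ∀ j, HasMoments P₀ (Z j))
    (n p : ℕ) (b : ℝ) (hr : 0 < r) (k : Fin r → ℕ) (hk : ∀ s, 0 < k s) :
    jointCumulant P (fun s ω => ((bandedCov W n p b ω) ^ (k s)).trace) =
      ∑ σ ∈ conn (Sigma.fst : Letter k → Fin r) Finset.univ,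
        (n : ℝ)⁻¹ ^ Fintype.card (Letter k) * (n : ℝ) ^ σ.card * partitionSum P₀ Z k p b σ := by
  rw [jointCumulant_trace hW hZ n p b hr k hk]
  simp only [Finset.mul_sum]
  rw [Finset.sum_comm]
  refine Finset.sum_congr rfl fun σ hσ => ?_
  have hσ' := (mem_conn.1 hσ).1
  rw [pre_univ] at hσ'
  rw [partitionSum, Finset.mul_sum]
  refine Finset.sum_congr rfl fun j _ => ?_
  rw [Finset.prod_mul_distrib, Finset.prod_mul_distrib, Finset.prod_pow_eq_pow_sum,
    sum_card_parts hσ', Finset.prod_const]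
  change _ * (_ * ∏ A ∈ σ, pairCum P₀ Z (pos j) (fun x => pos j (nextLetter x)) A) = _
  ring

theorem abs_partitionSum_le (k : Fin r → ℕ) (p : ℕ) (b : ℝ) (σ : Finset (Finset (Letter k))) :
    |partitionSum P₀ Z k p b σ| ≤
      ∑ j : Letter k → Fin p, (∏ x, bandMatrix p b (j x) (j (nextLetter x))) *
        ∏ A ∈ σ, |pairCum P₀ Z (pos j) (fun x => pos j (nextLetter x)) A| := by
  refine (Finset.abs_sum_le_sum_abs _ _).trans (Finset.sum_le_sum fun j _ => ?_)
  rw [abs_mul, Finset.abs_prod, Finset.abs_prod]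
  simp only [abs_of_nonneg (bandMatrix_nonneg _ _ _ _)]
  rfl

/-- The powers of `n`, `p` and `b` in the bound for a partition with `d + 1` fewer blocks than
letters. -/
theorem scaling_identity {n p b h : ℝ} (hn : 0 < n) (hp : 0 < p) (hb : 0 < b) (d : ℕ) :
    (n / p) ^ h * (n⁻¹ ^ (d + 1) * (p * b ^ d)) =
      (b / n) ^ (((d + 1 : ℕ) : ℝ) - h) * (b / p) ^ (h - 1) := by
  rw [Real.div_rpow hn.le hp.le, Real.div_rpow hb.le hn.le, Real.div_rpow hb.le hp.le,
    Real.rpow_sub hb, Real.rpow_sub hn, Real.rpow_sub hb, Real.rpow_sub hp, Real.rpow_natCast,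
    Real.rpow_natCast, Real.rpow_one, Real.rpow_one]
  have h1 := (Real.rpow_pos_of_pos hn h).ne'
  have h2 := (Real.rpow_pos_of_pos hp h).ne'
  have h3 := (Real.rpow_pos_of_pos hb h).ne'
  rw [pow_succ b, inv_pow]
  field_simp

/-- The partitions with few blocks are negligible: their contribution is of order
`(b / n) ^ (d + 1 - r / 2) * (b / p) ^ (r / 2 - 1)`, where `b ≤ p`. -/
theorem tendsto_minor (hs : IsStationary P₀ Z) (hm : MomentConditions P₀ Z) {n : ℕ → ℕ}
    {b : ℕ → ℝ} (hg : GrowthConditions n b) (hr : 1 < r) (k : Fin r → ℕ)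
    {σ : Finset (Finset (Letter k))}
    (hσ : σ ∈ conn (Sigma.fst : Letter k → Fin r) Finset.univ) {d : ℕ}
    (hd : σ.card + (d + 1) = Fintype.card (Letter k)) (hrd : (r : ℝ) / 2 < ((d + 1 : ℕ) : ℝ)) :
    Tendsto (fun p : ℕ => ((n p : ℝ) / p) ^ ((r : ℝ) / 2) *
      ((n p : ℝ)⁻¹ ^ Fintype.card (Letter k) * (n p : ℝ) ^ σ.card *
        partitionSum P₀ Z k p (b p) σ)) atTop (𝓝 0) := by
  obtain ⟨M, hM⟩ := partition_bound hs hm isCyclicOn_letter (by simpa using hr) hσ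
  have hlim : Tendsto (fun p => |M| * (b p / n p) ^ (((d + 1 : ℕ) : ℝ) - (r : ℝ) / 2)) atTop
      (𝓝 0) := by
    have := hg.ratio_tendsto.rpow_const (p := ((d + 1 : ℕ) : ℝ) - (r : ℝ) / 2)
      (Or.inr (sub_pos.2 hrd).le)
    rw [Real.zero_rpow (sub_pos.2 hrd).ne'] at this
    simpa using this.const_mul |M|
  refine squeeze_zero_norm' ?_ hlim
  filter_upwards [eventually_gt_atTop 0, hg.b_tendsto.eventually_ge_atTop 1] with p hp hb
  have hp' : (0 : ℝ) < p := by exact_mod_cast hp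
  have hn' : (0 : ℝ) < n p := by exact_mod_cast hg.n_pos p hp
  have hb' := hg.b_pos p hp
  have e : (n p : ℝ)⁻¹ ^ Fintype.card (Letter k) * (n p : ℝ) ^ σ.card = (n p : ℝ)⁻¹ ^ (d + 1) := by
    rw [← hd, pow_add, mul_right_comm, ← mul_pow, inv_mul_cancel₀ hn'.ne', one_pow, one_mul]
  have h1 := (abs_partitionSum_le (P₀ := P₀) (Z := Z) k p (b p) σ).trans (hM p (b p) hb)
  rw [← hd, show σ.card + (d + 1) - σ.card - 1 = d by omega] at h1
  have h2 : |partitionSum P₀ Z k p (b p) σ| ≤ |M| * (p * b p ^ d) := by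
    refine h1.trans ?_
    rw [mul_assoc]
    exact mul_le_mul_of_nonneg_right (le_abs_self M) (by positivity)
  have h3 : (b p / p) ^ ((r : ℝ) / 2 - 1) ≤ 1 := by
    refine Real.rpow_le_one (by positivity) ((div_le_one hp').2 (hg.b_le p hp)) ?_
    have : (2 : ℝ) ≤ r := by exact_mod_cast hr
    linarith
  rw [e, Real.norm_eq_abs, abs_mul, abs_mul, abs_of_nonneg (by positivity :
    (0 : ℝ) ≤ ((n p : ℝ) / p) ^ ((r : ℝ) / 2)), abs_of_nonneg (by positivity :
    (0 : ℝ) ≤ (n p : ℝ)⁻¹ ^ (d + 1))]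
  calc ((n p : ℝ) / p) ^ ((r : ℝ) / 2) *
        ((n p : ℝ)⁻¹ ^ (d + 1) * |partitionSum P₀ Z k p (b p) σ|)
      ≤ ((n p : ℝ) / p) ^ ((r : ℝ) / 2) * ((n p : ℝ)⁻¹ ^ (d + 1) * (|M| * (p * b p ^ d))) := by
        gcongr
    _ = |M| * (((n p : ℝ) / p) ^ ((r : ℝ) / 2) * ((n p : ℝ)⁻¹ ^ (d + 1) * (p * b p ^ d))) := by
        ring
    _ = |M| * ((b p / n p) ^ (((d + 1 : ℕ) : ℝ) - (r : ℝ) / 2) *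
          (b p / p) ^ ((r : ℝ) / 2 - 1)) := by
        rw [scaling_identity hn' hp' hb']
    _ ≤ |M| * ((b p / n p) ^ (((d + 1 : ℕ) : ℝ) - (r : ℝ) / 2) * 1) := by
        gcongr
    _ = _ := by rw [mul_one]

theorem card_conn_letter_add_le {k : Fin r → ℕ} (hk : ∀ s, 0 < k s) {σ : Finset (Finset (Letter k))}
    (hσ : σ ∈ conn (Sigma.fst : Letter k → Fin r) Finset.univ) :
    σ.card + r ≤ Fintype.card (Letter k) + 1 := by
  have := card_conn_add_le (g := (Sigma.fst : Letter k → Fin r)) (fun s => ⟨⟨s, ⟨0, hk s⟩⟩, rfl⟩) hσ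
  simpa using this

theorem tendsto_of_two_lt (hs : IsStationary P₀ Z) (hm : MomentConditions P₀ Z)
    (hW : IsIIDCopies P P₀ W Z) {n : ℕ → ℕ} {b : ℕ → ℝ} (hg : GrowthConditions n b)
    (hr : 2 < r) (k : Fin r → ℕ) (hk : ∀ s, 0 < k s) :
    Tendsto (fun p : ℕ => ((n p : ℝ) / (p : ℝ)) ^ ((r : ℝ) / 2) * jointCumulant P
      (fun (s : Fin r) (ω : Ω) => ((bandedCov W (n p) p (b p) ω) ^ (k s)).trace)) atTop (𝓝 0) := by
  simp only [jointCumulant_trace_eq_sum hW (hs.hasMoments hm) _ _ _ (by omega : 0 < r) k hk,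
    Finset.mul_sum]
  have h0 : ∑ _σ ∈ conn (Sigma.fst : Letter k → Fin r) Finset.univ, (0 : ℝ) = 0 :=
    Finset.sum_const_zero
  refine h0 ▸ tendsto_finsetSum _ fun σ hσ => ?_
  have h1 := card_conn_letter_add_le hk hσ
  obtain ⟨d, hd⟩ : ∃ d, σ.card + (d + 1) = Fintype.card (Letter k) :=
    ⟨Fintype.card (Letter k) - σ.card - 1, by omega⟩
  refine tendsto_minor hs hm hg (by omega) k hσ hd ?_
  have h2 : r ≤ d + 2 := by omega
  have h3 : (r : ℝ) ≤ d + 2 := by exact_mod_cast h2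
  have h4 : (2 : ℝ) < r := by exact_mod_cast hr
  push_cast
  linarith

theorem tendsto_two (hs : IsStationary P₀ Z) (hm : MomentConditions P₀ Z)
    (hW : IsIIDCopies P P₀ W Z) {n : ℕ → ℕ} {b : ℕ → ℝ} (hg : GrowthConditions n b) (l l' : ℕ) :
    Tendsto (fun p : ℕ => ((n p : ℝ) / (p : ℝ)) ^ ((2 : ℝ) / 2) * jointCumulant P
      (fun (s : Fin 2) (ω : Ω) => ((bandedCov W (n p) p (b p) ω) ^ (![l + 1, l' + 1] s)).trace))
      atTop (𝓝 (((l + 1 : ℕ) : ℝ) * ((l' + 1 : ℕ) : ℝ) * (2 * autocovPow P₀ Z (l + l' + 2) 0 +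
        ∑' ij : ℤ × ℤ,
          autocovPow P₀ Z l ij.1 * Q P₀ Z ij.1 ij.2 * autocovPow P₀ Z l' ij.2))) := by
  set Λ := 2 * autocovPow P₀ Z (l + l' + 2) 0 + ∑' ij : ℤ × ℤ,
    autocovPow P₀ Z l ij.1 * Q P₀ Z ij.1 ij.2 * autocovPow P₀ Z l' ij.2 with hΛ
  set k : Fin 2 → ℕ := ![l + 1, l' + 1] with hkdef
  have hk : ∀ s, 0 < k s := fun s => by fin_cases s <;> simp [hkdef]
  simp only [jointCumulant_trace_eq_sum hW (hs.hasMoments hm) _ _ _ (by omega : 0 < 2) k hk,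
    Finset.mul_sum]
  have e : ((l + 1 : ℕ) : ℝ) * ((l' + 1 : ℕ) : ℝ) * Λ =
      ∑ σ ∈ conn (Sigma.fst : Letter k → Fin 2) Finset.univ,
        if σ.card + 1 = Fintype.card (Letter k) then Λ else 0 := by
    rw [← Finset.sum_filter, Finset.sum_const, card_leading_partitions, nsmul_eq_mul]
    simp [hkdef]
  rw [e]
  refine tendsto_finsetSum _ fun σ hσ => ?_
  split_ifs with hc
  · have hmem : σ ∈ (conn (Sigma.fst : Letter k → Fin 2) Finset.univ).filter
        fun σ => σ.card + 1 = Fintype.card (Letter k) := Finset.mem_filter.2 ⟨hσ, hc⟩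
    rw [leading_partitions] at hmem
    obtain ⟨q, -, hq⟩ := Finset.mem_image.1 hmem
    refine (tendsto_wordWeight hs hm l l' hg.b_tendsto).congr' ?_
    filter_upwards [eventually_gt_atTop 0] with p hp
    have hn' : (n p : ℝ) ≠ 0 := by exact_mod_cast (hg.n_pos p hp).ne'
    rw [← sum_leading_partition hs hm q.1 q.2]
    have e1 : (n p : ℝ)⁻¹ ^ Fintype.card (Letter k) * (n p : ℝ) ^ σ.card = (n p : ℝ)⁻¹ := by
      rw [← hc, pow_succ, mul_right_comm, ← mul_pow, inv_mul_cancel₀ hn', one_pow, one_mul]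
    rw [e1, div_self two_ne_zero, Real.rpow_one, ← mul_assoc, div_mul_eq_mul_div,
      mul_inv_cancel₀ hn', one_div, ← hq]
    rfl
  · have h1 := card_conn_letter_add_le hk hσ
    obtain ⟨d, hd⟩ : ∃ d, σ.card + (d + 1) = Fintype.card (Letter k) :=
      ⟨Fintype.card (Letter k) - σ.card - 1, by omega⟩
    have := tendsto_minor hs hm hg (by omega) k hσ hd (by
      have : 1 ≤ d := by omega
      have : (1 : ℝ) ≤ d := by exact_mod_cast this
      push_cast
      linarith)
    exact_mod_cast this

end Asymptotics

end

end BandedCovariance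

theorem proposition8p1
    {Ω₀ : Type*} [MeasurableSpace Ω₀] (P₀ : Measure Ω₀) [IsProbabilityMeasure P₀]
    (Z : ℤ → Ω₀ → ℝ)
    (hstat : BandedCovariance.IsStationary P₀ Z)
    (hmom : BandedCovariance.MomentConditions P₀ Z)
    {Ω : Type*} [MeasurableSpace Ω] (P : Measure Ω) [IsProbabilityMeasure P]
    (W : ℕ → ℤ → Ω → ℝ)
    (hW : BandedCovariance.IsIIDCopies P P₀ W Z)
    (n : ℕ → ℕ) (b : ℕ → ℝ)
    (hgrowth : BandedCovariance.GrowthConditions n b) :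
    -- the series that define the limit converge absolutely
    (∀ (m : ℕ) (i : ℤ), Summable (fun l : ℤ =>
      |BandedCovariance.autocov P₀ Z (i - l) * BandedCovariance.autocovPow P₀ Z m l|)) ∧
    (∀ i j : ℤ, Summable (fun l : ℤ => |BandedCovariance.QTerm P₀ Z i j l|)) ∧
    -- the case of more than two traces
    (∀ (r : ℕ), 2 < r → ∀ k : Fin r → ℕ, (∀ s, 0 < k s) →
      Tendsto
        (fun p : ℕ => ((n p : ℝ) / (p : ℝ)) ^ ((r : ℝ) / 2) *
          BandedCovariance.jointCumulant P
            (fun (s : Fin r) (ω : Ω) =>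
              ((BandedCovariance.bandedCov W (n p) p (b p) ω) ^ (k s)).trace))
        atTop (𝓝 0)) ∧
    -- the case of two traces
    (∀ k₁ k₂ : ℕ, 0 < k₁ → 0 < k₂ →
      Summable (fun ij : ℤ × ℤ =>
        |BandedCovariance.autocovPow P₀ Z (k₁ - 1) ij.1 * BandedCovariance.Q P₀ Z ij.1 ij.2 *
          BandedCovariance.autocovPow P₀ Z (k₂ - 1) ij.2|) ∧
      Tendsto
        (fun p : ℕ => ((n p : ℝ) / (p : ℝ)) ^ ((2 : ℝ) / 2) *
          BandedCovariance.jointCumulant P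
            ![fun ω : Ω => ((BandedCovariance.bandedCov W (n p) p (b p) ω) ^ k₁).trace,
              fun ω : Ω => ((BandedCovariance.bandedCov W (n p) p (b p) ω) ^ k₂).trace])
        atTop
        (𝓝 ((k₁ : ℝ) * (k₂ : ℝ) *
          (2 * BandedCovariance.autocovPow P₀ Z (k₁ + k₂) 0 +
            ∑' ij : ℤ × ℤ,
              BandedCovariance.autocovPow P₀ Z (k₁ - 1) ij.1 * BandedCovariance.Q P₀ Z ij.1 ij.2 *
                BandedCovariance.autocovPow P₀ Z (k₂ - 1) ij.2)))) := by
  refine ⟨fun m i => BandedCovariance.summable_conv_term hstat hmom m i,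
    fun i j => BandedCovariance.summable_abs_QTerm hstat hmom i j,
    fun r hr k hk => BandedCovariance.tendsto_of_two_lt hstat hmom hW hgrowth hr k hk,
    fun k₁ k₂ h₁ h₂ => ?_⟩
  obtain ⟨l, rfl⟩ := Nat.exists_eq_succ_of_ne_zero h₁.ne'
  obtain ⟨l', rfl⟩ := Nat.exists_eq_succ_of_ne_zero h₂.ne'
  refine ⟨(BandedCovariance.summable_pow_Q_pow hstat hmom l l').abs, ?_⟩
  have h := BandedCovariance.tendsto_two hstat hmom hW hgrowth l l'
  have e : ∀ p, (fun (s : Fin 2) (ω : Ω) =>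
      ((BandedCovariance.bandedCov W (n p) p (b p) ω) ^ (![l + 1, l' + 1] s)).trace) =
      ![fun ω : Ω => ((BandedCovariance.bandedCov W (n p) p (b p) ω) ^ (l + 1)).trace,
        fun ω : Ω => ((BandedCovariance.bandedCov W (n p) p (b p) ω) ^ (l' + 1)).trace] := fun p => by
    funext s
    fin_cases s <;> rfl
  simp only [e] at h
  rw [show l.succ + l'.succ = l + l' + 2 by omega]
  exact h
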